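/- **Theorem (comparison).** Let $T>0$ and let $D\subset\mathbb R^d$ be a domain (a nonempty connected open set). For $x\in\partial D$ and $r>0$ put $N_{x,r}=\{\mathbf n\in\mathbb R^d: |\mathbf n|=1,\ B(x-r\mathbf n,r)\cap D=\emptyset\}$ ($B$ denotes open balls) and $N_x=\bigcup_{r>0}N_{x,r}$. Assume: - (A) there is $r_0>0$ such that $N_x=N_{x,4r_0}\neq\emptyset$ for all $x\in\partial D$; - (B) there are $\delta>0$, $\beta\ge 1$ such that for every $x\in\partial D$ there is a unit vector $l_x$ with $\langle l_x,\mathbf n\rangle\ge 1/\beta$ for all $\mathbf n\in\bigcup_{y\in B(x,\delta)\cap\partial D}N_y$; - (C) there are $f\in C^2(\mathbb R^d)$ with bounded derivatives of order $\le 2$ and $|f|\le1$, and $\gamma>0$, such that $Df(x)\cdot\mathbf n\ge\gamma/(8r_0)$ for all $x\in\partial D$, $\mathbf n\in N_x$, with $r_0$ as in (A). Let $\mathcal S^d$ be the space of real symmetric $d\times d$ matrices and let $H:[0,T]\times\bar D\times\mathbb R\times\mathbb R^d\times\mathcal S^d\to\mathbb R$ be continuous and such that: - (H1) for all reals $r\le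 r'$ there is $\gamma>0$ with $\gamma(r'-r)\le H(t,x,r',q,X)-H(t,x,r,q,X)$ for all $(t,x,q,X)\in[0,T]\times\bar D\times\mathbb R^d\times\mathcal S^d$; - (H2) there is a continuous nondecreasing $\omega_1:[0,\infty)\to[0,\infty)$ with $\omega_1(0)=0$ and $|H(t,x,r,q_1,X)-H(t,x,r,q_2,Y)|\le\omega_1(|q_1-q_2|+\|X-Y\|)$ for all $(t,x,r)\in(0,T)\times\bar D\times\mathbb R$, $q_1,q_2\in\mathbb R^d$, $X,Y\in\mathcal S^d$; - (H3) there is a continuous nondecreasing $\omega_2:[0,\infty)\to[0,\infty)$ with $\omega_2(0)=0$ and $$H(t,y,r,\alpha(x-y),Y)-H(t,x,r,\alpha(x-y),X)\le\omega_2\big(|x-y|(1+\alpha|x-y|)\big)$$ for all $t\in[0,T]$, $x,y\in D$, $r\in\mathbb R$, $\alpha>1$ and $X,Y\in\mathcal S^d$ satisfying $$-3\alpha\begin{pmatrix}I&0\\0&I\end{pmatrix}\le\begin{pmatrix}X&0\\0&-Y\end{pmatrix}\le3\alpha\begin{pmatrix}I&-I\\-I&I\end{pmatrix}.$$ Let $h:\bar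 D\to\mathbb R$ be a function and consider the problem $$-\partial_tu+H(t,x,u,Du,D^2u)=0\ \text{in }(0,T)\times D,\qquad -\frac{\partial u}{\partial\mathbf n}=0\ \text{on }(0,T)\times\partial D,\qquad u(T,\cdot)=h\ \text{on }\bar D.\tag{1}$$ For $x\in\partial D$ and $q\in\mathbb R^d$ put $N_x^-(q)=\inf_{\mathbf n\in N_x}\langle q,-\mathbf n\rangle$ and $N_x^+(q)=\sup_{\mathbf n\in N_x}\langle q,-\mathbf n\rangle$. Let $C^{1,2}((0,T)\times\bar D)$ be the set of functions $\phi$ for which $\phi$, $\partial_t\phi$, $D_x\phi$, $D_x^2\phi$ exist on $(0,T)\times D$, are bounded there, and extend continuously to $(0,T)\times\bar D$. A *viscosity subsolution* of (1) is an upper semicontinuous $u:(0,T]\times\bar D\to\mathbb R$ with $u(T,\cdot)\le h$ on $\bar D$ such that, for every $\phi\in C^{1,2}((0,T)\times\bar D)$ and every local maximum point $(t,x)\in(0,T)\times\bar D$ of $u-\phi$ relative to $(0,T)\times\bar D$, $$-\partial_t\phi(t,x)+H(t,x,u(t,x),D_x\phi,D_x^2\phi)\le0\quad\text{if }x\in D,$$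 $$\min\{-\partial_t\phi(t,x)+H(t,x,u(t,x),D_x\phi,D_x^2\phi),\,N_x^-(D_x\phi)\}\le0\quad\text{if }x\in\partial D.$$ A *viscosity supersolution* of (1) is a lower semicontinuous $v:(0,T]\times\bar D\to\mathbb R$ with $v(T,\cdot)\ge h$ on $\bar D$ that satisfies the corresponding conditions at local minimum points of $v-\phi$, with $\le0$, $\min$, $N_x^-$ replaced by $\ge0$, $\max$, $N_x^+$. If $u$ is a viscosity subsolution of (1) bounded above and $v$ is a viscosity supersolution of (1) bounded below, then $u\le v$ on $(0,T]\times\bar D$. -/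

import Mathlib

open Set
open scoped MatrixOrder

noncomputable section

namespace NeumannComparison

/-- `ℝ^d` with the Euclidean norm. -/
abbrev E (d : ℕ) : Type := EuclideanSpace ℝ (Fin d)

/-- The space of real symmetric `d × d` matrices. -/
abbrev Sym (d : ℕ) : Type := {X : Matrix (Fin d) (Fin d) ℝ // X.IsSymm}

/-- The linear operator on `ℝ^d` given by a matrix; its norm is the operator norm of the matrix. -/
abbrev opOf {d : ℕ} (X : Matrix (Fin d) (Fin d) ℝ) : E d →L[ℝ] E d :=
  Matrix.toEuclideanCLM (n := Fin d) (𝕜 := ℝ) X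

/-! ### The domain -/

/-- `N_{x,r}`: the unit vectors `n` such that `B(x - r n, r)` does not meet `D`. -/
def normalsAt {d : ℕ} (D : Set (E d)) (x : E d) (r : ℝ) : Set (E d) :=
  {n | ‖n‖ = 1 ∧ Metric.ball (x - r • n) r ∩ D = ∅}

/-- `N_x`: the inner unit normals at `x`. -/
def normals {d : ℕ} (D : Set (E d)) (x : E d) : Set (E d) :=
  ⋃ r ∈ Ioi (0 : ℝ), normalsAt D x r

/-- Uniform exterior sphere condition with constant `r₀`. -/
def CondA {d : ℕ} (D : Set (E d)) (r₀ : ℝ) : Prop :=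
  0 < r₀ ∧ ∀ x ∈ frontier D, normals D x = normalsAt D x (4 * r₀) ∧ (normals D x).Nonempty

/-- Uniform interior cone condition. -/
def CondB {d : ℕ} (D : Set (E d)) : Prop :=
  ∃ δ β : ℝ, 0 < δ ∧ 1 ≤ β ∧ ∀ x ∈ frontier D, ∃ l : E d, ‖l‖ = 1 ∧
    ∀ y ∈ Metric.ball x δ ∩ frontier D, ∀ n ∈ normals D y, 1 / β ≤ inner ℝ l n

/-- `f` is of class `C²` and its derivatives of order `0, 1, 2` are bounded on `ℝ^d`. -/
def IsCb2 {d : ℕ} (f : E d → ℝ) : Prop :=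
  ContDiff ℝ 2 f ∧ ∀ k : ℕ, k ≤ 2 → ∃ C : ℝ, ∀ x, ‖iteratedFDeriv ℝ k f x‖ ≤ C

/-- Existence of a bounded `C²` function whose derivative along every inner normal is bounded
below by a positive constant. -/
def CondC {d : ℕ} (D : Set (E d)) (r₀ : ℝ) : Prop :=
  ∃ f : E d → ℝ, IsCb2 f ∧ (∀ x, |f x| ≤ 1) ∧ ∃ γ : ℝ, 0 < γ ∧
    ∀ x ∈ frontier D, ∀ n ∈ normals D x, γ / (8 * r₀) ≤ fderiv ℝ f x n

/-! ### The Hamiltonian -/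

/-- The type of the nonlinearity `H(t, x, r, q, Q)`. -/
abbrev Ham (d : ℕ) : Type := ℝ → E d → ℝ → E d → Sym d → ℝ

/-- `H` is continuous on `[0,T] × D̄ × ℝ × ℝ^d × S^d`. -/
def HamContinuous {d : ℕ} (T : ℝ) (D : Set (E d)) (H : Ham d) : Prop :=
  ContinuousOn (fun z : ℝ × E d × ℝ × E d × Sym d => H z.1 z.2.1 z.2.2.1 z.2.2.2.1 z.2.2.2.2)
    (Icc 0 T ×ˢ closure D ×ˢ univ)

/-- A modulus: a continuous nondecreasing function on `[0,∞)` that vanishes at `0`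
(hence is nonnegative there). -/
structure IsModulus (ω : ℝ → ℝ) : Prop where
  continuousOn : ContinuousOn ω (Ici 0)
  monotoneOn : MonotoneOn ω (Ici 0)
  zero : ω 0 = 0

/-- Strict monotonicity in the unknown; the constant may depend on `r` and `r'`. -/
def HypH1 {d : ℕ} (T : ℝ) (D : Set (E d)) (H : Ham d) : Prop :=
  ∀ r r' : ℝ, r ≤ r' → ∃ γ : ℝ, 0 < γ ∧
    ∀ t ∈ Icc 0 T, ∀ x ∈ closure D, ∀ (q : E d) (X : Sym d),
      γ * (r' - r) ≤ H t x r' q X - H t x r q X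

/-- Uniform continuity in the gradient and Hessian variables. -/
def HypH2 {d : ℕ} (T : ℝ) (D : Set (E d)) (H : Ham d) : Prop :=
  ∃ ω : ℝ → ℝ, IsModulus ω ∧
    ∀ t ∈ Ioo 0 T, ∀ x ∈ closure D, ∀ (r : ℝ) (q₁ q₂ : E d) (X Y : Sym d),
      |H t x r q₁ X - H t x r q₂ Y| ≤ ω (‖q₁ - q₂‖ + ‖opOf (X.1 - Y.1)‖)

/-- `-3α [I 0; 0 I] ≤ [X 0; 0 -Y] ≤ 3α [I -I; -I I]` as quadratic forms on `ℝ^d × ℝ^d`. -/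
def MatrixIneq {d : ℕ} (α : ℝ) (X Y : Sym d) : Prop :=
  (-(3 * α)) • Matrix.fromBlocks 1 0 0 1 ≤ Matrix.fromBlocks X.1 0 0 (-Y.1) ∧
    Matrix.fromBlocks X.1 0 0 (-Y.1) ≤ (3 * α) • Matrix.fromBlocks 1 (-1) (-1) 1

/-- The structure condition linking the space variable and the Hessian variable. -/
def HypH3 {d : ℕ} (T : ℝ) (D : Set (E d)) (H : Ham d) : Prop :=
  ∃ ω : ℝ → ℝ, IsModulus ω ∧
    ∀ t ∈ Icc 0 T, ∀ x ∈ D, ∀ y ∈ D, ∀ (r : ℝ) (X Y : Sym d) (α : ℝ), 1 < α →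
      MatrixIneq α X Y →
      H t y r (α • (x - y)) Y - H t x r (α • (x - y)) X ≤ ω (‖x - y‖ * (1 + α * ‖x - y‖))

/-! ### Viscosity sub- and supersolutions -/

/-- `φ` belongs to `C^{1,2}((0,T) × D̄)`: `φt`, `Dφ`, `D2φ` are its time derivative, spatial
gradient and spatial Hessian on `(0,T) × D`, and all four functions are bounded and continuous on
`(0,T) × D̄`. At boundary points the derivatives are thereby the continuous extensions. -/
structure IsC12 {d : ℕ} (T : ℝ) (D : Set (E d)) (φ φt : ℝ → E d → ℝ) (Dφ : ℝ → E d → E d)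
    (D2φ : ℝ → E d → Sym d) : Prop where
  time_deriv : ∀ t ∈ Ioo 0 T, ∀ x ∈ D, HasDerivAt (fun s => φ s x) (φt t x) t
  gradient : ∀ t ∈ Ioo 0 T, ∀ x ∈ D, HasGradientAt (φ t) (Dφ t x) x
  hessian : ∀ t ∈ Ioo 0 T, ∀ x ∈ D, HasFDerivAt (Dφ t) (opOf (D2φ t x).1) x
  cont : ContinuousOn (fun z : ℝ × E d => φ z.1 z.2) (Ioo 0 T ×ˢ closure D)
  cont_time : ContinuousOn (fun z : ℝ × E d => φt z.1 z.2) (Ioo 0 T ×ˢ closure D)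
  cont_gradient : ContinuousOn (fun z : ℝ × E d => Dφ z.1 z.2) (Ioo 0 T ×ˢ closure D)
  cont_hessian : ContinuousOn (fun z : ℝ × E d => D2φ z.1 z.2) (Ioo 0 T ×ˢ closure D)
  bounded : ∃ C : ℝ, ∀ t ∈ Ioo 0 T, ∀ x ∈ closure D,
    |φ t x| ≤ C ∧ |φt t x| ≤ C ∧ ‖Dφ t x‖ ≤ C ∧ ‖opOf (D2φ t x).1‖ ≤ C

/-- `N⁻_x(q) = inf_{n ∈ N_x} ⟨q, -n⟩`. -/
def normalInf {d : ℕ} (D : Set (E d)) (x q : E d) : ℝ :=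
  sInf ((fun n : E d => inner ℝ q (-n)) '' normals D x)

/-- `N⁺_x(q) = sup_{n ∈ N_x} ⟨q, -n⟩`. -/
def normalSup {d : ℕ} (D : Set (E d)) (x q : E d) : ℝ :=
  sSup ((fun n : E d => inner ℝ q (-n)) '' normals D x)

/-- Viscosity subsolution of the terminal value problem `-∂_t u + H(t, x, u, Du, D²u) = 0` in
`(0,T) × D`, `-∂u/∂n = 0` on `(0,T) × ∂D`, `u(T,·) = h` on `D̄`. Only the values of `u` on
`(0,T] × D̄` matter. -/
structure IsSubsolution {d : ℕ} (T : ℝ) (D : Set (E d)) (H : Ham d) (h : E d → ℝ)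
    (u : ℝ → E d → ℝ) : Prop where
  usc : UpperSemicontinuousOn (fun z : ℝ × E d => u z.1 z.2) (Ioc 0 T ×ˢ closure D)
  terminal : ∀ x ∈ closure D, u T x ≤ h x
  interior : ∀ φ φt Dφ D2φ, IsC12 T D φ φt Dφ D2φ → ∀ t ∈ Ioo 0 T, ∀ x ∈ D,
    IsLocalMaxOn (fun z : ℝ × E d => u z.1 z.2 - φ z.1 z.2) (Ioo 0 T ×ˢ closure D) (t, x) →
    -φt t x + H t x (u t x) (Dφ t x) (D2φ t x) ≤ 0
  boundary : ∀ φ φt Dφ D2φ, IsC12 T D φ φt Dφ D2φ → ∀ t ∈ Ioo 0 T, ∀ x ∈ frontier D,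
    IsLocalMaxOn (fun z : ℝ × E d => u z.1 z.2 - φ z.1 z.2) (Ioo 0 T ×ˢ closure D) (t, x) →
    min (-φt t x + H t x (u t x) (Dφ t x) (D2φ t x)) (normalInf D x (Dφ t x)) ≤ 0

/-- Viscosity supersolution of the same problem. -/
structure IsSupersolution {d : ℕ} (T : ℝ) (D : Set (E d)) (H : Ham d) (h : E d → ℝ)
    (v : ℝ → E d → ℝ) : Prop where
  lsc : LowerSemicontinuousOn (fun z : ℝ × E d => v z.1 z.2) (Ioc 0 T ×ˢ closure D)
  terminal : ∀ x ∈ closure D, h x ≤ v T x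
  interior : ∀ φ φt Dφ D2φ, IsC12 T D φ φt Dφ D2φ → ∀ t ∈ Ioo 0 T, ∀ x ∈ D,
    IsLocalMinOn (fun z : ℝ × E d => v z.1 z.2 - φ z.1 z.2) (Ioo 0 T ×ˢ closure D) (t, x) →
    0 ≤ -φt t x + H t x (v t x) (Dφ t x) (D2φ t x)
  boundary : ∀ φ φt Dφ D2φ, IsC12 T D φ φt Dφ D2φ → ∀ t ∈ Ioo 0 T, ∀ x ∈ frontier D,
    IsLocalMinOn (fun z : ℝ × E d => v z.1 z.2 - φ z.1 z.2) (Ioo 0 T ×ˢ closure D) (t, x) →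
    0 ≤ max (-φt t x + H t x (v t x) (Dφ t x) (D2φ t x)) (normalSup D x (Dφ t x))

end NeumannComparison

end

/-! Suppose u exceeds v by c > 0 at some point. Compare instead U = u − η/t − k(x) with V = v + η/t
+ k(x). The term η/t keeps the relevant points away from t = 0 and, having time derivative −η/t²,
makes both differential inequalities strict by at least η/T². The function k = εg − δf combines the
coercive g(x) = log(1 + |x|²), which confines everything to a compact set, with the function f of
(C), which makes Dk·n ≤ −c₁ < 0 for every normal n. Now double the variables with the penalty κ/2 (t
− s)² + α/2 |x − y|² and study a maximum of the doubled function.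

Boundary points: a ball of radius 4r₀ touches D from outside, so ⟨x − y, n⟩ ≤ |x − y|²/(8r₀)
(`inner_normal_le`). Hence the penalty gradient α(x − y) has outward sign up to an error α|x −
y|²/(8r₀), and this vanishes as α grows (`exists_penalization_le`). The strictly signed Dk·n beats
the error, the boundary alternative is violated, and the equation itself holds at boundary points
for u and v alike.

Equations: (H1) allows u(t, x) and v(s, y) to be exchanged, (H2) absorbs the small gradients and
Hessians of k, and (H3), extended to the closure of D by continuity, compares the two spatial
arguments. Since (H3) lives at a single time, the times are penalized separately: once α is fixed
all jets lie in a compact set, where H is uniformly continuous in time, and κ is chosen last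
(`hamiltonian_sub_le`, `false_of_doubling`).

Second order: semicontinuous functions need a theorem on sums. An approximate one suffices
(`exists_approximate_jets`): genuine quadratic touching near the maximum, with an error θ. The two
functions are replaced by C^{1,1} majorants (sup-convolution followed by inf-convolution,
`exists_regularization`). Because the gradients are Lipschitz, Rademacher's theorem and a Sard-type
choice of slope give nearby points of second differentiability with almost nonpositive Hessian
(`exists_almost_critical`). There the Hessian is not extremal, which forces contact with the
original functions (`exists_contact`). -/

namespace NeumannComparison

/-! ### Sup-inf-convolution of a semicontinuous function. -/

section Regularization

variable {V : Type*} [NormedAddCommGroup V] [InnerProductSpace ℝ V]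

/-- The sup-convolution of an upper semicontinuous function over a compact set is attained. -/
theorem exists_supConvolution {V : Type*} [NormedAddCommGroup V] {K : Set V} (hK : IsCompact K) (hne : K.Nonempty) {U : V → ℝ}
    (hU : UpperSemicontinuousOn U K) :
    ∃ (J : V → ℝ) (ξ : V → V), (∀ y, ξ y ∈ K) ∧ (∀ y, J y = U (ξ y) - 6 / 5 * ‖y - ξ y‖ ^ 2) ∧
      ∀ y, ∀ z ∈ K, U z - 6 / 5 * ‖y - z‖ ^ 2 ≤ J y := by
  have key : ∀ y : V, ∃ z ∈ K, ∀ w ∈ K,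
      U w - 6 / 5 * ‖y - w‖ ^ 2 ≤ U z - 6 / 5 * ‖y - z‖ ^ 2 := by
    intro y
    have hc : Continuous fun z : V => -(6 / 5 * ‖y - z‖ ^ 2) := by fun_prop
    have h1 : UpperSemicontinuousOn (fun z => U z + -(6 / 5 * ‖y - z‖ ^ 2)) K :=
      hU.add (hc.upperSemicontinuous.upperSemicontinuousOn K)
    obtain ⟨z, hz, hmax⟩ := h1.exists_isMaxOn hne hK
    refine ⟨z, hz, fun w hw => ?_⟩
    have := hmax hw
    simp only [mem_ofPred_eq] at this
    linarith
  choose ξ hξ hmax using key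
  exact ⟨fun y => U (ξ y) - 6 / 5 * ‖y - ξ y‖ ^ 2, ξ, hξ, fun y => rfl, fun y z hz => hmax y z hz⟩

theorem lowerSemicontinuous_of_paraboloid_below {J : V → ℝ}
    (hJ : ∀ y₀, ∃ m : V, ∀ y, J y₀ + inner ℝ m (y - y₀) - 6 / 5 * ‖y - y₀‖ ^ 2 ≤ J y) :
    LowerSemicontinuous J := by
  intro y₀ c hc
  obtain ⟨m, hm⟩ := hJ y₀
  have hcont : Continuous fun y => J y₀ + inner ℝ m (y - y₀) - 6 / 5 * ‖y - y₀‖ ^ 2 := by fun_prop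
  have h0 : c < J y₀ + inner ℝ m (y₀ - y₀) - 6 / 5 * ‖y₀ - y₀‖ ^ 2 := by simpa using hc
  filter_upwards [hcont.continuousAt.eventually (lt_mem_nhds h0)] with y hy
  exact hy.trans_le (hm y)

theorem hasFDerivAt_of_quadratic_bound {W : V → ℝ} {g x : V} {C : ℝ}
    (h : ∀ y, |W y - W x - inner ℝ g (y - x)| ≤ C * ‖y - x‖ ^ 2) :
    HasFDerivAt W (innerSL ℝ g) x := by
  rw [hasFDerivAt_iff_isLittleO]
  have hO : (fun y => W y - W x - (innerSL ℝ g) (y - x)) =O[nhds x] fun y => ‖y - x‖ ^ 2 := by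
    refine Asymptotics.IsBigO.of_bound C (Filter.Eventually.of_forall fun y => ?_)
    simpa [Real.norm_eq_abs] using h y
  refine hO.trans_isLittleO ?_
  have := Asymptotics.isLittleO_pow_sub_sub x (m := 2) (by norm_num)
  simpa using this

/-- Lasry–Lions regularization: a `C^{1,1}` majorant of the sup-convolution which agrees with it
at the points of second differentiability where the Hessian is not extremal. -/
theorem exists_regularization [FiniteDimensional ℝ V] {K : Set V} (hK : IsCompact K)
    (hne : K.Nonempty) {U : V → ℝ} (hU : UpperSemicontinuousOn U K) :
    ∃ (W : V → ℝ) (G : V → V), (∀ x, HasFDerivAt W (innerSL ℝ (G x)) x) ∧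
      LipschitzWith 42 G ∧
      (∀ x, ∀ z ∈ K, U z - 3 / 2 * ‖x - z‖ ^ 2 ≤ W x) ∧
      (∀ x y, ∃ z ∈ K, W x ≤ U z - 6 / 5 * ‖y - z‖ ^ 2 + 6 * ‖x - y‖ ^ 2) ∧
      ∀ (x : V) (X : V →L[ℝ] V) (c : ℝ), c < 12 → HasFDerivAt G X x →
        (∀ a, inner ℝ (X a) a ≤ c * ‖a‖ ^ 2) → ∃ z ∈ K, W x = U z - 3 / 2 * ‖x - z‖ ^ 2 := by
  -- Write a penalty as |·|²/(2a). Here the sup-convolution has a = 5/12 and the inf-convolution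
  -- with coefficient 6 has a = 1/12; the difference 1/3 corresponds to the coefficient 3/2. The
  -- value 3/2 is what produces the constant 3α of (H3).
  obtain ⟨J, ξ, hξK, hJ, hJge⟩ := exists_supConvolution hK hne hU
  -- The paraboloid with vertex `ξ y₀` touches J from below at y₀. Thus J + 6/5 |·|² is convex.
  have hslope : ∀ y₀ y, J y₀ + inner ℝ ((12 / 5 : ℝ) • (ξ y₀ - y₀)) (y - y₀)
      - 6 / 5 * ‖y - y₀‖ ^ 2 ≤ J y := by
    intro y₀ y
    refine le_trans (le_of_eq ?_) (hJge y (ξ y₀) (hξK y₀))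
    rw [hJ y₀]
    simp only [← real_inner_self_eq_norm_sq, inner_sub_left, inner_sub_right, real_inner_smul_right,
      real_inner_comm]
    ring
  have hlsc : LowerSemicontinuous J :=
    lowerSemicontinuous_of_paraboloid_below fun y₀ => ⟨_, hslope y₀⟩
  obtain ⟨z₀, hz₀⟩ := hne
  -- existence of the minimiser
  have hmin : ∀ x, ∃ y, ∀ y', J y + 6 * ‖x - y‖ ^ 2 ≤ J y' + 6 * ‖x - y'‖ ^ 2 := by
    intro x
    -- Far away, 6|x − y'|² dominates the lower bound of J, which costs at most 12/5 |x − y'|² plus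
    -- a constant; R is large enough that no such y' beats y' = x.
    set R : ℝ := |J x - U z₀| + ‖x - z₀‖ ^ 2 + 2 with hR
    have hl : LowerSemicontinuousOn (fun y => J y + 6 * ‖x - y‖ ^ 2) (Metric.closedBall x R) := by
      have hc : Continuous fun y : V => 6 * ‖x - y‖ ^ 2 := by fun_prop
      exact (hlsc.add hc.lowerSemicontinuous).lowerSemicontinuousOn _
    have hR0 : 0 ≤ R := by positivity
    obtain ⟨y, -, hy⟩ := hl.exists_isMinOn (Metric.nonempty_closedBall.2 hR0)
      (isCompact_closedBall x R)
    refine ⟨y, fun y' => ?_⟩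
    by_cases hy' : y' ∈ Metric.closedBall x R
    · exact hy hy'
    · have h1 : J y + 6 * ‖x - y‖ ^ 2 ≤ J x + 6 * ‖x - x‖ ^ 2 :=
        hy (Metric.mem_closedBall_self hR0)
      have h2 := hJge y' z₀ hz₀
      rw [Metric.mem_closedBall, dist_eq_norm, not_le, norm_sub_rev] at hy'
      have h3 : ‖y' - z₀‖ ≤ ‖x - y'‖ + ‖x - z₀‖ := by
        calc ‖y' - z₀‖ = ‖(x - z₀) - (x - y')‖ := by congr 1; abel
          _ ≤ ‖x - z₀‖ + ‖x - y'‖ := norm_sub_le _ _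
          _ = _ := by ring
      have h4 : ‖y' - z₀‖ ^ 2 ≤ 2 * ‖x - y'‖ ^ 2 + 2 * ‖x - z₀‖ ^ 2 := by
        nlinarith [norm_nonneg (y' - z₀), sq_nonneg (‖x - y'‖ - ‖x - z₀‖), norm_nonneg (x - y'),
          norm_nonneg (x - z₀)]
      have h5 : R * 2 ≤ ‖x - y'‖ ^ 2 := by
        have : 2 ≤ R := by
          have : 0 ≤ |J x - U z₀| + ‖x - z₀‖ ^ 2 := by positivity
          linarith
        nlinarith
      have h6 := le_abs_self (J x - U z₀)
      simp only [sub_self, norm_zero] at h1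
      nlinarith [sq_nonneg ‖x - z₀‖, abs_nonneg (J x - U z₀)]
  choose Y hY using hmin
  -- strong convexity
  have hstrong : ∀ x y, J (Y x) + 6 * ‖x - Y x‖ ^ 2 + 12 / 5 * ‖y - Y x‖ ^ 2
      ≤ J y + 6 * ‖x - y‖ ^ 2 := by
    intro x y
    -- Midpoint test: J + 6|x − ·|² has the convexity of (6 − 6/5)|·|² = 24/5 |·|², and comparing
    -- the minimum with the midpoint retains half of this.
    set q := (1 / 2 : ℝ) • (Y x + y) with hq
    have h1 := hY x q
    have h2 := hJge y (ξ q) (hξK q)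
    have h3 := hJge (Y x) (ξ q) (hξK q)
    have e1 : ‖q - ξ q‖ ^ 2 = 1 / 2 * ‖Y x - ξ q‖ ^ 2 + 1 / 2 * ‖y - ξ q‖ ^ 2
        - 1 / 4 * ‖y - Y x‖ ^ 2 := by
      generalize ξ q = z
      rw [hq]
      simp only [← real_inner_self_eq_norm_sq, inner_sub_left, inner_sub_right,
        inner_add_right, real_inner_smul_right, real_inner_comm]
      ring
    have e2 : ‖x - q‖ ^ 2 = 1 / 2 * ‖x - Y x‖ ^ 2 + 1 / 2 * ‖x - y‖ ^ 2
        - 1 / 4 * ‖y - Y x‖ ^ 2 := by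
      rw [hq]
      simp only [← real_inner_self_eq_norm_sq, inner_sub_left, inner_sub_right,
        inner_add_right, real_inner_smul_right, real_inner_comm]
      ring
    rw [hJ q, e1, e2] at h1
    linarith
  have huniq : ∀ x y, (∀ y', J y + 6 * ‖x - y‖ ^ 2 ≤ J y' + 6 * ‖x - y'‖ ^ 2) → Y x = y := by
    intro x y h
    have h1 := hstrong x y
    have h2 := h (Y x)
    have h3 : ‖y - Y x‖ ^ 2 ≤ 0 := by linarith
    have h4 : ‖y - Y x‖ = 0 := by
      have := sq_nonneg ‖y - Y x‖
      exact pow_eq_zero_iff (n := 2) (by norm_num) |>.1 (le_antisymm h3 this)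
    exact (sub_eq_zero.1 (norm_eq_zero.1 h4)).symm
  have hYlip : ∀ x x', ‖Y x - Y x'‖ ≤ 5 / 2 * ‖x - x'‖ := by
    intro x x'
    have h1 := hstrong x (Y x')
    have h2 := hstrong x' (Y x)
    have h3 : ‖x - Y x'‖ ^ 2 - ‖x - Y x‖ ^ 2 + ‖x' - Y x‖ ^ 2 - ‖x' - Y x'‖ ^ 2
        = 2 * inner ℝ (x - x') (Y x - Y x') := by
      simp only [← real_inner_self_eq_norm_sq, inner_sub_left, inner_sub_right, real_inner_comm]
      ring
    have h4 := real_inner_le_norm (x - x') (Y x - Y x')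
    rw [norm_sub_rev (Y x') (Y x)] at h1
    have h5 : 24 / 5 * ‖Y x - Y x'‖ ^ 2 ≤ 12 * (‖x - x'‖ * ‖Y x - Y x'‖) := by linarith
    rcases eq_or_lt_of_le (norm_nonneg (Y x - Y x')) with h | h
    · rw [← h]; positivity
    · nlinarith
  set W : V → ℝ := fun x => J (Y x) + 6 * ‖x - Y x‖ ^ 2 with hW
  set G : V → V := fun x => (12 : ℝ) • (x - Y x) with hG
  -- 42 = 12 (1 + 5/2).
  have hGlip : ∀ x x', ‖G x - G x'‖ ≤ 42 * ‖x - x'‖ := by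
    intro x x'
    have : G x - G x' = (12 : ℝ) • ((x - x') - (Y x - Y x')) := by
      simp only [hG, ← smul_sub]; congr 1; abel
    rw [this, norm_smul]
    have h1 := norm_sub_le (x - x') (Y x - Y x')
    have h2 := hYlip x x'
    norm_num
    linarith
  have hupper : ∀ x x', W x' ≤ W x + inner ℝ (G x) (x' - x) + 6 * ‖x' - x‖ ^ 2 := by
    intro x x'
    refine (hY x' (Y x)).trans (le_of_eq ?_)
    simp only [hW, hG, ← real_inner_self_eq_norm_sq, inner_sub_left, inner_sub_right,
      real_inner_smul_right,
      real_inner_comm]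
    ring
  have hderiv : ∀ x, HasFDerivAt W (innerSL ℝ (G x)) x := by
    intro x
    -- The upper bound `hupper` at x, and again at y with the gradient moved back to x by the
    -- Lipschitz bound, gives 48 = 6 + 42.
    refine hasFDerivAt_of_quadratic_bound (C := 48) fun y => ?_
    have h1 := hupper x y
    have h2 := hupper y x
    have h3 : inner ℝ (G y) (x - y) = - inner ℝ (G x) (y - x) - inner ℝ (G y - G x) (y - x) := by
      simp only [inner_sub_left, inner_sub_right]; ring
    have h4 := (real_inner_le_norm (G y - G x) (y - x)).trans
      (mul_le_mul_of_nonneg_right (hGlip y x) (norm_nonneg _))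
    have h5 := neg_le_of_abs_le ((abs_real_inner_le_norm (G y - G x) (y - x)).trans
      (mul_le_mul_of_nonneg_right (hGlip y x) (norm_nonneg _)))
    rw [norm_sub_rev x y] at h2
    rw [abs_le]
    constructor <;> nlinarith [sq_nonneg ‖y - x‖]
  refine ⟨W, G, hderiv, LipschitzWith.of_dist_le_mul fun x y => ?_, ?_, ?_, ?_⟩
  · simpa [dist_eq_norm] using hGlip x y
  · intro x z hz
    have h1 := hJge (Y x) z hz
    -- The three quadratics differ by a square that vanishes exactly when z − Y x = 5 (x − Y x).
    -- This is the contact configuration reached in the last part.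
    have h2 : 0 ≤ ‖(5 : ℝ) • (x - Y x) + (Y x - z)‖ ^ 2 := by positivity
    have h3 : 6 * ‖x - Y x‖ ^ 2 - 6 / 5 * ‖Y x - z‖ ^ 2 + 3 / 2 * ‖x - z‖ ^ 2
        = 3 / 10 * ‖(5 : ℝ) • (x - Y x) + (Y x - z)‖ ^ 2 := by
      simp only [← real_inner_self_eq_norm_sq, inner_sub_left, inner_sub_right, inner_add_left,
        inner_add_right, real_inner_smul_right, real_inner_comm]
      ring
    simp only [hW]
    linarith
  · intro x y
    refine ⟨ξ y, hξK y, ?_⟩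
    have := hY x y
    rw [hJ y] at this
    exact this
  · intro x X c hc hX hXc
    set y := Y x with hy
    set z := ξ y with hz
    -- J has two slopes at y: G x, from minimality of y, and 12/5 (z − y), from maximality of z.
    -- Contact amounts to their difference m being zero.
    set m : V := (12 / 5 : ℝ) • (z - y) - G x with hm
    -- Every slope between these two is admissible at y, so y remains the minimizer along a whole
    -- segment. There G is affine with slope 12, so a nonzero m would be an eigenvector of X for the
    -- extremal eigenvalue 12, excluded by c < 12.
    have hline : ∀ s ∈ Icc (0 : ℝ) 1, G (x + (s / 12) • m) = G x + s • m := by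
      intro s hs
      have hYs : Y (x + (s / 12) • m) = y := by
        refine huniq _ _ fun y' => ?_
        have h1 := hslope y y'
        have h2 := hY x y'
        rw [← hz] at h1
        have hA : J y + inner ℝ (G x) (y' - y) - 6 * ‖y' - y‖ ^ 2 ≤ J y' := by
          refine le_trans (le_of_eq ?_) (sub_le_iff_le_add.2 h2)
          simp only [hG, ← hy, ← real_inner_self_eq_norm_sq, inner_sub_left, inner_sub_right,
            real_inner_smul_right,
      real_inner_comm]
          ring
        have hB : J y + inner ℝ (G x + m) (y' - y) - 6 * ‖y' - y‖ ^ 2 ≤ J y' := by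
          have : G x + m = (12 / 5 : ℝ) • (z - y) := by rw [hm]; abel
          rw [this]
          nlinarith [sq_nonneg ‖y' - y‖]
        have hC : J y + inner ℝ (G x + s • m) (y' - y) - 6 * ‖y' - y‖ ^ 2 ≤ J y' := by
          rw [inner_add_left] at hB ⊢
          rw [real_inner_smul_left m (y' - y) s]
          have := mul_le_mul_of_nonneg_left hB hs.1
          have := mul_le_mul_of_nonneg_left hA (sub_nonneg.2 hs.2)
          linarith
        have e : 6 * ‖x + (s / 12) • m - y‖ ^ 2 - 6 * ‖x + (s / 12) • m - y'‖ ^ 2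
            = inner ℝ (G x + s • m) (y' - y) - 6 * ‖y' - y‖ ^ 2 := by
          simp only [hG, ← hy]
          generalize m = m'
          simp only [← real_inner_self_eq_norm_sq, inner_sub_left, inner_sub_right,
            inner_add_left, inner_add_right, real_inner_smul_right,
            real_inner_comm]
          ring
        linarith
      have : G (x + (s / 12) • m) = (12 : ℝ) • (x + (s / 12) • m - y) := by
        simp only [hG]; rw [hYs]
      rw [this]
      simp only [hG, ← hy]
      module
    have hd1 : HasDerivWithinAt (fun s : ℝ => G (x + (s / 12) • m)) (X ((1 / 12 : ℝ) • m))
        (Icc 0 1) 0 := by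
      have hl : HasDerivAt (fun s : ℝ => x + (s / 12) • m) ((1 / 12 : ℝ) • m) 0 := by
        have := (((hasDerivAt_id (0 : ℝ)).div_const 12).smul_const m).const_add x
        simpa using this
      have hX' : HasFDerivAt G X (x + ((0 : ℝ) / 12) • m) := by simpa using hX
      exact (hX'.comp_hasDerivAt (0 : ℝ) hl).hasDerivWithinAt
    have hd2 : HasDerivWithinAt (fun s : ℝ => G (x + (s / 12) • m)) m (Icc 0 1) 0 := by
      have hl : HasDerivAt (fun s : ℝ => G x + s • m) m 0 := by
        have := ((hasDerivAt_id (0 : ℝ)).smul_const m).const_add (G x)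
        simpa using this
      exact hl.hasDerivWithinAt.congr (fun s hs => hline s hs) (by simp)
    have hu : UniqueDiffWithinAt ℝ (Icc (0 : ℝ) 1) 0 :=
      uniqueDiffOn_Icc_zero_one 0 (by simp)
    have hXm : X ((1 / 12 : ℝ) • m) = m := hu.eq_deriv _ hd1 hd2
    have hXm' : X m = (12 : ℝ) • m := by
      have := congrArg (fun w => (12 : ℝ) • w) hXm
      simpa only [map_smul, smul_smul, show (12 : ℝ) * (1 / 12) = 1 by norm_num, one_smul] using this
    have h12 := hXc m
    rw [hXm', real_inner_smul_left, real_inner_self_eq_norm_sq] at h12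
    have hm0 : m = 0 := by
      have : ‖m‖ ^ 2 ≤ 0 := by nlinarith [sq_nonneg ‖m‖]
      have := pow_eq_zero_iff (n := 2) (by norm_num) |>.1 (le_antisymm this (sq_nonneg ‖m‖))
      exact norm_eq_zero.1 this
    refine ⟨z, hξK y, ?_⟩
    have hzy : z = y + (5 : ℝ) • (x - y) := by
      have h1 : (12 / 5 : ℝ) • (z - y) = (12 : ℝ) • (x - y) := by
        have := sub_eq_zero.1 (hm.symm.trans hm0)
        simpa [hG, ← hy] using this
      have h2 : z - y = (5 : ℝ) • (x - y) := by
        have := congrArg (fun w => (5 / 12 : ℝ) • w) h1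
        simp only [smul_smul] at this
        norm_num at this
        exact this
      rw [← h2]; abel
    have : W x = U z - 6 / 5 * ‖y - z‖ ^ 2 + 6 * ‖x - y‖ ^ 2 := by
      simp only [hW, ← hy]
      rw [hJ y]
    rw [this, hzy]
    simp only [← real_inner_self_eq_norm_sq, inner_sub_left, inner_sub_right,
      inner_add_left, inner_add_right, real_inner_smul_right,
      real_inner_comm]
    rw [← hzy]
    ring

end Regularization

/-! ### A Jensen-type lemma for C^{1,1} functions. -/

section Jensen

variable {V : Type*} [NormedAddCommGroup V] [InnerProductSpace ℝ V]

theorem hasFDerivAt_norm_sub_sq (c x : V) :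
    HasFDerivAt (fun z => ‖z - c‖ ^ 2) (innerSL ℝ ((2 : ℝ) • (x - c))) x := by
  refine hasFDerivAt_of_quadratic_bound (C := 1) fun y => le_of_eq ?_
  have : ‖y - c‖ ^ 2 - ‖x - c‖ ^ 2 - inner ℝ ((2 : ℝ) • (x - c)) (y - x) = ‖y - x‖ ^ 2 := by
    simp only [← real_inner_self_eq_norm_sq, inner_sub_left, inner_sub_right,
      real_inner_smul_right, real_inner_comm]
    ring
  rw [this, abs_of_nonneg (sq_nonneg _), one_mul]

/-- First and second order necessary conditions at a minimum. -/
theorem second_order_nonneg {f : V → ℝ} {g : V → V} (hf : ∀ x, HasFDerivAt f (innerSL ℝ (g x)) x)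
    {x₀ : V} (hmin : ∀ x, f x₀ ≤ f x) {A : V →L[ℝ] V} (hA : HasFDerivAt g A x₀) :
    g x₀ = 0 ∧ ∀ a, 0 ≤ inner ℝ (A a) a := by
  constructor
  · have h : IsLocalMin f x₀ := Filter.Eventually.of_forall hmin
    have := h.hasFDerivAt_eq_zero (hf x₀)
    have h2 := congrArg (fun φ : V →L[ℝ] ℝ => φ (g x₀)) this
    simpa using h2
  · intro a
    by_contra! hneg
    set h : ℝ → ℝ := fun s => f (x₀ + s • a) with hh
    have hline : ∀ s, HasDerivAt (fun s : ℝ => x₀ + s • a) a s := fun s => by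
      simpa using ((hasDerivAt_id s).smul_const a).const_add x₀
    have hd : ∀ s, HasDerivAt h (inner ℝ (g (x₀ + s • a)) a) s := fun s => by
      have := (hf (x₀ + s • a)).comp_hasDerivAt s (hline s)
      rwa [innerSL_apply_apply] at this
    have hd' : deriv h = fun s => inner ℝ (g (x₀ + s • a)) a := funext fun s => (hd s).deriv
    have hdd : HasDerivAt (deriv h) (inner ℝ (A a) a) 0 := by
      rw [hd']
      have hA' : HasFDerivAt g A (x₀ + (0 : ℝ) • a) := by simpa using hA
      have := (hA'.comp_hasDerivAt (0 : ℝ) (hline 0)).inner ℝ (hasDerivAt_const (0 : ℝ) a)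
      simpa using this
    have hminh : IsLocalMin h 0 := Filter.Eventually.of_forall fun s => by
      simpa [hh] using hmin (x₀ + s • a)
    -- A negative second derivative would make 0 a local maximum of h as well as a local minimum.
    -- Then h is constant near 0 and its second derivative vanishes.
    have hmaxh : IsLocalMin (fun s => -h s) 0 := by
      apply isLocalMin_of_deriv_deriv_pos
      · have : deriv (fun s => -h s) = fun s => -deriv h s := by
          funext s; exact (hd s).neg.deriv.trans (by rw [(hd s).deriv])
        have h2 : deriv (fun s => -deriv h s) 0 = -inner ℝ (A a) a := hdd.neg.deriv
        rw [this, h2]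
        linarith
      · refine (hd 0).neg.deriv.trans ?_
        rw [neg_eq_zero, ← (hd 0).deriv]
        exact hminh.deriv_eq_zero
      · exact (hd 0).neg.continuousAt
    have hconst : h =ᶠ[nhds 0] fun _ => h 0 := by
      filter_upwards [hminh, hmaxh] with s h1 h2
      linarith
    have h1 : deriv h =ᶠ[nhds 0] fun _ => 0 := by
      simpa using hconst.deriv
    have h2 : deriv (deriv h) 0 = 0 := by
      rw [h1.deriv_eq]; simp
    rw [hdd.deriv] at h2
    linarith

/-- Near a global maximum of a `C^{1,1}` function there are points of second differentiability
with small gradient and almost nonpositive Hessian. -/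
theorem exists_almost_critical [FiniteDimensional ℝ V] {F : V → ℝ} {G : V → V} {L : NNReal}
    (hF : ∀ x, HasFDerivAt F (innerSL ℝ (G x)) x) (hG : LipschitzWith L G) {z₀ : V}
    (hmax : ∀ x, F x ≤ F z₀) {θ : ℝ} (hθ : 0 < θ) :
    ∃ z, ‖z - z₀‖ < θ ∧ ‖G z‖ < θ ∧ F z₀ - θ < F z ∧
      ∃ A : V →L[ℝ] V, HasFDerivAt G A z ∧ ∀ a, inner ℝ (A a) a ≤ θ * ‖a‖ ^ 2 := by
  obtain ⟨τ, hτ0, hτ⟩ : ∃ τ : ℝ, 0 < τ ∧ 2 * τ ≤ θ := ⟨θ / 2, by positivity, by linarith⟩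
  obtain ⟨ρ, hρ0, hρ1, hρ2, hρ3⟩ : ∃ ρ : ℝ, 0 < ρ ∧ 3 * ρ ≤ θ / 2 ∧ ρ / τ ≤ θ / 2 ∧ ρ ≤ 1 := by
    refine ⟨min (θ / 6) (min (τ * θ / 2) 1), by positivity, ?_, ?_, ?_⟩
    · have := min_le_left (θ / 6) (min (τ * θ / 2) 1); linarith
    · rw [div_le_iff₀ hτ0]
      have := (min_le_right (θ / 6) (min (τ * θ / 2) 1)).trans (min_le_left _ _)
      linarith
    · exact (min_le_right (θ / 6) (min (τ * θ / 2) 1)).trans (min_le_right _ _)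
  -- P is the gradient of F − τ|· − z₀|². The quadratic term makes the maximum strict, so that small
  -- linear tilts keep it near z₀.
  set P : V → V := fun z => G z - (2 * τ) • (z - z₀) with hP
  have hPlip : ∃ L', LipschitzWith L' P := by
    refine ⟨L + ‖2 * τ‖₊, hG.sub ?_⟩
    refine LipschitzWith.of_dist_le_mul fun x y => ?_
    rw [dist_smul₀, dist_sub_right]
    simp
  obtain ⟨L', hL'⟩ := hPlip
  -- Sard-type argument: by Rademacher P fails to be differentiable only on a null set, and a
  -- Lipschitz map sends null sets to null sets for the Hausdorff measure of full dimension. Hence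
  -- some small slope p has only points of differentiability in its preimage.
  obtain ⟨p, hp, hpd⟩ : ∃ p : V, ‖p‖ < ρ ∧ ∀ z, P z = p → DifferentiableAt ℝ P z := by
    let _ : MeasurableSpace V := borel V
    have _ : BorelSpace V := ⟨rfl⟩
    set μ : MeasureTheory.Measure V :=
      MeasureTheory.Measure.hausdorffMeasure (Module.finrank ℝ V : ℝ) with hμ
    have hae : ∀ᵐ x ∂μ, DifferentiableAt ℝ P x := hL'.ae_differentiableAt
    have h0 : μ {x | ¬ DifferentiableAt ℝ P x} = 0 := hae
    have h1 : μ (P '' {x | ¬ DifferentiableAt ℝ P x}) = 0 := by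
      refine le_antisymm ((hL'.hausdorffMeasure_image_le (by positivity) _).trans ?_) zero_le
      rw [← hμ, h0, mul_zero]
    have h2 : μ (Metric.ball 0 ρ) ≠ 0 :=
      (Metric.isOpen_ball.measure_pos μ ⟨0, Metric.mem_ball_self hρ0⟩).ne'
    have h3 : ¬ Metric.ball 0 ρ ⊆ P '' {x | ¬ DifferentiableAt ℝ P x} := fun h =>
      h2 (MeasureTheory.measure_mono_null h h1)
    obtain ⟨p, hp, hp'⟩ := Set.not_subset.1 h3
    refine ⟨p, by simpa using hp, fun z hz => ?_⟩
    by_contra hcon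
    exact hp' ⟨z, hcon, hz⟩
  set Φ : V → ℝ := fun z => τ * ‖z - z₀‖ ^ 2 + inner ℝ p (z - z₀) - F z with hΦ
  have hFc : Continuous F := continuous_iff_continuousAt.2 fun x => (hF x).continuousAt
  have hΦc : Continuous Φ := by fun_prop
  have hR0 : 0 ≤ ρ / τ := by positivity
  obtain ⟨z, hz, hzmin⟩ := (isCompact_closedBall z₀ (ρ / τ)).exists_isMinOn
    (Metric.nonempty_closedBall.2 hR0) hΦc.continuousOn
  rw [Metric.mem_closedBall, dist_eq_norm] at hz
  have hz0 : Φ z ≤ -F z₀ := by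
    have := hzmin (Metric.mem_closedBall_self hR0)
    simpa [hΦ] using this
  -- Outside the ball of radius ρ/τ the term τ|x − z₀|² exceeds the tilt, which is at most ρ|x −
  -- z₀|.
  have hglob : ∀ x, Φ z ≤ Φ x := by
    intro x
    by_cases hx : x ∈ Metric.closedBall z₀ (ρ / τ)
    · exact hzmin hx
    · rw [Metric.mem_closedBall, not_le, dist_eq_norm, div_lt_iff₀ hτ0] at hx
      refine hz0.trans ?_
      have h1 := neg_le_of_abs_le (abs_real_inner_le_norm p (x - z₀))
      have h2 := hmax x
      have h3 : 0 ≤ ‖x - z₀‖ := norm_nonneg _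
      simp only [hΦ]
      nlinarith [mul_le_mul_of_nonneg_right hp.le h3]
  have hΦd : ∀ x, HasFDerivAt Φ (innerSL ℝ (p - P x)) x := by
    intro x
    have h1 := ((hasFDerivAt_norm_sub_sq z₀ x).const_mul τ)
    have h2 : HasFDerivAt (fun z => inner ℝ p (z - z₀)) (innerSL ℝ p) x := by
      refine hasFDerivAt_of_quadratic_bound (C := 0) fun y => le_of_eq ?_
      rw [zero_mul, abs_eq_zero, ← inner_sub_right, ← inner_sub_right, sub_sub_sub_cancel_right,
        sub_self, inner_zero_right]
    refine ((h1.add h2).sub (hF x)).congr_fderiv ?_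
    ext v
    simp [hP]
    ring
  have hPz : P z = p := by
    have h1 : IsLocalMin Φ z := Filter.Eventually.of_forall hglob
    have h2 := congrArg (fun φ : V →L[ℝ] ℝ => φ (p - P z)) (h1.hasFDerivAt_eq_zero (hΦd z))
    have h3 : p - P z = 0 := by
      rw [innerSL_apply_apply] at h2
      simpa using h2
    exact (sub_eq_zero.1 h3).symm
  have hdP := (hpd z hPz).hasFDerivAt
  have hso := (second_order_nonneg hΦd hglob (hdP.const_sub p)).2
  refine ⟨z, by linarith, ?_, ?_, fderiv ℝ P z + (2 * τ) • ContinuousLinearMap.id ℝ V, ?_, ?_⟩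
  · have : G z = p + (2 * τ) • (z - z₀) := by rw [← hPz, hP]; simp
    rw [this]
    refine (norm_add_le _ _).trans_lt ?_
    rw [norm_smul, Real.norm_of_nonneg (by positivity)]
    have : τ * ‖z - z₀‖ ≤ ρ := by
      have := mul_le_mul_of_nonneg_left hz hτ0.le
      rwa [mul_div_cancel₀ _ hτ0.ne'] at this
    linarith
  · have h1 := neg_le_of_abs_le (abs_real_inner_le_norm p (z - z₀))
    have h2 : ‖p‖ * ‖z - z₀‖ ≤ 1 * (θ / 2) :=
      mul_le_mul (by linarith) (hz.trans hρ2) (norm_nonneg _) zero_le_one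
    have h3 : 0 ≤ τ * ‖z - z₀‖ ^ 2 := by positivity
    simp only [hΦ] at hz0
    linarith
  · have h1 : HasFDerivAt (fun z => (2 * τ) • (z - z₀)) ((2 * τ) • ContinuousLinearMap.id ℝ V) z :=
      ((hasFDerivAt_id z).sub_const z₀).const_smul (2 * τ)
    refine (hdP.add h1).congr_of_eventuallyEq (Filter.Eventually.of_forall fun x => ?_)
    simp [hP]
  · intro a
    have h1 := hso a
    simp only [neg_apply, inner_neg_left] at h1
    simp only [add_apply, smul_apply,
      ContinuousLinearMap.id_apply, inner_add_left, real_inner_smul_left,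
      real_inner_self_eq_norm_sq]
    nlinarith [sq_nonneg ‖a‖]

end Jensen

/-! ### Taylor expansion and contact points. -/

section Sums

variable {V : Type*} [NormedAddCommGroup V] [InnerProductSpace ℝ V]

/-- The derivative of a gradient field is symmetric. -/
theorem inner_symm_of_hasFDerivAt_gradient {W : V → ℝ} {G : V → V}
    (hW : ∀ x, HasFDerivAt W (innerSL ℝ (G x)) x) {x : V} {X : V →L[ℝ] V}
    (hX : HasFDerivAt G X x) (a b : V) : (inner ℝ (X a) b : ℝ) = inner ℝ (X b) a := by
  let B : V →L[ℝ] V →L[ℝ] ℝ := LinearMap.mkContinuous₂ (innerₗ V) 1 fun a b => by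
    simpa using norm_inner_le_norm (𝕜 := ℝ) a b
  have hB : ∀ a b, B a b = inner ℝ a b := fun a b => rfl
  have hW' : ∀ x, HasFDerivAt W (B (G x)) x := fun x =>
    (hW x).congr_fderiv (by ext v; simp [hB])
  have := second_derivative_symmetric hW' (B.hasFDerivAt.comp x hX) a b
  simpa [hB] using this

/-- Second order Taylor expansion (one-sided) at a point of differentiability of the gradient. -/
theorem eventually_le_taylor {W : V → ℝ} {G : V → V}
    (hW : ∀ x, HasFDerivAt W (innerSL ℝ (G x)) x) {x : V} {X : V →L[ℝ] V}
    (hX : HasFDerivAt G X x) {θ : ℝ} (hθ : 0 < θ) :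
    ∀ᶠ y in nhds x, W y ≤ W x + inner ℝ (G x) (y - x) + 1 / 2 * inner ℝ (X (y - x)) (y - x)
      + θ * ‖y - x‖ ^ 2 := by
  have hsymm := inner_symm_of_hasFDerivAt_gradient hW hX
  have h1 : ∀ᶠ y in nhds x, ‖G y - G x - X (y - x)‖ ≤ θ * ‖y - x‖ :=
    (hasFDerivAt_iff_isLittleO.1 hX).def hθ
  obtain ⟨r, hr, hball⟩ := Metric.eventually_nhds_iff_ball.1 h1
  set Q : V → ℝ := fun y => inner ℝ (G x) (y - x) + 1 / 2 * inner ℝ (X (y - x)) (y - x) with hQ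
  have hQd : ∀ y, HasFDerivAt Q (innerSL ℝ (G x + X (y - x))) y := by
    intro y
    refine hasFDerivAt_of_quadratic_bound (C := 1 / 2 * ‖X‖) fun z => ?_
    have : Q z - Q y - inner ℝ (G x + X (y - x)) (z - y) = 1 / 2 * inner ℝ (X (z - y)) (z - y) := by
      simp only [hQ, map_sub, inner_sub_left, inner_sub_right, inner_add_left]
      rw [hsymm z y, hsymm z x, hsymm y x]
      ring
    rw [this, abs_mul, abs_of_pos (by norm_num : (0 : ℝ) < 1 / 2), mul_assoc]
    refine mul_le_mul_of_nonneg_left ?_ (by norm_num)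
    refine (abs_real_inner_le_norm _ _).trans ?_
    rw [pow_two, ← mul_assoc]
    exact mul_le_mul_of_nonneg_right (X.le_opNorm _) (norm_nonneg _)
  filter_upwards [Metric.ball_mem_nhds x hr] with y hy
  have hRd : ∀ z ∈ Metric.closedBall x ‖y - x‖, HasFDerivWithinAt (fun z => W z - Q z)
      (innerSL ℝ (G z - G x - X (z - x))) (Metric.closedBall x ‖y - x‖) z := by
    intro z _
    refine (((hW z).sub (hQd z)).congr_fderiv ?_).hasFDerivWithinAt
    ext v
    simp
    ring
  have hRb : ∀ z ∈ Metric.closedBall x ‖y - x‖,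
      ‖(innerSL ℝ (G z - G x - X (z - x)) : V →L[ℝ] ℝ)‖ ≤ θ * ‖y - x‖ := by
    intro z hz
    rw [innerSL_apply_norm]
    rw [Metric.mem_ball, dist_eq_norm] at hy
    rw [Metric.mem_closedBall, dist_eq_norm] at hz
    refine (hball z (by rw [Metric.mem_ball, dist_eq_norm]; linarith)).trans ?_
    exact mul_le_mul_of_nonneg_left hz hθ.le
  -- Mean value inequality for W − Q on the ball of radius |y − x|, where its gradient is at most
  -- θ|y − x|.
  have h2 := (convex_closedBall x ‖y - x‖).norm_image_sub_le_of_norm_hasFDerivWithin_le hRd hRb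
    (Metric.mem_closedBall_self (norm_nonneg _)) (y := y) (by simp [dist_eq_norm])
  have h3 := (le_abs_self _).trans h2
  have h4 : Q x = 0 := by simp [hQ]
  rw [h4] at h3
  simp only [hQ] at h3
  nlinarith

/-- Second order information carried by the regularization at a contact point. -/
theorem exists_contact {K : Set V} {U W : V → ℝ} {G : V → V}
    (hW : ∀ x, HasFDerivAt W (innerSL ℝ (G x)) x)
    (hUW : ∀ x, ∀ z ∈ K, U z - 3 / 2 * ‖x - z‖ ^ 2 ≤ W x) {x z : V}
    (hz : W x = U z - 3 / 2 * ‖x - z‖ ^ 2) (hzK : z ∈ K) {X : V →L[ℝ] V}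
    (hX : HasFDerivAt G X x) {θ : ℝ} (hθ : 0 < θ) :
    z = x + (1 / 3 : ℝ) • G x ∧ (∀ a, -3 * ‖a‖ ^ 2 ≤ inner ℝ (X a) a) ∧
    ∀ᶠ y in nhds z, y ∈ K → U y ≤ U z + inner ℝ (G x) (y - z)
      + 1 / 2 * inner ℝ (X (y - z)) (y - z) + θ * ‖y - z‖ ^ 2 := by
  have hd : ∀ y, HasFDerivAt (fun y => W y + 3 / 2 * ‖y - z‖ ^ 2)
      (innerSL ℝ (G y + (3 : ℝ) • (y - z))) y := by
    intro y
    refine ((hW y).add ((hasFDerivAt_norm_sub_sq z y).const_mul (3 / 2))).congr_fderiv ?_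
    ext v
    simp
    ring
  -- At a contact point, x minimizes W + 3/2 |· − z|², so first and second order conditions apply.
  have hmin : ∀ y, W x + 3 / 2 * ‖x - z‖ ^ 2 ≤ W y + 3 / 2 * ‖y - z‖ ^ 2 := by
    intro y
    have := hUW y z hzK
    linarith
  have hA : HasFDerivAt (fun y => G y + (3 : ℝ) • (y - z)) (X + (3 : ℝ) • .id ℝ V) x :=
    hX.add (((hasFDerivAt_id x).sub_const z).const_smul (3 : ℝ))
  obtain ⟨h1, h2⟩ := second_order_nonneg hd hmin hA
  refine ⟨?_, fun a => ?_, ?_⟩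
  · have : G x = (3 : ℝ) • (z - x) := by
      rw [← sub_eq_zero, ← h1]; module
    rw [this, smul_smul]
    norm_num
  · have := h2 a
    simp only [add_apply, smul_apply, ContinuousLinearMap.id_apply, inner_add_left,
      real_inner_smul_left, real_inner_self_eq_norm_sq] at this
    linarith
  -- Translation by x − z keeps the penalty |x − z|² fixed, so the expansion of W at x passes
  -- unchanged to U at z.
  · have hc : Filter.Tendsto (fun y => y + (x - z)) (nhds z) (nhds x) := by
      have : Continuous fun y => y + (x - z) := by fun_prop
      simpa using this.tendsto z
    filter_upwards [hc.eventually (eventually_le_taylor hW hX hθ)] with y hy hyK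
    have h3 := hUW (y + (x - z)) y hyK
    have e1 : y + (x - z) - y = x - z := by abel
    have e2 : y + (x - z) - x = y - z := by abel
    rw [e1] at h3
    rw [e2] at hy
    linarith

end Sums

/-! ### The approximate theorem on sums. -/

section Sums

variable {V : Type*} [NormedAddCommGroup V] [InnerProductSpace ℝ V]

/-- Regularizing both functions turns the penalty 1/2 |z − w|² into 3/2 |x − x'|². Sup-convolution
first raises the coefficient to 3, and the inf-convolution brings it down to 3/2. -/
theorem regularization_sum_le {K : Set V} {U₁ U₂ W₁ W₂ : V → ℝ} {m : ℝ}
    (h₁ : ∀ x y, ∃ z ∈ K, W₁ x ≤ U₁ z - 6 / 5 * ‖y - z‖ ^ 2 + 6 * ‖x - y‖ ^ 2)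
    (h₂ : ∀ x y, ∃ z ∈ K, W₂ x ≤ U₂ z - 6 / 5 * ‖y - z‖ ^ 2 + 6 * ‖x - y‖ ^ 2)
    (hm : ∀ z ∈ K, ∀ w ∈ K, U₁ z + U₂ w - 1 / 2 * ‖z - w‖ ^ 2 ≤ m) (x x' : V) :
    W₁ x + W₂ x' - 3 / 2 * ‖x - x'‖ ^ 2 ≤ m := by
  -- Moving each point a quarter of the way is optimal: 6/16 + 6/16 + 3/4 = 3/2.
  obtain ⟨z, hz, hz'⟩ := h₁ x (x - (1 / 4 : ℝ) • (x - x'))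
  obtain ⟨w, hw, hw'⟩ := h₂ x' (x' + (1 / 4 : ℝ) • (x - x'))
  have h := hm z hz w hw
  set y := x - (1 / 4 : ℝ) • (x - x') with hy
  set y' := x' + (1 / 4 : ℝ) • (x - x') with hy'
  have e1 : ‖x - y‖ ^ 2 = 1 / 16 * ‖x - x'‖ ^ 2 := by
    have : x - y = (1 / 4 : ℝ) • (x - x') := by rw [hy]; abel
    rw [this, norm_smul, mul_pow]; norm_num
  have e2 : ‖x' - y'‖ ^ 2 = 1 / 16 * ‖x - x'‖ ^ 2 := by
    have : x' - y' = -((1 / 4 : ℝ) • (x - x')) := by rw [hy']; abel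
    rw [this, norm_neg, norm_smul, mul_pow]; norm_num
  have e3 : ‖y - y'‖ ^ 2 = 1 / 4 * ‖x - x'‖ ^ 2 := by
    have : y - y' = (1 / 2 : ℝ) • (x - x') := by rw [hy, hy']; module
    rw [this, norm_smul, mul_pow]; norm_num
  have e4 : 1 / 2 * ‖z - w‖ ^ 2 ≤ 6 / 5 * ‖y - z‖ ^ 2 + 6 / 5 * ‖y' - w‖ ^ 2
      + 3 * ‖y - y'‖ ^ 2 := by
    have e5 : z - w = (y - y') - (y - z) + (y' - w) := by abel
    rw [e5]
    generalize y - y' = a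
    generalize y - z = b
    generalize y' - w = c
    have e6 : 6 / 5 * ‖b‖ ^ 2 + 6 / 5 * ‖c‖ ^ 2 + 3 * ‖a‖ ^ 2 - 1 / 2 * ‖a - b + c‖ ^ 2
        = 3 / 5 * ‖b + c‖ ^ 2 + 1 / 10 * ‖(5 : ℝ) • a + (b - c)‖ ^ 2 := by
      simp only [← real_inner_self_eq_norm_sq, inner_sub_left, inner_sub_right, inner_add_left,
        inner_add_right, real_inner_smul_right, real_inner_comm]
      ring
    have : 0 ≤ 3 / 5 * ‖b + c‖ ^ 2 + 1 / 10 * ‖(5 : ℝ) • a + (b - c)‖ ^ 2 := by positivity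
    linarith
  linarith

/-- An approximate version of the theorem on sums for the penalty `|z - w|² / 2`. -/
theorem exists_approximate_jets [FiniteDimensional ℝ V] {K : Set V} (hK : IsCompact K)
    {U U' : V → ℝ} (hU : UpperSemicontinuousOn U K) (hU' : LowerSemicontinuousOn U' K)
    {z₀ w₀ : V} (hz₀ : z₀ ∈ K) (hw₀ : w₀ ∈ K)
    (hmax : ∀ z ∈ K, ∀ w ∈ K,
      U z - U' w - 1 / 2 * ‖z - w‖ ^ 2 ≤ U z₀ - U' w₀ - 1 / 2 * ‖z₀ - w₀‖ ^ 2)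
    {θ : ℝ} (hθ : 0 < θ) :
    ∃ z ∈ K, ∃ w ∈ K, ∃ (p q : V) (X Y : V →L[ℝ] V),
      ‖z - z₀‖ < θ ∧ ‖w - w₀‖ < θ ∧ ‖p - (z₀ - w₀)‖ < θ ∧ ‖q - (z₀ - w₀)‖ < θ ∧
      U z₀ - U' w₀ - 1 / 2 * ‖z₀ - w₀‖ ^ 2 - θ < U z - U' w ∧
      (∀ a b, (inner ℝ (X a) b : ℝ) = inner ℝ (X b) a) ∧
      (∀ a b, (inner ℝ (Y a) b : ℝ) = inner ℝ (Y b) a) ∧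
      (∀ a b, inner ℝ (X a) a - inner ℝ (Y b) b
        ≤ 3 * ‖a - b‖ ^ 2 + θ * (‖a‖ ^ 2 + ‖b‖ ^ 2)) ∧
      (∀ a, -3 * ‖a‖ ^ 2 ≤ inner ℝ (X a) a) ∧ (∀ b, inner ℝ (Y b) b ≤ 3 * ‖b‖ ^ 2) ∧
      (∀ᶠ y in nhds z, y ∈ K →
        U y ≤ U z + inner ℝ p (y - z) + 1 / 2 * inner ℝ (X (y - z)) (y - z)) ∧
      ∀ᶠ y in nhds w, y ∈ K →
        U' w + inner ℝ q (y - w) + 1 / 2 * inner ℝ (Y (y - w)) (y - w) ≤ U' y := by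
  obtain ⟨W₁, G₁, hW₁, hL₁, hge₁, hle₁, hcont₁⟩ := exists_regularization hK ⟨z₀, hz₀⟩ hU
  have hUneg : UpperSemicontinuousOn (fun z => -U' z) K := hU'.neg
  obtain ⟨W₂, G₂, hW₂, hL₂, hge₂, hle₂, hcont₂⟩ := exists_regularization hK ⟨z₀, hz₀⟩ hUneg
  set m : ℝ := U z₀ - U' w₀ - 1 / 2 * ‖z₀ - w₀‖ ^ 2 with hm
  have hle := regularization_sum_le (m := m) hle₁ hle₂ (fun z hz w hw => by
    have := hmax z hz w hw
    linarith)
  let e : WithLp 2 (V × V) ≃L[ℝ] V × V := WithLp.prodContinuousLinearEquiv 2 ℝ V V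
  let F : WithLp 2 (V × V) → ℝ := fun z => W₁ z.fst + W₂ z.snd - 3 / 2 * ‖z.fst - z.snd‖ ^ 2
  let G : WithLp 2 (V × V) → WithLp 2 (V × V) := fun z =>
    WithLp.toLp 2 (G₁ z.fst - (3 : ℝ) • (z.fst - z.snd), G₂ z.snd + (3 : ℝ) • (z.fst - z.snd))
  let f₁ : WithLp 2 (V × V) →L[ℝ] V := WithLp.fstL 2 ℝ V V
  let f₂ : WithLp 2 (V × V) →L[ℝ] V := WithLp.sndL 2 ℝ V V
  have hGlip : ∃ L, LipschitzWith L G := by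
    have h1 := (hL₁.comp f₁.lipschitz).sub ((3 : ℝ) • (f₁ - f₂)).lipschitz
    have h2 := (hL₂.comp f₂.lipschitz).add ((3 : ℝ) • (f₁ - f₂)).lipschitz
    exact ⟨_, (e.symm : V × V →L[ℝ] WithLp 2 (V × V)).lipschitz.comp (h1.prodMk h2)⟩
  obtain ⟨L, hGlip⟩ := hGlip
  have hFd : ∀ x, HasFDerivAt F (innerSL ℝ (G x)) x := by
    intro x
    have h1 := (hW₁ x.fst).comp x f₁.hasFDerivAt
    have h2 := (hW₂ x.snd).comp x f₂.hasFDerivAt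
    have h3 : HasFDerivAt (fun z : WithLp 2 (V × V) => ‖(f₁ - f₂) z - 0‖ ^ 2) _ x :=
      (hasFDerivAt_norm_sub_sq (0 : V) ((f₁ - f₂) x)).comp x (f₁ - f₂).hasFDerivAt
    simp only [sub_zero] at h3
    refine ((h1.add h2).sub (h3.const_mul (3 / 2))).congr_fderiv ?_
    ext v
    simp [G, f₁, f₂, WithLp.prod_inner_apply, inner_sub_left, inner_add_left,
      real_inner_smul_left]
    ring
  set d := z₀ - w₀ with hd
  -- The regularized maximum is attained where the bounds of the convolutions are sharp: each point
  -- moves by a third of z₀ − w₀ towards the other.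
  set xh : V := z₀ - (1 / 3 : ℝ) • d with hxh
  set xh' : V := w₀ + (1 / 3 : ℝ) • d with hxh'
  have hxx : xh - xh' = (1 / 3 : ℝ) • d := by rw [hxh, hxh', hd]; module
  have hFmax : ∀ x, F x ≤ F (WithLp.toLp 2 (xh, xh')) := by
    intro x
    refine (hle x.fst x.snd).trans ?_
    have h1 := hge₁ xh z₀ hz₀
    have h2 := hge₂ xh' w₀ hw₀
    have h3 : ‖xh - z₀‖ ^ 2 = 1 / 9 * ‖d‖ ^ 2 := by
      have : xh - z₀ = -((1 / 3 : ℝ) • d) := by rw [hxh]; abel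
      rw [this, norm_neg, norm_smul, mul_pow]; norm_num
    have h4 : ‖xh' - w₀‖ ^ 2 = 1 / 9 * ‖d‖ ^ 2 := by
      have : xh' - w₀ = (1 / 3 : ℝ) • d := by rw [hxh']; abel
      rw [this, norm_smul, mul_pow]; norm_num
    have h5 : ‖xh - xh'‖ ^ 2 = 1 / 9 * ‖d‖ ^ 2 := by
      rw [hxx, norm_smul, mul_pow]; norm_num
    change m ≤ W₁ xh + W₂ xh' - 3 / 2 * ‖xh - xh'‖ ^ 2
    rw [h3] at h1
    rw [h4] at h2
    rw [h5]
    linarith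
  -- The largest error below is 7η, so 11η ≤ θ leaves room; η ≤ 1 keeps the Hessians below 3 + 1 =
  -- 4.
  obtain ⟨η, hη0, hηθ, hη1⟩ : ∃ η : ℝ, 0 < η ∧ 11 * η ≤ θ ∧ η ≤ 1 :=
    ⟨min (θ / 11) 1, by positivity, by linarith [min_le_left (θ / 11) 1], min_le_right _ _⟩
  obtain ⟨zz, hz1, hz2, hz3, A, hA, hAle⟩ := exists_almost_critical hFd hGlip hFmax hη0
  set x := zz.fst with hx
  set x' := zz.snd with hx'
  let ι₁ : V →L[ℝ] WithLp 2 (V × V) := (e.symm : V × V →L[ℝ] _).comp (.inl ℝ V V)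
  let ι₂ : V →L[ℝ] WithLp 2 (V × V) := (e.symm : V × V →L[ℝ] _).comp (.inr ℝ V V)
  -- Differentiability of the product gradient at zz gives that of each factor by restriction to a
  -- slice through zz.
  have hX₁ : ∃ X : V →L[ℝ] V, HasFDerivAt G₁ X x := by
    have hl : HasFDerivAt (fun y => zz + ι₁ (y - x)) ι₁ x := by
      simpa using (HasFDerivAt.comp x (f := fun y => y - x) (g := ι₁) ι₁.hasFDerivAt
        ((hasFDerivAt_id x).sub_const x)).const_add zz
    have h1 : HasFDerivAt G A ((fun y => zz + ι₁ (y - x)) x) := by simpa using hA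
    have h2 := f₁.hasFDerivAt.comp x (h1.comp x hl)
    have h3 := h2.add (((hasFDerivAt_id x).sub_const x').const_smul (3 : ℝ))
    refine ⟨_, h3.congr_of_eventuallyEq (Filter.Eventually.of_forall fun y => ?_)⟩
    simp [G, f₁, ι₁, e, ← hx, ← hx']
  have hX₂ : ∃ X : V →L[ℝ] V, HasFDerivAt G₂ X x' := by
    have hl : HasFDerivAt (fun y => zz + ι₂ (y - x')) ι₂ x' := by
      simpa using (HasFDerivAt.comp x' (f := fun y => y - x') (g := ι₂) ι₂.hasFDerivAt
        ((hasFDerivAt_id x').sub_const x')).const_add zz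
    have h1 : HasFDerivAt G A ((fun y => zz + ι₂ (y - x')) x') := by simpa using hA
    have h2 := f₂.hasFDerivAt.comp x' (h1.comp x' hl)
    have h3 := h2.add (((hasFDerivAt_id x').sub_const x).const_smul (3 : ℝ))
    refine ⟨_, h3.congr_of_eventuallyEq (Filter.Eventually.of_forall fun y => ?_)⟩
    simp [G, f₂, ι₂, e, ← hx, ← hx']
    module
  obtain ⟨X₁, hX₁⟩ := hX₁
  obtain ⟨X₂, hX₂⟩ := hX₂
  have hquad : ∀ a b, inner ℝ (X₁ a) a + inner ℝ (X₂ b) b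
      ≤ 3 * ‖a - b‖ ^ 2 + η * (‖a‖ ^ 2 + ‖b‖ ^ 2) := by
    intro a b
    have h1 : HasFDerivAt (fun z => G₁ (f₁ z) - (3 : ℝ) • (f₁ - f₂) z) _ zz :=
      (HasFDerivAt.comp zz (f := f₁) (g := G₁) hX₁ f₁.hasFDerivAt).sub
        ((f₁ - f₂).hasFDerivAt.const_smul (3 : ℝ))
    have h2 : HasFDerivAt (fun z => G₂ (f₂ z) + (3 : ℝ) • (f₁ - f₂) z) _ zz :=
      (HasFDerivAt.comp zz (f := f₂) (g := G₂) hX₂ f₂.hasFDerivAt).add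
        ((f₁ - f₂).hasFDerivAt.const_smul (3 : ℝ))
    have h3 : HasFDerivAt G _ zz :=
      (e.symm : V × V →L[ℝ] WithLp 2 (V × V)).hasFDerivAt.comp zz (h1.prodMk h2)
    have h4 := hAle (WithLp.toLp 2 (a, b))
    rw [hA.unique h3, WithLp.prod_norm_sq_eq_of_L2] at h4
    simp [e, f₁, f₂, WithLp.prod_inner_apply, inner_sub_left, inner_add_left,
      real_inner_smul_left] at h4
    rw [norm_sub_sq_real]
    have h5 := real_inner_comm a b
    linarith
  -- Taking b = 0 bounds the Hessian by 4, far from the extremal value 12; this is what yields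
  -- contact.
  have hc₁ : ∀ a, inner ℝ (X₁ a) a ≤ 4 * ‖a‖ ^ 2 := fun a => by
    have := hquad a 0
    simp at this
    nlinarith [sq_nonneg ‖a‖]
  have hc₂ : ∀ a, inner ℝ (X₂ a) a ≤ 4 * ‖a‖ ^ 2 := fun a => by
    have := hquad 0 a
    simp at this
    nlinarith [sq_nonneg ‖a‖]
  obtain ⟨z, hzK, hz⟩ := hcont₁ x X₁ 4 (by norm_num) hX₁ hc₁
  obtain ⟨w, hwK, hw⟩ := hcont₂ x' X₂ 4 (by norm_num) hX₂ hc₂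
  obtain ⟨hzx, hX₁ge, hev₁⟩ := exists_contact hW₁ hge₁ hz hzK hX₁ hη0
  obtain ⟨hwx, hX₂ge, hev₂⟩ := exists_contact hW₂ hge₂ hw hwK hX₂ hη0
  -- smallness
  have hg₁ : ‖G₁ x - (3 : ℝ) • (x - x')‖ < η :=
    (WithLp.norm_fst_le V (G zz)).trans_lt hz2
  have hg₂ : ‖G₂ x' + (3 : ℝ) • (x - x')‖ < η :=
    (WithLp.norm_snd_le V (G zz)).trans_lt hz2
  have hxx₁ : ‖x - xh‖ < η :=
    (WithLp.norm_fst_le V (zz - WithLp.toLp 2 (xh, xh'))).trans_lt hz1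
  have hxx₂ : ‖x' - xh'‖ < η :=
    (WithLp.norm_snd_le V (zz - WithLp.toLp 2 (xh, xh'))).trans_lt hz1
  have hp : ‖G₁ x - d‖ ≤ 7 * η := by
    have : G₁ x - d = (G₁ x - (3 : ℝ) • (x - x')) + (3 : ℝ) • ((x - xh) - (x' - xh')) := by
      have : d = (3 : ℝ) • (xh - xh') := by rw [hxx, smul_smul]; norm_num
      rw [this]; module
    rw [this]
    refine (norm_add_le _ _).trans ?_
    rw [norm_smul]
    have := norm_sub_le (x - xh) (x' - xh')
    norm_num
    linarith
  have hq : ‖-G₂ x' - d‖ ≤ 7 * η := by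
    have : -G₂ x' - d = (3 : ℝ) • ((x - xh) - (x' - xh')) - (G₂ x' + (3 : ℝ) • (x - x')) := by
      have : d = (3 : ℝ) • (xh - xh') := by rw [hxx, smul_smul]; norm_num
      rw [this]; module
    rw [this]
    refine (norm_sub_le _ _).trans ?_
    rw [norm_smul]
    have := norm_sub_le (x - xh) (x' - xh')
    norm_num
    linarith
  -- Adding 2η times the identity absorbs the Taylor error η|y − z|², so the touching inequalities
  -- hold without remainder.
  refine ⟨z, hzK, w, hwK, G₁ x, -G₂ x', X₁ + (2 * η) • .id ℝ V, -(X₂ + (2 * η) • .id ℝ V),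
    ?_, ?_, by linarith, by linarith, ?_, ?_, ?_, ?_, ?_, ?_, ?_, ?_⟩
  · have : z - z₀ = (x - xh) + (1 / 3 : ℝ) • (G₁ x - d) := by rw [hzx, hxh]; module
    rw [this]
    refine (norm_add_le _ _).trans_lt ?_
    rw [norm_smul]
    norm_num
    linarith
  · have : w - w₀ = (x' - xh') - (1 / 3 : ℝ) • (-G₂ x' - d) := by rw [hwx, hxh']; module
    rw [this]
    refine (norm_sub_le _ _).trans_lt ?_
    rw [norm_smul]
    norm_num
    linarith
  · have h1 : F (WithLp.toLp 2 (xh, xh')) ≥ m := by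
      have h1 := hge₁ xh z₀ hz₀
      have h2 := hge₂ xh' w₀ hw₀
      have h3 : ‖xh - z₀‖ ^ 2 = 1 / 9 * ‖d‖ ^ 2 := by
        have : xh - z₀ = -((1 / 3 : ℝ) • d) := by rw [hxh]; abel
        rw [this, norm_neg, norm_smul, mul_pow]; norm_num
      have h4 : ‖xh' - w₀‖ ^ 2 = 1 / 9 * ‖d‖ ^ 2 := by
        have : xh' - w₀ = (1 / 3 : ℝ) • d := by rw [hxh']; abel
        rw [this, norm_smul, mul_pow]; norm_num
      have h5 : ‖xh - xh'‖ ^ 2 = 1 / 9 * ‖d‖ ^ 2 := by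
        rw [hxx, norm_smul, mul_pow]; norm_num
      change m ≤ W₁ xh + W₂ xh' - 3 / 2 * ‖xh - xh'‖ ^ 2
      rw [h3] at h1
      rw [h4] at h2
      rw [h5]
      linarith
    have h2 : F zz = W₁ x + W₂ x' - 3 / 2 * ‖x - x'‖ ^ 2 := rfl
    have : 0 ≤ ‖x - x'‖ ^ 2 := by positivity
    have : 0 ≤ ‖x - z‖ ^ 2 := by positivity
    have : 0 ≤ ‖x' - w‖ ^ 2 := by positivity
    linarith
  · intro a b
    have := inner_symm_of_hasFDerivAt_gradient hW₁ hX₁ a b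
    simp only [add_apply, smul_apply, ContinuousLinearMap.id_apply, inner_add_left,
      real_inner_smul_left]
    rw [this, real_inner_comm a b]
  · intro a b
    have := inner_symm_of_hasFDerivAt_gradient hW₂ hX₂ a b
    simp only [neg_apply, add_apply, smul_apply, ContinuousLinearMap.id_apply, inner_add_left,
      inner_neg_left, real_inner_smul_left]
    rw [this, real_inner_comm a b]
  · intro a b
    have := hquad a b
    simp only [neg_apply, add_apply, smul_apply, ContinuousLinearMap.id_apply, inner_add_left,
      inner_neg_left, real_inner_smul_left, real_inner_self_eq_norm_sq]
    nlinarith [sq_nonneg ‖a‖, sq_nonneg ‖b‖]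
  · intro a
    have := hX₁ge a
    simp only [add_apply, smul_apply, ContinuousLinearMap.id_apply, inner_add_left,
      real_inner_smul_left, real_inner_self_eq_norm_sq]
    nlinarith [sq_nonneg ‖a‖]
  · intro a
    have := hX₂ge a
    simp only [neg_apply, add_apply, smul_apply, ContinuousLinearMap.id_apply, inner_add_left,
      inner_neg_left, real_inner_smul_left, real_inner_self_eq_norm_sq]
    nlinarith [sq_nonneg ‖a‖]
  · filter_upwards [hev₁] with y hy hyK
    have := hy hyK
    simp only [add_apply, smul_apply, ContinuousLinearMap.id_apply, inner_add_left,
      real_inner_smul_left, real_inner_self_eq_norm_sq]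
    linarith
  · filter_upwards [hev₂] with y hy hyK
    have := hy hyK
    simp only [neg_apply, add_apply, smul_apply, ContinuousLinearMap.id_apply, inner_add_left,
      inner_neg_left, real_inner_smul_left, real_inner_self_eq_norm_sq]
    linarith

end Sums

/-! ### Bilinear forms, symmetric matrices and the block inequality. -/

section Matrices

open Matrix

variable {d : ℕ}

theorem inner_opOf (X : Matrix (Fin d) (Fin d) ℝ) (a b : E d) :
    inner ℝ (opOf X a) b = b.ofLp ⬝ᵥ X *ᵥ a.ofLp := by
  rw [real_inner_comm]
  exact Matrix.inner_toEuclideanCLM X b a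

/-- The matrix of a bilinear form in the standard basis. -/
noncomputable def matrixOf (β : E d →L[ℝ] E d →L[ℝ] ℝ) : Matrix (Fin d) (Fin d) ℝ :=
  Matrix.of fun i j => β (EuclideanSpace.single j 1) (EuclideanSpace.single i 1)

theorem inner_opOf_matrixOf (β : E d →L[ℝ] E d →L[ℝ] ℝ) (a b : E d) :
    inner ℝ (opOf (matrixOf β) a) b = β a b := by
  have ha : a = ∑ j, a j • EuclideanSpace.single j (1 : ℝ) := by
    ext i; simp [Finset.sum_apply, Pi.single_apply]
  have hb : b = ∑ j, b j • EuclideanSpace.single j (1 : ℝ) := by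
    ext i; simp [Finset.sum_apply, Pi.single_apply]
  rw [inner_opOf]
  conv_rhs => rw [ha, hb]
  simp only [map_sum, map_smul, _root_.sum_apply, _root_.smul_apply, smul_eq_mul, dotProduct, mulVec, matrixOf,
    of_apply, Finset.mul_sum]
  refine Finset.sum_congr rfl fun i _ => Finset.sum_congr rfl fun j _ => ?_
  ring

theorem matrixOf_isSymm {β : E d →L[ℝ] E d →L[ℝ] ℝ} (h : ∀ a b, β a b = β b a) :
    (matrixOf β).IsSymm :=
  Matrix.IsSymm.ext fun _ _ => h _ _

theorem norm_opOf_matrixOf_le (β : E d →L[ℝ] E d →L[ℝ] ℝ) : ‖opOf (matrixOf β)‖ ≤ ‖β‖ := by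
  refine ContinuousLinearMap.opNorm_le_bound _ (norm_nonneg β) fun a => ?_
  set c := opOf (matrixOf β) a with hc
  have h1 : ‖c‖ * ‖c‖ ≤ ‖β‖ * ‖a‖ * ‖c‖ := by
    rw [← real_inner_self_eq_norm_mul_norm, hc, inner_opOf_matrixOf, ← hc]
    exact (le_abs_self _).trans (β.le_opNorm₂ a c)
  rcases eq_or_lt_of_le (norm_nonneg c) with h | h
  · rw [← h]; positivity
  · exact le_of_mul_le_mul_right h1 h

theorem matrixIneq_of_forall {α : ℝ} {X Y : Sym d}
    (h : ∀ a b : E d, inner ℝ (opOf X.1 a) a - inner ℝ (opOf Y.1 b) b ≤ 3 * α * ‖a - b‖ ^ 2)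
    (hX : ∀ a : E d, -(3 * α) * ‖a‖ ^ 2 ≤ inner ℝ (opOf X.1 a) a)
    (hY : ∀ b : E d, inner ℝ (opOf Y.1 b) b ≤ 3 * α * ‖b‖ ^ 2) : MatrixIneq α X Y := by
  have hXs : X.1ᵀ = X.1 := X.2
  have hYs : Y.1ᵀ = Y.1 := Y.2
  have hn : ∀ a : E d, ‖a‖ ^ 2 = a.ofLp ⬝ᵥ a.ofLp := fun a => by
    rw [← real_inner_self_eq_norm_sq, EuclideanSpace.inner_eq_star_dotProduct]
    simp
  constructor
  · rw [Matrix.le_iff]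
    refine .of_dotProduct_mulVec_nonneg ?_ fun x => ?_
    · rw [Matrix.IsHermitian, conjTranspose_eq_transpose_of_trivial]
      simp [fromBlocks_transpose, hXs, hYs, transpose_smul]
    · have h1 := hX (WithLp.toLp 2 (x ∘ Sum.inl))
      have h2 := hY (WithLp.toLp 2 (x ∘ Sum.inr))
      rw [inner_opOf, hn] at h1 h2
      simp only [star_trivial, sub_mulVec, smul_mulVec, fromBlocks_mulVec, dotProduct_sub,
        dotProduct_smul, dotProduct_block, Sum.elim_comp_inl, Sum.elim_comp_inr, zero_mulVec,
        one_mulVec, add_zero, zero_add, neg_mulVec, dotProduct_neg, smul_eq_mul]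
      linarith
  · rw [Matrix.le_iff]
    refine .of_dotProduct_mulVec_nonneg ?_ fun x => ?_
    · rw [Matrix.IsHermitian, conjTranspose_eq_transpose_of_trivial]
      simp [transpose_sub, fromBlocks_transpose, hXs, hYs, transpose_smul]
    · have h1 := h (WithLp.toLp 2 (x ∘ Sum.inl)) (WithLp.toLp 2 (x ∘ Sum.inr))
      rw [inner_opOf, inner_opOf, hn] at h1
      simp only [star_trivial, sub_mulVec, smul_mulVec, fromBlocks_mulVec, dotProduct_sub,
        dotProduct_smul, dotProduct_block, Sum.elim_comp_inl, Sum.elim_comp_inr, zero_mulVec,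
        one_mulVec, add_zero, zero_add, neg_mulVec, dotProduct_neg, smul_eq_mul, WithLp.ofLp_sub,
        dotProduct_add, sub_dotProduct] at h1 ⊢
      have := dotProduct_comm (x ∘ Sum.inl) (x ∘ Sum.inr)
      linarith

/-- Polarization together with the parallelogram law bounds each entry of Y by C. Compactness is
what allows uniform continuity of H in time to be used over all relevant Hessians. -/
theorem exists_isCompact_sym (d : ℕ) (C : ℝ) : ∃ S : Set (Sym d), IsCompact S ∧
    ∀ Y : Sym d, (∀ a : E d, |inner ℝ (opOf Y.1 a) a| ≤ C * ‖a‖ ^ 2) → Y ∈ S := by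
  have h1 : IsCompact (Set.pi univ fun _ : Fin d => Set.pi univ fun _ : Fin d => Icc (-C) C) :=
    isCompact_univ_pi fun _ => isCompact_univ_pi fun _ => isCompact_Icc
  have hcl : IsClosed {X : Matrix (Fin d) (Fin d) ℝ | X.IsSymm} :=
    isClosed_eq continuous_id.matrix_transpose continuous_id
  refine ⟨_, hcl.isClosedEmbedding_subtypeVal.isCompact_preimage h1, fun Y hY => ?_⟩
  refine mem_preimage.2 (mem_univ_pi.2 fun i => mem_univ_pi.2 fun j => ?_)
  rw [mem_Icc, ← abs_le]
  set e : Fin d → E d := fun i => EuclideanSpace.single i (1 : ℝ) with he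
  have hij : inner ℝ (opOf Y.1 (e j)) (e i) = Y.1 i j := by
    rw [inner_opOf]; simp [he]
  have hji : inner ℝ (opOf Y.1 (e i)) (e j) = Y.1 i j := by
    rw [inner_opOf, ← Y.2.apply i j]; simp [he]
  have hp := hY (e i + e j)
  have hm := hY (e i - e j)
  have hpar : ‖e i + e j‖ ^ 2 + ‖e i - e j‖ ^ 2 = 4 := by
    have := parallelogram_law_with_norm ℝ (e i) (e j)
    have h1 : ‖e i‖ = 1 := by simp [he]
    have h2 : ‖e j‖ = 1 := by simp [he]
    rw [h1, h2] at this
    nlinarith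
  simp only [map_add, map_sub, inner_add_left, inner_add_right, inner_sub_left,
    inner_sub_right, hij, hji] at hp hm
  rw [abs_le] at *
  constructor <;> nlinarith

end Matrices

/-! ### Jets in time and space with separate penalties. -/

section ParabolicJets

variable {d : ℕ}

/-- Linear change of variables turning an anisotropic penalty into an isotropic one. -/
theorem exists_scaling (d : ℕ) {μ ν : ℝ} (hμ : 0 < μ) (hν : 0 < ν) :
    ∃ (S : ℝ × E d →L[ℝ] WithLp 2 (ℝ × E d)) (R : WithLp 2 (ℝ × E d) →L[ℝ] ℝ × E d),
      (∀ z, (S z).fst = μ * z.1) ∧ (∀ z, (S z).snd = ν • z.2) ∧ ∀ z, R (S z) = z := by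
  let e : WithLp 2 (ℝ × E d) ≃L[ℝ] ℝ × E d := WithLp.prodContinuousLinearEquiv 2 ℝ ℝ (E d)
  refine ⟨(e.symm : ℝ × E d →L[ℝ] _).comp
    ((μ • ContinuousLinearMap.fst ℝ ℝ (E d)).prod (ν • ContinuousLinearMap.snd ℝ ℝ (E d))),
    (((μ⁻¹ • ContinuousLinearMap.fst ℝ ℝ (E d)).prod
      (ν⁻¹ • ContinuousLinearMap.snd ℝ ℝ (E d))).comp (e : _ →L[ℝ] ℝ × E d)),
    fun z => rfl, fun z => rfl, fun z => ?_⟩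
  ext1
  · change μ⁻¹ * (μ * z.1) = z.1
    rw [inv_mul_cancel_left₀ hμ.ne']
  · change ν⁻¹ • (ν • z.2) = z.2
    rw [inv_smul_smul₀ hν.ne']

theorem exists_bilinear_comp {V W : Type*} [NormedAddCommGroup V] [InnerProductSpace ℝ V]
    [NormedAddCommGroup W] [NormedSpace ℝ W] (S : W →L[ℝ] V) (X : V →L[ℝ] V) :
    ∃ B : W →L[ℝ] W →L[ℝ] ℝ, ∀ z w, B z w = inner ℝ (X (S z)) (S w) := by
  let I : V →L[ℝ] V →L[ℝ] ℝ := LinearMap.mkContinuous₂ (innerₗ V) 1 fun a b => by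
    simpa using norm_inner_le_norm (𝕜 := ℝ) a b
  exact ⟨I.bilinearComp (X.comp S) S, fun z w => rfl⟩

/-- The approximate theorem on sums in time-space coordinates with an anisotropic penalty. -/
theorem exists_parabolic_jets {K : Set (ℝ × E d)} (hK : IsCompact K)
    {U U' : ℝ × E d → ℝ} (hU : UpperSemicontinuousOn U K) (hU' : LowerSemicontinuousOn U' K)
    {z₀ w₀ : ℝ × E d} (hz₀ : z₀ ∈ K) (hw₀ : w₀ ∈ K) {α κ : ℝ} (hα : 0 < α) (hκ : 0 < κ)
    (hmax : ∀ z ∈ K, ∀ w ∈ K,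
      U z - U' w - (κ / 2 * (z.1 - w.1) ^ 2 + α / 2 * ‖z.2 - w.2‖ ^ 2)
        ≤ U z₀ - U' w₀ - (κ / 2 * (z₀.1 - w₀.1) ^ 2 + α / 2 * ‖z₀.2 - w₀.2‖ ^ 2))
    {θ : ℝ} (hθ : 0 < θ) :
    ∃ z ∈ K, ∃ w ∈ K, ∃ (a b : ℝ) (p q : E d) (B C : (ℝ × E d) →L[ℝ] (ℝ × E d) →L[ℝ] ℝ)
      (X Y : Sym d),
      ‖z - z₀‖ < θ ∧ ‖w - w₀‖ < θ ∧
      |a - κ * (z₀.1 - w₀.1)| < θ ∧ |b - κ * (z₀.1 - w₀.1)| < θ ∧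
      ‖p - α • (z₀.2 - w₀.2)‖ < θ ∧ ‖q - α • (z₀.2 - w₀.2)‖ < θ ∧
      U z₀ - U' w₀ - (κ / 2 * (z₀.1 - w₀.1) ^ 2 + α / 2 * ‖z₀.2 - w₀.2‖ ^ 2) - θ < U z - U' w ∧
      (∀ a b, B a b = B b a) ∧ (∀ a b, C a b = C b a) ∧
      (∀ a b : E d, B (0, a) (0, b) = inner ℝ (opOf X.1 a) b) ∧
      (∀ a b : E d, C (0, a) (0, b) = inner ℝ (opOf Y.1 a) b) ∧
      (∀ a b : E d, inner ℝ (opOf X.1 a) a - inner ℝ (opOf Y.1 b) b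
        ≤ 3 * α * ‖a - b‖ ^ 2 + θ * (‖a‖ ^ 2 + ‖b‖ ^ 2)) ∧
      (∀ a : E d, -(3 * α) * ‖a‖ ^ 2 ≤ inner ℝ (opOf X.1 a) a) ∧
      (∀ b : E d, inner ℝ (opOf Y.1 b) b ≤ 3 * α * ‖b‖ ^ 2) ∧
      (∀ᶠ y in nhds z, y ∈ K →
        U y ≤ U z + (a * (y.1 - z.1) + inner ℝ p (y.2 - z.2) + 1 / 2 * B (y - z) (y - z))) ∧
      ∀ᶠ y in nhds w, y ∈ K →
        U' w + (b * (y.1 - w.1) + inner ℝ q (y.2 - w.2) + 1 / 2 * C (y - w) (y - w)) ≤ U' y := by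
  -- Scaling time by √κ and space by √α makes the penalty equal to half the squared Euclidean
  -- distance.
  obtain ⟨μ, hμ0, hμ⟩ : ∃ μ : ℝ, 0 < μ ∧ μ ^ 2 = κ := ⟨√κ, Real.sqrt_pos.2 hκ, Real.sq_sqrt hκ.le⟩
  obtain ⟨ν, hν0, hν⟩ : ∃ ν : ℝ, 0 < ν ∧ ν ^ 2 = α := ⟨√α, Real.sqrt_pos.2 hα, Real.sq_sqrt hα.le⟩
  obtain ⟨S, R, hS1, hS2, hRS⟩ := exists_scaling d hμ0 hν0
  have hnorm : ∀ z w, ‖S z - S w‖ ^ 2 = κ * (z.1 - w.1) ^ 2 + α * ‖z.2 - w.2‖ ^ 2 := by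
    intro z w
    rw [← map_sub, WithLp.prod_norm_sq_eq_of_L2, hS1, hS2, norm_mul, norm_smul, mul_pow, mul_pow,
      Real.norm_of_nonneg hμ0.le, Real.norm_of_nonneg hν0.le, hμ, hν]
    simp
  have hKS : IsCompact (S '' K) := hK.image S.continuous
  have hmaps : MapsTo R (S '' K) K := by
    rintro _ ⟨z, hz, rfl⟩
    rwa [hRS]
  have hUS : UpperSemicontinuousOn (fun z => U (R z)) (S '' K) :=
    UpperSemicontinuousOn.comp hU R.continuous.continuousOn hmaps
  have hUS' : LowerSemicontinuousOn (fun z => U' (R z)) (S '' K) :=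
    LowerSemicontinuousOn.comp hU' R.continuous.continuousOn hmaps
  obtain ⟨η, hη0, h1, h2, h3, h4, h5, h6⟩ : ∃ η : ℝ, 0 < η ∧ μ⁻¹ * η < θ ∧ ν⁻¹ * η < θ ∧
      μ * η < θ ∧ ν * η < θ ∧ α * η < θ ∧ η < θ := by
    have hev : ∀ c : ℝ, ∀ᶠ η : ℝ in nhdsWithin 0 (Ioi 0), c * η < θ := fun c => by
      have : Filter.Tendsto (fun η : ℝ => c * η) (nhdsWithin 0 (Ioi 0)) (nhds (c * 0)) :=
        ((continuous_const.mul continuous_id).tendsto 0).mono_left nhdsWithin_le_nhds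
      exact this.eventually (gt_mem_nhds (by simpa using hθ))
    obtain ⟨η, a1, a2, a3, a4, a5, a6, a7⟩ := ((hev μ⁻¹).and ((hev ν⁻¹).and ((hev μ).and
      ((hev ν).and ((hev α).and ((hev 1).and self_mem_nhdsWithin)))))).exists
    exact ⟨η, a7, a1, a2, a3, a4, a5, by simpa using a6⟩
  obtain ⟨_, ⟨z, hzK, rfl⟩, _, ⟨w, hwK, rfl⟩, p, q, X, Y, hz, hw, hp, hq, hval, hXs, hYs, hXY, hXl,
    hYu, hjetU, hjetU'⟩ := exists_approximate_jets hKS hUS hUS' (mem_image_of_mem S hz₀)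
      (mem_image_of_mem S hw₀) (by
        rintro _ ⟨z, hz, rfl⟩ _ ⟨w, hw, rfl⟩
        have := hmax z hz w hw
        simp only [hRS, hnorm]
        linarith) hη0
  choose form hform using fun X => exists_bilinear_comp S X
  -- Only the spatial block of the second order jet enters the equation.
  obtain ⟨sform, hsform⟩ : ∃ sform : (WithLp 2 (ℝ × E d) →L[ℝ] WithLp 2 (ℝ × E d)) →
      E d →L[ℝ] E d →L[ℝ] ℝ, ∀ X a b, sform X a b = form X (0, a) (0, b) :=
    ⟨fun X => (form X).bilinearComp (.inr ℝ ℝ (E d)) (.inr ℝ ℝ (E d)), fun X a b => rfl⟩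
  have hXs' : ∀ a b, form X a b = form X b a := fun a b => by
    rw [hform, hform]; exact hXs _ _
  have hYs' : ∀ a b, form Y a b = form Y b a := fun a b => by
    rw [hform, hform]; exact hYs _ _
  have hnι : ∀ a : E d, ‖S (0, a)‖ ^ 2 = α * ‖a‖ ^ 2 := fun a => by
    simpa using hnorm (0, a) 0
  have hdist : ∀ y y₀ : ℝ × E d, ‖S y - S y₀‖ < η → ‖y - y₀‖ < θ := by
    intro y y₀ h
    rw [← map_sub] at h
    have hf := (WithLp.norm_fst_le _ (S (y - y₀))).trans_lt h
    have hs := (WithLp.norm_snd_le _ (S (y - y₀))).trans_lt h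
    rw [hS1, norm_mul, Real.norm_of_nonneg hμ0.le] at hf
    rw [hS2, norm_smul, Real.norm_of_nonneg hν0.le] at hs
    rw [Prod.norm_def, max_lt_iff]
    constructor
    · refine lt_trans ?_ h1
      rw [← div_eq_inv_mul, lt_div_iff₀ hμ0]; linarith
    · refine lt_trans ?_ h2
      rw [← div_eq_inv_mul, lt_div_iff₀ hν0]; linarith
  have hfst : ∀ r : WithLp 2 (ℝ × E d), ‖r - (S z₀ - S w₀)‖ < η → |μ * r.fst - κ * (z₀.1 - w₀.1)| < θ := by
    intro r h
    have hf := (WithLp.norm_fst_le _ (r - (S z₀ - S w₀))).trans_lt h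
    have : μ * r.fst - κ * (z₀.1 - w₀.1) = μ * (r - (S z₀ - S w₀)).fst := by
      rw [WithLp.sub_fst, WithLp.sub_fst, hS1, hS1, ← hμ]; ring
    rw [this, abs_mul, abs_of_pos hμ0]
    exact (mul_lt_mul_of_pos_left hf hμ0).trans h3
  have hsnd : ∀ r : WithLp 2 (ℝ × E d), ‖r - (S z₀ - S w₀)‖ < η → ‖ν • r.snd - α • (z₀.2 - w₀.2)‖ < θ := by
    intro r h
    have hf := (WithLp.norm_snd_le _ (r - (S z₀ - S w₀))).trans_lt h
    have : ν • r.snd - α • (z₀.2 - w₀.2) = ν • (r - (S z₀ - S w₀)).snd := by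
      rw [WithLp.sub_snd, WithLp.sub_snd, hS2, hS2, ← hν]; module
    rw [this, norm_smul, Real.norm_of_nonneg hν0.le]
    exact (mul_lt_mul_of_pos_left hf hν0).trans h4
  have hlin : ∀ (r : WithLp 2 (ℝ × E d)) (y : ℝ × E d),
      inner ℝ r (S y) = μ * r.fst * y.1 + inner ℝ (ν • r.snd) y.2 := by
    intro r y
    rw [WithLp.prod_inner_apply]
    change inner ℝ r.fst (S y).fst + inner ℝ r.snd (S y).snd = _
    rw [hS1, hS2, real_inner_smul_left, real_inner_smul_right]
    simp
    ring
  have hpen : κ / 2 * (z₀.1 - w₀.1) ^ 2 + α / 2 * ‖z₀.2 - w₀.2‖ ^ 2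
      = 1 / 2 * ‖S z₀ - S w₀‖ ^ 2 := by rw [hnorm]; ring
  refine ⟨z, hzK, w, hwK, μ * p.fst, μ * q.fst, ν • p.snd, ν • q.snd, form X, form Y,
    ⟨matrixOf (sform X), matrixOf_isSymm fun a b => by rw [hsform, hsform]; exact hXs' _ _⟩,
    ⟨matrixOf (sform Y), matrixOf_isSymm fun a b => by rw [hsform, hsform]; exact hYs' _ _⟩,
    hdist _ _ hz, hdist _ _ hw, hfst p hp, hfst q hq, hsnd p hp, hsnd q hq, ?_, hXs', hYs',
    ?_, ?_, ?_, ?_, ?_, ?_, ?_⟩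
  · simp only [hRS] at hval
    rw [hpen]
    linarith
  · intro a b; rw [inner_opOf_matrixOf, hsform]
  · intro a b; rw [inner_opOf_matrixOf, hsform]
  · intro a b
    rw [inner_opOf_matrixOf, inner_opOf_matrixOf, hsform, hsform, hform, hform]
    have h := hXY (S (0, a)) (S (0, b))
    rw [hnι, hnι, hnorm] at h
    have h7 : 0 ≤ ‖a‖ ^ 2 + ‖b‖ ^ 2 := by positivity
    simp only [sub_self] at h
    nlinarith [mul_le_mul_of_nonneg_right h5.le h7]
  · intro a
    rw [inner_opOf_matrixOf, hsform, hform]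
    have h := hXl (S (0, a))
    rw [hnι] at h
    linarith
  · intro a
    rw [inner_opOf_matrixOf, hsform, hform]
    have h := hYu (S (0, a))
    rw [hnι] at h
    linarith
  · filter_upwards [(S.continuous.tendsto z).eventually hjetU] with y hy hyK
    have := hy (mem_image_of_mem S hyK)
    simp only [hRS, ← map_sub] at this
    rw [hlin p] at this
    rw [hform]
    simpa only [Prod.fst_sub, Prod.snd_sub, add_assoc] using this
  · filter_upwards [(S.continuous.tendsto w).eventually hjetU'] with y hy hyK
    have := hy (mem_image_of_mem S hyK)
    simp only [hRS, ← map_sub] at this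
    rw [hlin q] at this
    rw [hform]
    simpa only [Prod.fst_sub, Prod.snd_sub, add_assoc] using this

end ParabolicJets

/-! ### From local C² functions to admissible test functions. -/

section TestFunctions

variable {d : ℕ}

theorem exists_gradient_map (d : ℕ) : ∃ g : ((ℝ × E d) →L[ℝ] ℝ) →L[ℝ] E d,
    ∀ l a, inner ℝ (g l) a = l (0, a) := by
  let e : E d ≃L[ℝ] (Fin d → ℝ) := EuclideanSpace.equiv (Fin d) ℝ
  refine ⟨(e.symm : (Fin d → ℝ) →L[ℝ] E d).comp (ContinuousLinearMap.pi fun i =>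
    ContinuousLinearMap.apply ℝ ℝ ((0 : ℝ), (EuclideanSpace.single i (1 : ℝ) : E d))),
    fun l a => ?_⟩
  have ha : a = ∑ j, a j • EuclideanSpace.single j (1 : ℝ) := by
    ext i; simp [Finset.sum_apply, Pi.single_apply]
  have h0 : l (0, a) = (l.comp (.inr ℝ ℝ (E d))) a := by simp
  rw [h0]
  conv_rhs => rw [ha, map_sum]
  simp [PiLp.inner_apply, e]

/-- A compactly supported `C²` function that agrees with a given one near a point. -/
theorem exists_compactSupport_eventuallyEq {W : Type*} [NormedAddCommGroup W] [NormedSpace ℝ W]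
    [FiniteDimensional ℝ W] {φ : W → ℝ} {z₀ : W} (hφ : ContDiffAt ℝ 2 φ z₀) :
    ∃ Φ : W → ℝ, ContDiff ℝ 2 Φ ∧ HasCompactSupport Φ ∧ Φ =ᶠ[nhds z₀] φ := by
  have h1 : ∀ᶠ z in nhds z₀, ContDiffAt ℝ 2 φ z := hφ.eventually (by simp)
  obtain ⟨r, hr, hball⟩ := Metric.eventually_nhds_iff_ball.1 h1
  -- The support of χ lies in the closed ball of radius r/2, where φ is already C².
  let χ : ContDiffBump z₀ := ⟨r / 4, r / 2, by linarith, by linarith⟩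
  refine ⟨fun z => χ z * φ z, contDiff_iff_contDiffAt.2 fun z => ?_, χ.hasCompactSupport.mul_right, ?_⟩
  · by_cases hz : z ∈ tsupport χ
    swap
    · have h2 : (fun z => χ z * φ z) =ᶠ[nhds z] fun _ => 0 := by
        filter_upwards [notMem_tsupport_iff_eventuallyEq.1 hz] with y hy
        rw [hy]; simp
      exact contDiffAt_const.congr_of_eventuallyEq h2
    have hz' := hz
    rw [χ.tsupport_eq] at hz'
    exact χ.contDiffAt.mul (hball z (Metric.closedBall_subset_ball (by simp [χ]; linarith) hz'))
  · filter_upwards [χ.eventuallyEq_one] with z hz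
    rw [hz]; simp

theorem exists_bound_of_compactSupport {W : Type*} [NormedAddCommGroup W] [NormedSpace ℝ W]
    {Φ : W → ℝ} (hΦ : ContDiff ℝ 2 Φ) (hΦc : HasCompactSupport Φ) :
    ∃ C0 C1 C2 : ℝ, (∀ z, ‖Φ z‖ ≤ C0) ∧ (∀ z, ‖fderiv ℝ Φ z‖ ≤ C1) ∧
      ∀ z, ‖fderiv ℝ (fderiv ℝ Φ) z‖ ≤ C2 := by
  have hc1 : ContDiff ℝ 1 (fderiv ℝ Φ) := hΦ.fderiv_right (by norm_num)
  have hc2 : Continuous (fderiv ℝ (fderiv ℝ Φ)) := hc1.continuous_fderiv (by norm_num)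
  obtain ⟨C0, hC0⟩ := hΦc.isCompact.exists_bound_of_continuousOn hΦ.continuous.continuousOn
  obtain ⟨C1, hC1⟩ := hΦc.isCompact.exists_bound_of_continuousOn hc1.continuous.continuousOn
  have hc2n : Continuous fun z => ‖fderiv ℝ (fderiv ℝ Φ) z‖ :=
    (hc1.continuous_fderiv (by norm_num)).norm
  obtain ⟨C2, hC2⟩ := hΦc.isCompact.exists_bound_of_continuousOn hc2n.continuousOn
  have hout : ∀ z, z ∉ tsupport Φ → Φ z = 0 ∧ fderiv ℝ Φ z = 0 ∧
      fderiv ℝ (fderiv ℝ Φ) z = 0 := by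
    intro z hz
    have h0 : Φ =ᶠ[nhds z] fun _ => 0 := notMem_tsupport_iff_eventuallyEq.1 hz
    have h1 : fderiv ℝ Φ =ᶠ[nhds z] fun _ => 0 := by
      refine h0.fderiv.trans (Filter.Eventually.of_forall fun y => ?_)
      simp
    refine ⟨h0.self_of_nhds, h1.self_of_nhds, ?_⟩
    rw [h1.fderiv_eq]
    simp
  refine ⟨max C0 0, max C1 0, max C2 0, fun z => ?_, fun z => ?_, fun z => ?_⟩ <;>
    by_cases hz : z ∈ tsupport Φ
  · exact (hC0 z hz).trans (le_max_left _ _)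
  · rw [(hout z hz).1, norm_zero]; exact le_max_right _ _
  · exact (hC1 z hz).trans (le_max_left _ _)
  · rw [(hout z hz).2.1, norm_zero]; exact le_max_right _ _
  · exact ((le_abs_self _).trans (hC2 z hz)).trans (le_max_left _ _)
  · rw [(hout z hz).2.2]; exact (norm_zero (E := W →L[ℝ] W →L[ℝ] ℝ)).le.trans (le_max_right _ _)

theorem hasFDerivAt_slice (d : ℕ) : ∃ ι : E d →L[ℝ] ℝ × E d, (∀ a, ι a = (0, a)) ∧
    ∀ t x, HasFDerivAt (fun y : E d => (t, y)) ι x :=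
  ⟨ContinuousLinearMap.inr ℝ ℝ (E d), fun _ => rfl, fun t x => hasFDerivAt_prodMk_right t x⟩

theorem isC12_of_hasCompactSupport (T : ℝ) (D : Set (E d)) {Φ : ℝ × E d → ℝ}
    (hΦ : ContDiff ℝ 2 Φ) (hΦc : HasCompactSupport Φ) {g : ((ℝ × E d) →L[ℝ] ℝ) →L[ℝ] E d}
    (hg : ∀ l a, inner ℝ (g l) a = l (0, a)) {D2 : ℝ × E d → Sym d}
    (hD2 : ∀ z a b, inner ℝ (opOf (D2 z).1 a) b = fderiv ℝ (fderiv ℝ Φ) z (0, a) (0, b))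
    (hD2c : Continuous D2) :
    IsC12 T D (fun t x => Φ (t, x)) (fun t x => fderiv ℝ Φ (t, x) (1, 0))
      (fun t x => g (fderiv ℝ Φ (t, x))) (fun t x => D2 (t, x)) := by
  have hd : Differentiable ℝ Φ := hΦ.differentiable (by norm_num)
  have hc1 : ContDiff ℝ 1 (fderiv ℝ Φ) := hΦ.fderiv_right (by norm_num)
  have hdd : Differentiable ℝ (fderiv ℝ Φ) := hc1.differentiable (by norm_num)
  have hc2 : Continuous (fderiv ℝ (fderiv ℝ Φ)) := hc1.continuous_fderiv (by norm_num)
  obtain ⟨ι, hι, hx⟩ := hasFDerivAt_slice d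
  have hop : ∀ z, opOf (D2 z).1 = g.comp ((fderiv ℝ (fderiv ℝ Φ) z).comp ι) := by
    intro z
    ext1 a
    refine ext_inner_right ℝ fun b => ?_
    rw [hD2, ContinuousLinearMap.comp_apply, hg, ContinuousLinearMap.comp_apply, hι]
  obtain ⟨C0, C1, C2, hC0, hC1, hC2⟩ := exists_bound_of_compactSupport hΦ hΦc
  refine ⟨fun t _ x _ => ?_, fun t _ x _ => ?_, fun t _ x _ => ?_, hΦ.continuous.continuousOn,
    (hc1.continuous.clm_apply continuous_const).continuousOn,
    (g.continuous.comp hc1.continuous).continuousOn, hD2c.continuousOn,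
    max C0 (max C1 (max (‖g‖ * C1) (‖g‖ * (C2 * ‖ι‖)))), fun t _ x _ => ⟨?_, ?_, ?_, ?_⟩⟩
  · have h1 : HasDerivAt (fun s : ℝ => (s, x)) ((1 : ℝ), (0 : E d)) t :=
      (hasDerivAt_id t).prodMk (hasDerivAt_const t x)
    exact (hd (t, x)).hasFDerivAt.comp_hasDerivAt t h1
  · rw [hasGradientAt_iff_hasFDerivAt]
    refine ((hd (t, x)).hasFDerivAt.comp x (hx t x)).congr_fderiv ?_
    ext1 a
    rw [InnerProductSpace.toDual_apply_apply, hg, ContinuousLinearMap.comp_apply, hι]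
  · rw [hop]
    exact g.hasFDerivAt.comp x ((hdd (t, x)).hasFDerivAt.comp x (hx t x))
  · exact (hC0 (t, x)).trans (le_max_left _ _)
  · refine le_trans ?_ ((le_max_left C1 _).trans (le_max_right C0 _))
    refine ((fderiv ℝ Φ (t, x)).le_opNorm _).trans ?_
    have : ‖((1 : ℝ), (0 : E d))‖ = 1 := by simp [Prod.norm_def]
    rw [this, mul_one]
    exact hC1 _
  · refine le_trans ?_ (((le_max_left _ _).trans (le_max_right C1 _)).trans (le_max_right C0 _))
    exact (g.le_opNorm _).trans (mul_le_mul_of_nonneg_left (hC1 _) (norm_nonneg _))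
  · refine le_trans ?_ (((le_max_right _ _).trans (le_max_right C1 _)).trans (le_max_right C0 _))
    rw [hop]
    refine (ContinuousLinearMap.opNorm_comp_le _ _).trans
      (mul_le_mul_of_nonneg_left ?_ (norm_nonneg _))
    exact (ContinuousLinearMap.opNorm_comp_le _ _).trans
      (mul_le_mul_of_nonneg_right (hC2 _) (norm_nonneg _))

/-- Every function of class `C²` near a point agrees there with an admissible test function. -/
theorem exists_isC12 (T : ℝ) (D : Set (E d)) {φ : ℝ × E d → ℝ} {z₀ : ℝ × E d}
    (hφ : ContDiffAt ℝ 2 φ z₀) :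
    ∃ φ' φt Dφ D2φ, IsC12 T D φ' φt Dφ D2φ ∧ (∀ᶠ z in nhds z₀, φ' z.1 z.2 = φ z) ∧
      φt z₀.1 z₀.2 = fderiv ℝ φ z₀ (1, 0) ∧
      (∀ a, inner ℝ (Dφ z₀.1 z₀.2) a = fderiv ℝ φ z₀ (0, a)) ∧
      ∀ a b, inner ℝ (opOf (D2φ z₀.1 z₀.2).1 a) b
        = fderiv ℝ (fderiv ℝ φ) z₀ (0, a) (0, b) := by
  obtain ⟨Φ, hΦ, hΦc, hΦφ⟩ := exists_compactSupport_eventuallyEq hφ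
  obtain ⟨g, hg⟩ := exists_gradient_map d
  have hd : Differentiable ℝ Φ := hΦ.differentiable (by norm_num)
  have hc1 : ContDiff ℝ 1 (fderiv ℝ Φ) := hΦ.fderiv_right (by norm_num)
  have hdd : Differentiable ℝ (fderiv ℝ Φ) := hc1.differentiable (by norm_num)
  have hc2 : Continuous (fderiv ℝ (fderiv ℝ Φ)) := hc1.continuous_fderiv (by norm_num)
  have hsymm : ∀ z a b, fderiv ℝ (fderiv ℝ Φ) z a b = fderiv ℝ (fderiv ℝ Φ) z b a := fun z a b =>
    second_derivative_symmetric (fun y => (hd y).hasFDerivAt) (hdd z).hasFDerivAt a b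
  obtain ⟨β, hβ⟩ : ∃ β : ℝ × E d → E d →L[ℝ] E d →L[ℝ] ℝ,
      ∀ z a b, β z a b = fderiv ℝ (fderiv ℝ Φ) z (0, a) (0, b) :=
    ⟨fun z => (fderiv ℝ (fderiv ℝ Φ) z).bilinearComp (.inr ℝ ℝ (E d)) (.inr ℝ ℝ (E d)),
      fun z a b => rfl⟩
  have hβs : ∀ z, (matrixOf (β z)).IsSymm := fun z => matrixOf_isSymm fun a b => by
    rw [hβ, hβ]; exact hsymm _ _ _
  have hβc : Continuous fun z => (⟨matrixOf (β z), hβs z⟩ : Sym d) := by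
    refine Continuous.subtype_mk (continuous_matrix fun i j => ?_) _
    simp only [matrixOf, Matrix.of_apply, hβ]
    exact (hc2.clm_apply continuous_const).clm_apply continuous_const
  have hβe : ∀ z a b, inner ℝ (opOf (matrixOf (β z)) a) b
      = fderiv ℝ (fderiv ℝ Φ) z (0, a) (0, b) := fun z a b => by rw [inner_opOf_matrixOf, hβ]
  have e1 : fderiv ℝ Φ z₀ = fderiv ℝ φ z₀ := hΦφ.fderiv_eq
  have e2 : fderiv ℝ (fderiv ℝ Φ) z₀ = fderiv ℝ (fderiv ℝ φ) z₀ := hΦφ.fderiv.fderiv_eq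
  have hC := isC12_of_hasCompactSupport T D hΦ hΦc hg (D2 := fun z => ⟨matrixOf (β z), hβs z⟩) hβe hβc
  refine ⟨_, _, _, _, hC, hΦφ, ?_, fun a => ?_, fun a b => ?_⟩
  · rw [Prod.mk.eta, e1]
  · rw [hg, Prod.mk.eta, e1]
  · rw [hβe, Prod.mk.eta, e2]

/-- At a boundary point the minimum in the definition can be nonpositive only through the equation
once N⁻ is positive; so the equation holds at boundary points too. Multiplying by a cutoff supplies
the global boundedness required of test functions without changing the jet. -/
theorem IsSubsolution.le_of_test {T : ℝ} {D : Set (E d)} {H : Ham d} {h : E d → ℝ}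
    {u : ℝ → E d → ℝ} (hu : IsSubsolution T D H h u) {φ : ℝ × E d → ℝ}
    {z₀ : ℝ × E d} (ht : z₀.1 ∈ Ioo 0 T) (hx : z₀.2 ∈ closure D) (hφ : ContDiffAt ℝ 2 φ z₀)
    (hmax : ∀ᶠ z in nhds z₀, z ∈ Ioo 0 T ×ˢ closure D →
      u z.1 z.2 - φ z ≤ u z₀.1 z₀.2 - φ z₀) {q : E d} {X : Sym d}
    (hq : ∀ a, fderiv ℝ φ z₀ (0, a) = inner ℝ q a)
    (hX : ∀ a b, fderiv ℝ (fderiv ℝ φ) z₀ (0, a) (0, b) = inner ℝ (opOf X.1 a) b)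
    (hbd : z₀.2 ∈ frontier D → 0 < normalInf D z₀.2 q) :
    -fderiv ℝ φ z₀ (1, 0) + H z₀.1 z₀.2 (u z₀.1 z₀.2) q X ≤ 0 := by
  obtain ⟨φ', φt, Dφ, D2φ, hC, hev, h1, h2, h3⟩ := exists_isC12 T D hφ
  have hq' : Dφ z₀.1 z₀.2 = q := ext_inner_right ℝ fun a => by rw [h2, hq]
  have hX' : D2φ z₀.1 z₀.2 = X := by
    have h4 : opOf (D2φ z₀.1 z₀.2).1 = opOf X.1 := by
      ext1 a
      exact ext_inner_right ℝ fun b => by rw [← hX, ← h3]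
    exact Subtype.ext ((Matrix.toEuclideanCLM (n := Fin d) (𝕜 := ℝ)).injective h4)
  have hloc : IsLocalMaxOn (fun z : ℝ × E d => u z.1 z.2 - φ' z.1 z.2) (Ioo 0 T ×ˢ closure D)
      (z₀.1, z₀.2) := by
    have h4 := hev.self_of_nhds
    filter_upwards [nhdsWithin_le_nhds hev, nhdsWithin_le_nhds hmax, self_mem_nhdsWithin]
      with z hz hz' hzm
    simp only [hz, h4]
    exact hz' hzm
  rw [← h1, ← hq', ← hX']
  rw [closure_eq_self_union_frontier] at hx
  rcases hx with hx | hx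
  · exact hu.interior _ _ _ _ hC _ ht _ hx hloc
  · have h5 := hu.boundary _ _ _ _ hC _ ht _ hx hloc
    have h6 := hbd hx
    rw [← hq'] at h6
    rcases min_le_iff.1 h5 with h7 | h7
    · exact h7
    · linarith

theorem IsSupersolution.le_of_test {T : ℝ} {D : Set (E d)} {H : Ham d} {h : E d → ℝ}
    {v : ℝ → E d → ℝ} (hv : IsSupersolution T D H h v) {φ : ℝ × E d → ℝ}
    {z₀ : ℝ × E d} (ht : z₀.1 ∈ Ioo 0 T) (hx : z₀.2 ∈ closure D) (hφ : ContDiffAt ℝ 2 φ z₀)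
    (hmin : ∀ᶠ z in nhds z₀, z ∈ Ioo 0 T ×ˢ closure D →
      v z₀.1 z₀.2 - φ z₀ ≤ v z.1 z.2 - φ z) {q : E d} {X : Sym d}
    (hq : ∀ a, fderiv ℝ φ z₀ (0, a) = inner ℝ q a)
    (hX : ∀ a b, fderiv ℝ (fderiv ℝ φ) z₀ (0, a) (0, b) = inner ℝ (opOf X.1 a) b)
    (hbd : z₀.2 ∈ frontier D → normalSup D z₀.2 q < 0) :
    0 ≤ -fderiv ℝ φ z₀ (1, 0) + H z₀.1 z₀.2 (v z₀.1 z₀.2) q X := by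
  obtain ⟨φ', φt, Dφ, D2φ, hC, hev, h1, h2, h3⟩ := exists_isC12 T D hφ
  have hq' : Dφ z₀.1 z₀.2 = q := ext_inner_right ℝ fun a => by rw [h2, hq]
  have hX' : D2φ z₀.1 z₀.2 = X := by
    have h4 : opOf (D2φ z₀.1 z₀.2).1 = opOf X.1 := by
      ext1 a
      exact ext_inner_right ℝ fun b => by rw [← hX, ← h3]
    exact Subtype.ext ((Matrix.toEuclideanCLM (n := Fin d) (𝕜 := ℝ)).injective h4)
  have hloc : IsLocalMinOn (fun z : ℝ × E d => v z.1 z.2 - φ' z.1 z.2) (Ioo 0 T ×ˢ closure D)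
      (z₀.1, z₀.2) := by
    have h4 := hev.self_of_nhds
    filter_upwards [nhdsWithin_le_nhds hev, nhdsWithin_le_nhds hmin, self_mem_nhdsWithin]
      with z hz hz' hzm
    simp only [hz, h4]
    exact hz' hzm
  rw [← h1, ← hq', ← hX']
  rw [closure_eq_self_union_frontier] at hx
  rcases hx with hx | hx
  · exact hv.interior _ _ _ _ hC _ ht _ hx hloc
  · have h5 := hv.boundary _ _ _ _ hC _ ht _ hx hloc
    have h6 := hbd hx
    rw [← hq'] at h6
    rcases le_max_iff.1 h5 with h7 | h7
    · exact h7
    · linarith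

end TestFunctions

/-! ### Compactness tools, normals, and continuity of the Hamiltonian. -/

section Utilities

/-- On a compact set, an upper semicontinuous function that is below `b` on the zero set of a
nonnegative continuous function is below `b` where this function is small. -/
theorem exists_pos_forall_lt {X : Type*} [TopologicalSpace X] {C : Set X} (hC : IsCompact C)
    {F δ : X → ℝ} (hF : UpperSemicontinuousOn F C) (hδ : ContinuousOn δ C)
    (hδ0 : ∀ x ∈ C, 0 ≤ δ x) {b : ℝ} (h : ∀ x ∈ C, δ x = 0 → F x < b) :
    ∃ σ : ℝ, 0 < σ ∧ ∀ x ∈ C, δ x < σ → F x < b := by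
  -- The superlevel set {F ≥ b} in C is compact and misses the zeros of δ, so the minimum of δ over
  -- it serves as σ.
  have hA := hF.isCompact_inter_preimage_Ici hC b
  rcases (C ∩ F ⁻¹' Ici b).eq_empty_or_nonempty with hA0 | hA0
  · refine ⟨1, one_pos, fun x hx _ => ?_⟩
    by_contra! hcon
    exact notMem_empty x (hA0 ▸ ⟨hx, hcon⟩)
  · obtain ⟨x₀, hx₀, hmin⟩ := hA.exists_isMinOn hA0 (hδ.mono inter_subset_left)
    refine ⟨δ x₀, lt_of_le_of_ne (hδ0 x₀ hx₀.1) fun h0 => ?_, fun x hx hlt => ?_⟩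
    · exact absurd (h x₀ hx₀.1 h0.symm) (not_lt.2 hx₀.2)
    · by_contra! hcon
      exact absurd (hmin ⟨hx, hcon⟩ : δ x₀ ≤ δ x) (not_le.2 hlt)

theorem IsModulus.exists_pos {ω : ℝ → ℝ} (hω : IsModulus ω) {e : ℝ} (he : 0 < e) :
    ∃ ρ : ℝ, 0 < ρ ∧ ∀ s, 0 ≤ s → s ≤ ρ → ω s ≤ e := by
  have h1 := hω.continuousOn 0 self_mem_Ici
  have h2 : ∀ᶠ s in nhdsWithin 0 (Ici 0), ω s < e :=
    h1.eventually (gt_mem_nhds (by rw [hω.zero]; exact he))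
  obtain ⟨r, hr, hball⟩ := Metric.mem_nhdsWithin_iff.1 h2
  refine ⟨r / 2, by positivity, fun s hs hsr => ?_⟩
  have : s ∈ Metric.ball (0 : ℝ) r ∩ Ici 0 := by
    refine ⟨?_, hs⟩
    rw [Metric.mem_ball, Real.dist_eq, sub_zero, abs_of_nonneg hs]
    linarith
  exact (hball this).le

variable {d : ℕ}

/-- Expand |y − (x − 4r₀n)|² ≥ (4r₀)². The exterior ball is open, so avoiding D it also avoids the
closure of D. -/
theorem inner_normal_le {D : Set (E d)} {r₀ : ℝ} (hA : CondA D r₀) {x y n : E d}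
    (hx : x ∈ frontier D) (hy : y ∈ closure D) (hn : n ∈ normals D x) :
    inner ℝ (x - y) n ≤ ‖x - y‖ ^ 2 / (8 * r₀) := by
  obtain ⟨hr, hA⟩ := hA
  rw [(hA x hx).1] at hn
  obtain ⟨hn1, hn2⟩ := hn
  have hdisj : Disjoint (Metric.ball (x - (4 * r₀) • n) (4 * r₀)) (closure D) :=
    (disjoint_iff_inter_eq_empty.2 hn2).closure_right Metric.isOpen_ball
  have h1 : ¬ y ∈ Metric.ball (x - (4 * r₀) • n) (4 * r₀) := fun h =>
    Set.disjoint_left.1 hdisj h hy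
  rw [Metric.mem_ball, not_lt, dist_eq_norm] at h1
  have h2 : (4 * r₀) ^ 2 ≤ ‖y - (x - (4 * r₀) • n)‖ ^ 2 := by
    have : 0 ≤ 4 * r₀ := by positivity
    gcongr
  have h3 : y - (x - (4 * r₀) • n) = (4 * r₀) • n - (x - y) := by abel
  rw [h3, norm_sub_sq_real, norm_smul, hn1, mul_one, Real.norm_of_nonneg (by positivity),
    real_inner_smul_left, real_inner_comm] at h2
  rw [le_div_iff₀ (by positivity)]
  linarith

/-- Nonemptiness matters: the infimum of the empty set has the default value 0. A uniform c is
needed because the infimum need not be attained. -/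
theorem normalInf_pos {D : Set (E d)} {x q : E d} (hne : (normals D x).Nonempty) {c : ℝ}
    (hc : 0 < c) (h : ∀ n ∈ normals D x, inner ℝ q n ≤ -c) : 0 < normalInf D x q := by
  refine hc.trans_le (le_csInf (hne.image _) ?_)
  rintro _ ⟨n, hn, rfl⟩
  have := h n hn
  simp only [inner_neg_right]
  linarith

theorem normalSup_neg {D : Set (E d)} {x q : E d} (hne : (normals D x).Nonempty) {c : ℝ}
    (hc : 0 < c) (h : ∀ n ∈ normals D x, c ≤ inner ℝ q n) : normalSup D x q < 0 := by
  refine lt_of_le_of_lt (csSup_le (hne.image _) ?_) (neg_neg_of_pos hc)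
  rintro _ ⟨n, hn, rfl⟩
  have := h n hn
  simp only [inner_neg_right]
  linarith

theorem HypH1.mono {T : ℝ} {D : Set (E d)} {H : Ham d} (h1 : HypH1 T D H) {r r' t : ℝ} {x q : E d}
    {X : Sym d} (hr : r ≤ r') (ht : t ∈ Icc 0 T) (hx : x ∈ closure D) :
    H t x r q X ≤ H t x r' q X := by
  obtain ⟨γ, hγ, h⟩ := h1 r r' hr
  have := h t ht x hx q X
  have := mul_nonneg hγ.le (sub_nonneg.2 hr)
  linarith

/-- The structure condition holds up to the boundary. -/
theorem structure_closure {T : ℝ} {D : Set (E d)} {H : Ham d} (hH : HamContinuous T D H)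
    {ω : ℝ → ℝ} (hω : IsModulus ω)
    (h3 : ∀ t ∈ Icc 0 T, ∀ x ∈ D, ∀ y ∈ D, ∀ (r : ℝ) (X Y : Sym d) (α : ℝ), 1 < α →
      MatrixIneq α X Y →
      H t y r (α • (x - y)) Y - H t x r (α • (x - y)) X ≤ ω (‖x - y‖ * (1 + α * ‖x - y‖)))
    {t : ℝ} (ht : t ∈ Icc 0 T) {x y : E d} (hx : x ∈ closure D) (hy : y ∈ closure D) (r : ℝ)
    {X Y : Sym d} {α : ℝ} (hα : 1 < α) (hXY : MatrixIneq α X Y) :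
    H t y r (α • (x - y)) Y - H t x r (α • (x - y)) X ≤ ω (‖x - y‖ * (1 + α * ‖x - y‖)) := by
  have hmem : (x, y) ∈ closure (D ×ˢ D) := by rw [closure_prod_eq]; exact ⟨hx, hy⟩
  have hsub : D ×ˢ D ⊆ closure D ×ˢ closure D := prod_mono subset_closure subset_closure
  have hcY : ContinuousOn (fun p : E d × E d => H t p.2 r (α • (p.1 - p.2)) Y)
      (closure D ×ˢ closure D) := by
    have hc : Continuous fun p : E d × E d => (t, p.2, r, α • (p.1 - p.2), Y) := by fun_prop
    exact ContinuousOn.comp hH hc.continuousOn fun p hp => ⟨ht, hp.2, mem_univ _⟩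
  have hcX : ContinuousOn (fun p : E d × E d => H t p.1 r (α • (p.1 - p.2)) X)
      (closure D ×ˢ closure D) := by
    have hc : Continuous fun p : E d × E d => (t, p.1, r, α • (p.1 - p.2), X) := by fun_prop
    exact ContinuousOn.comp hH hc.continuousOn fun p hp => ⟨ht, hp.1, mem_univ _⟩
  have hcω : Continuous fun p : E d × E d => ‖p.1 - p.2‖ * (1 + α * ‖p.1 - p.2‖) := by fun_prop
  have hcω' : ContinuousOn (fun p : E d × E d => ω (‖p.1 - p.2‖ * (1 + α * ‖p.1 - p.2‖)))
      (closure D ×ˢ closure D) :=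
    hω.continuousOn.comp hcω.continuousOn fun p _ => by
      have : 0 ≤ α := by linarith
      simp only [mem_Ici]
      positivity
  exact ContinuousWithinAt.closure_le (x := (x, y)) hmem
    (((hcY.sub hcX) (x, y) ⟨hx, hy⟩).mono hsub) ((hcω' (x, y) ⟨hx, hy⟩).mono hsub)
    fun p hp => h3 t ht p.1 hp.1 p.2 hp.2 r X Y α hα hXY

/-- Uniform continuity in time on compact sets. -/
theorem HamContinuous.exists_time_modulus {T : ℝ} {D : Set (E d)} {H : Ham d}
    (hH : HamContinuous T D H) {P : Set (E d × ℝ × E d × Sym d)} (hP : IsCompact P)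
    (hPD : ∀ p ∈ P, p.1 ∈ closure D) {e : ℝ} (he : 0 < e) :
    ∃ σ : ℝ, 0 < σ ∧ ∀ t ∈ Icc 0 T, ∀ s ∈ Icc 0 T, ∀ p ∈ P, |s - t| < σ →
      H s p.1 p.2.1 p.2.2.1 p.2.2.2 - H t p.1 p.2.1 p.2.2.1 p.2.2.2 < e := by
  have hC : IsCompact (Icc 0 T ×ˢ Icc 0 T ×ˢ P) := isCompact_Icc.prod (isCompact_Icc.prod hP)
  have h1 : ContinuousOn (fun z : ℝ × ℝ × (E d × ℝ × E d × Sym d) =>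
      H z.2.1 z.2.2.1 z.2.2.2.1 z.2.2.2.2.1 z.2.2.2.2.2) (Icc 0 T ×ˢ Icc 0 T ×ˢ P) := by
    have hc : Continuous fun z : ℝ × ℝ × (E d × ℝ × E d × Sym d) => (z.2.1, z.2.2) := by fun_prop
    exact ContinuousOn.comp hH hc.continuousOn fun z hz => ⟨hz.2.1, hPD _ hz.2.2, mem_univ _⟩
  have h2 : ContinuousOn (fun z : ℝ × ℝ × (E d × ℝ × E d × Sym d) =>
      H z.1 z.2.2.1 z.2.2.2.1 z.2.2.2.2.1 z.2.2.2.2.2) (Icc 0 T ×ˢ Icc 0 T ×ˢ P) := by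
    have hc : Continuous fun z : ℝ × ℝ × (E d × ℝ × E d × Sym d) => (z.1, z.2.2) := by fun_prop
    exact ContinuousOn.comp hH hc.continuousOn fun z hz => ⟨hz.1, hPD _ hz.2.2, mem_univ _⟩
  have hδ : Continuous fun z : ℝ × ℝ × (E d × ℝ × E d × Sym d) => |z.2.1 - z.1| := by fun_prop
  -- The difference of the two values is continuous and vanishes on the diagonal s = t.
  obtain ⟨σ, hσ, h⟩ := exists_pos_forall_lt hC (h1.sub h2).upperSemicontinuousOn hδ.continuousOn
    (fun z _ => abs_nonneg _) (b := e) (fun z _ hz => by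
      have : z.2.1 = z.1 := sub_eq_zero.1 (abs_eq_zero.1 hz)
      change H z.2.1 _ _ _ _ - H z.1 _ _ _ _ < e
      rw [this, sub_self]
      exact he)
  exact ⟨σ, hσ, fun t ht s hs p hp hst => h (t, s, p) ⟨ht, hs, hp⟩ hst⟩

/-- A coercive function with bounded first and second derivatives. -/
theorem exists_coercive (d : ℕ) : ∃ (g : E d → ℝ) (C : ℝ), ContDiff ℝ 2 g ∧ (∀ x, 0 ≤ g x) ∧
    (∀ x, ‖fderiv ℝ g x‖ ≤ C) ∧ (∀ x, ‖fderiv ℝ (fderiv ℝ g) x‖ ≤ C) ∧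
    ∀ M : ℝ, ∃ R : ℝ, ∀ x, g x ≤ M → ‖x‖ < R := by
  let L : E d →L[ℝ] E d →L[ℝ] ℝ := LinearMap.mkContinuous₂ (innerₗ (E d)) 1 fun a b => by
    simpa using norm_inner_le_norm (𝕜 := ℝ) a b
  have hL : ∀ a b, L a b = inner ℝ a b := fun a b => rfl
  have hLn : ∀ a, ‖L a‖ ≤ ‖a‖ := fun a =>
    ContinuousLinearMap.opNorm_le_bound _ (norm_nonneg _) fun b => norm_inner_le_norm a b
  have hpos : ∀ x : E d, 0 < 1 + ‖x‖ ^ 2 := fun x => by positivity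
  have hq : ∀ x : E d, HasFDerivAt (fun x : E d => 1 + ‖x‖ ^ 2) ((2 : ℝ) • L x) x := by
    intro x
    have h := (hasFDerivAt_norm_sub_sq (0 : E d) x).const_add 1
    simp only [sub_zero] at h
    refine h.congr_fderiv ?_
    ext1 v
    simp [hL]
  set c : E d → ℝ := fun x => (1 + ‖x‖ ^ 2)⁻¹ with hc
  have hg : ∀ x : E d, HasFDerivAt (fun x : E d => Real.log (1 + ‖x‖ ^ 2))
      (c x • ((2 : ℝ) • L x)) x := fun x => (hq x).log (hpos x).ne'
  have hg' : fderiv ℝ (fun x : E d => Real.log (1 + ‖x‖ ^ 2)) = fun x => c x • ((2 : ℝ) • L x) :=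
    funext fun x => (hg x).fderiv
  have hcd : ∀ x, HasFDerivAt c (-(c x ^ 2) • ((2 : ℝ) • L x)) x := by
    intro x
    have h := (hasDerivAt_inv (hpos x).ne').comp_hasFDerivAt x (hq x)
    refine h.congr_fderiv ?_
    ext1 v
    simp [hc]
  have hgg : ∀ x, HasFDerivAt (fun x => c x • ((2 : ℝ) • L x))
      (c x • ((2 : ℝ) • L) + (-(c x ^ 2) • ((2 : ℝ) • L x)).smulRight ((2 : ℝ) • L x)) x :=
    fun x => (hcd x).smul (((2 : ℝ) • L).hasFDerivAt)
  have hc0 : ∀ x, 0 ≤ c x := fun x => by positivity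
  have hc1 : ∀ x, c x ≤ 1 := fun x => inv_le_one_of_one_le₀ (by nlinarith [sq_nonneg ‖x‖])
  have hc2 : ∀ x, c x * ‖x‖ ^ 2 ≤ 1 := fun x => by
    rw [hc, inv_mul_le_iff₀ (hpos x)]; linarith
  have hc3 : ∀ x, c x * ‖x‖ ≤ 1 := fun x => by
    rw [hc, inv_mul_le_iff₀ (hpos x)]; nlinarith [sq_nonneg (‖x‖ - 1)]
  -- The second derivative consists of two terms bounded by 2 and 4, whence 6.
  refine ⟨fun x => Real.log (1 + ‖x‖ ^ 2), 6, ?_, fun x => ?_, fun x => ?_, fun x => ?_,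
    fun M => ?_⟩
  · exact (contDiff_const.add (contDiff_norm_sq ℝ)).log fun x => (hpos x).ne'
  · exact Real.log_nonneg (by nlinarith [sq_nonneg ‖x‖])
  · rw [(hg x).fderiv, norm_smul, norm_smul, Real.norm_of_nonneg (hc0 x)]
    norm_num
    have := mul_le_mul_of_nonneg_left (hLn x) (hc0 x)
    have := hc3 x
    nlinarith
  · rw [hg', (hgg x).fderiv]
    refine ContinuousLinearMap.opNorm_le_bound _ (by norm_num) fun v => ?_
    refine (norm_add_le _ _).trans ?_
    have h1 : ‖(c x • ((2 : ℝ) • L)) v‖ ≤ 2 * ‖v‖ := by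
      rw [smul_apply, smul_apply, norm_smul, norm_smul, Real.norm_of_nonneg (hc0 x)]
      norm_num
      have := mul_le_mul (hc1 x) (hLn v) (norm_nonneg _) zero_le_one
      linarith
    have h2 : ‖((-(c x ^ 2) • ((2 : ℝ) • L x)).smulRight ((2 : ℝ) • L x)) v‖ ≤ 4 * ‖v‖ := by
      rw [ContinuousLinearMap.smulRight_apply, norm_smul, norm_smul, smul_apply, smul_apply,
        norm_smul, norm_smul, norm_neg, Real.norm_of_nonneg (by positivity : 0 ≤ c x ^ 2), hL]
      norm_num
      have a1 : |(inner ℝ x v : ℝ)| ≤ ‖x‖ * ‖v‖ := abs_real_inner_le_norm x v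
      have a2 := hLn x
      calc c x ^ 2 * (2 * |(inner ℝ x v : ℝ)|) * (2 * ‖L x‖)
          ≤ c x ^ 2 * (2 * (‖x‖ * ‖v‖)) * (2 * ‖x‖) := by gcongr
        _ = 4 * (c x * (c x * ‖x‖ ^ 2)) * ‖v‖ := by ring
        _ ≤ 4 * (1 * 1) * ‖v‖ := by
          have a3 := hc2 x
          have a4 := hc1 x
          have a5 := hc0 x
          gcongr
        _ = 4 * ‖v‖ := by ring
    exact (add_le_add h1 h2).trans (by linarith)
  · refine ⟨Real.exp M + 1, fun x hx => ?_⟩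
    have h1 := (Real.log_le_iff_le_exp (hpos x)).1 hx
    have h2 := Real.exp_pos M
    by_contra! hcon
    nlinarith [norm_nonneg x]

end Utilities

/-! ### The coercive perturbation and its jets. -/

section Perturbation

variable {d : ℕ}

/-- A small coercive perturbation whose derivative along the normals is negative. -/
theorem CondC.exists_perturbation {D : Set (E d)} {r₀ : ℝ} (hr : 0 < r₀) (hC : CondC D r₀)
    {ν : ℝ} (hν : 0 < ν) (x₀ : E d) :
    ∃ (k : E d → ℝ) (c : ℝ), 0 < c ∧ ContDiff ℝ 2 k ∧ (∀ x, -ν ≤ k x) ∧ k x₀ ≤ ν ∧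
      (∀ x, ‖fderiv ℝ k x‖ ≤ ν) ∧ (∀ x, ‖fderiv ℝ (fderiv ℝ k) x‖ ≤ ν) ∧
      (∀ M : ℝ, ∃ R : ℝ, ∀ x, k x ≤ M → ‖x‖ < R) ∧
      ∀ x ∈ frontier D, ∀ n ∈ normals D x, fderiv ℝ k x n ≤ -c := by
  obtain ⟨f, ⟨hf, hfb⟩, hf1, γ, hγ, hfn⟩ := hC
  obtain ⟨g, C, hg, hg0, hg1, hg2, hgR⟩ := exists_coercive d
  obtain ⟨C₁, hC₁⟩ := hfb 1 (by norm_num)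
  obtain ⟨C₂, hC₂⟩ := hfb 2 le_rfl
  have hf1' : ∀ x, ‖fderiv ℝ f x‖ ≤ C₁ := fun x => by
    rw [← norm_iteratedFDeriv_one]; exact hC₁ x
  have hf2' : ∀ x, ‖fderiv ℝ (fderiv ℝ f) x‖ ≤ C₂ := fun x => by
    rw [← norm_iteratedFDeriv_one, norm_iteratedFDeriv_fderiv]; exact hC₂ x
  have hC₁0 : 0 ≤ C₁ := (norm_nonneg _).trans (hf1' x₀)
  have hC₂0 : 0 ≤ C₂ := (norm_nonneg _).trans (hC₂ x₀)
  have hC0 : 0 ≤ C := (norm_nonneg _).trans (hg1 x₀)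
  -- δ makes f and its derivatives contribute at most ν/2. Then ε is taken small relative to δ, so
  -- that Dg destroys at most half of the normal derivative δγ/(8r₀) gained from f.
  set δ : ℝ := ν / (2 * (1 + C₁ + C₂)) with hδ
  have hδ0 : 0 < δ := by positivity
  have hδe : δ * (1 + C₁ + C₂) = ν / 2 := by rw [hδ]; field_simp
  set ε : ℝ := min (ν / (2 * (1 + C + g x₀))) (δ * γ / (8 * r₀) / (2 * (1 + C))) with hε
  have hg00 := hg0 x₀
  have hε0 : 0 < ε := by positivity
  have hεe : ε * (1 + C + g x₀) ≤ ν / 2 := by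
    have h1 : ε ≤ ν / (2 * (1 + C + g x₀)) := min_le_left _ _
    rw [le_div_iff₀ (by positivity)] at h1
    linarith
  have hεb : ε * (1 + C) ≤ δ * γ / (8 * r₀) / 2 := by
    have h1 : ε ≤ δ * γ / (8 * r₀) / (2 * (1 + C)) := min_le_right _ _
    rw [le_div_iff₀ (by positivity)] at h1
    linarith
  have hεC : ε * C ≤ ν / 2 := by nlinarith [mul_nonneg hε0.le hg00]
  have hδC₁ : δ * C₁ ≤ ν / 2 := by nlinarith [mul_nonneg hδ0.le hC₂0]
  have hδC₂ : δ * C₂ ≤ ν / 2 := by nlinarith [mul_nonneg hδ0.le hC₁0]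
  have hδ1 : δ ≤ ν / 2 := by nlinarith [mul_nonneg hδ0.le hC₁0, mul_nonneg hδ0.le hC₂0]
  have hεg : ε * g x₀ ≤ ν / 2 := by nlinarith [mul_nonneg hε0.le hC0]
  have hd1 : ∀ x, fderiv ℝ (fun x => ε * g x - δ * f x) x = ε • fderiv ℝ g x - δ • fderiv ℝ f x := by
    intro x
    have h1 := (hg.differentiable (by norm_num) x).hasFDerivAt
    have h2 := (hf.differentiable (by norm_num) x).hasFDerivAt
    exact ((h1.const_mul ε).sub (h2.const_mul δ)).fderiv
  have hd2 : ∀ x, fderiv ℝ (fderiv ℝ (fun x => ε * g x - δ * f x)) x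
      = ε • fderiv ℝ (fderiv ℝ g) x - δ • fderiv ℝ (fderiv ℝ f) x := by
    intro x
    rw [show fderiv ℝ (fun x => ε * g x - δ * f x)
      = fun x => ε • fderiv ℝ g x - δ • fderiv ℝ f x from funext hd1]
    have hg' : ContDiff ℝ 1 (fderiv ℝ g) := hg.fderiv_right (by norm_num)
    have hf' : ContDiff ℝ 1 (fderiv ℝ f) := hf.fderiv_right (by norm_num)
    have h1 := (hg'.differentiable (by norm_num) x).hasFDerivAt
    have h2 := (hf'.differentiable (by norm_num) x).hasFDerivAt
    exact ((h1.const_smul ε).sub (h2.const_smul δ)).fderiv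
  have hfl := fun x => (abs_le.1 (hf1 x)).1
  have hfu := fun x => (abs_le.1 (hf1 x)).2
  refine ⟨fun x => ε * g x - δ * f x, δ * γ / (8 * r₀) / 2, by positivity,
    (contDiff_const.mul hg).sub (contDiff_const.mul hf), fun x => ?_, ?_, fun x => ?_, fun x => ?_,
    fun M => ?_, fun x hx n hn => ?_⟩
  · have := mul_nonneg hε0.le (hg0 x)
    have := mul_le_mul_of_nonneg_left (hfu x) hδ0.le
    linarith
  · have := mul_le_mul_of_nonneg_left (hfl x₀) hδ0.le
    linarith
  · rw [hd1]
    refine (norm_sub_le _ _).trans ?_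
    rw [norm_smul, norm_smul, Real.norm_of_nonneg hε0.le, Real.norm_of_nonneg hδ0.le]
    have := mul_le_mul_of_nonneg_left (hg1 x) hε0.le
    have := mul_le_mul_of_nonneg_left (hf1' x) hδ0.le
    linarith
  · rw [hd2]
    refine (norm_sub_le (ε • fderiv ℝ (fderiv ℝ g) x) _).trans ?_
    have e1 := ContinuousLinearMap.opNorm_smul_le ε (fderiv ℝ (fderiv ℝ g) x)
    have e2 := ContinuousLinearMap.opNorm_smul_le δ (fderiv ℝ (fderiv ℝ f) x)
    rw [Real.norm_of_nonneg hε0.le] at e1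
    rw [Real.norm_of_nonneg hδ0.le] at e2
    refine (add_le_add e1 e2).trans ?_
    have := mul_le_mul_of_nonneg_left (hg2 x) hε0.le
    have := mul_le_mul_of_nonneg_left (hf2' x) hδ0.le
    linarith
  · obtain ⟨R, hR⟩ := hgR ((M + δ) / ε)
    refine ⟨R, fun x hx => hR x ?_⟩
    rw [le_div_iff₀ hε0]
    have := mul_le_mul_of_nonneg_left (hfu x) hδ0.le
    linarith
  · rw [hd1, sub_apply, smul_apply, smul_apply, smul_eq_mul, smul_eq_mul]
    have h1 := mul_le_mul_of_nonneg_left (hfn x hx n hn) hδ0.le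
    have hn1 : ‖n‖ = 1 := by
      obtain ⟨r, -, hr⟩ := mem_iUnion₂.1 hn
      exact hr.1
    have h2 : fderiv ℝ g x n ≤ C := by
      refine (le_abs_self _).trans (((fderiv ℝ g x).le_opNorm n).trans ?_)
      rw [hn1, mul_one]; exact hg1 x
    have h3 := mul_le_mul_of_nonneg_left h2 hε0.le
    rw [← mul_div_assoc] at h1
    linarith

/-- Gradient and Hessian of a `C²` function as a vector and a symmetric matrix. -/
theorem exists_gradient_hessian {k : E d → ℝ} (hk : ContDiff ℝ 2 k) (x : E d) {ν : ℝ}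
    (h1 : ‖fderiv ℝ k x‖ ≤ ν) (h2 : ‖fderiv ℝ (fderiv ℝ k) x‖ ≤ ν) :
    ∃ (g : E d) (Q : Sym d), (∀ v, fderiv ℝ k x v = inner ℝ g v) ∧
      (∀ v w, fderiv ℝ (fderiv ℝ k) x v w = inner ℝ (opOf Q.1 v) w) ∧
      ‖g‖ ≤ ν ∧ ‖opOf Q.1‖ ≤ ν := by
  have hk1 : ContDiff ℝ 1 (fderiv ℝ k) := hk.fderiv_right (by norm_num)
  have hsymm : ∀ a b, fderiv ℝ (fderiv ℝ k) x a b = fderiv ℝ (fderiv ℝ k) x b a := fun a b =>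
    second_derivative_symmetric (fun y => (hk.differentiable (by norm_num) y).hasFDerivAt)
      (hk1.differentiable (by norm_num) x).hasFDerivAt a b
  refine ⟨(InnerProductSpace.toDual ℝ (E d)).symm (fderiv ℝ k x),
    ⟨matrixOf (fderiv ℝ (fderiv ℝ k) x), matrixOf_isSymm hsymm⟩, fun v => ?_, fun v w => ?_, ?_, ?_⟩
  · rw [InnerProductSpace.toDual_symm_apply]
  · rw [inner_opOf_matrixOf]
  · rw [LinearIsometryEquiv.norm_map]; exact h1
  · exact (norm_opOf_matrixOf_le _).trans h2

/-- These are the test functions seen by u and v when a quadratic jet of U or V is shifted back by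
η/t + k. Symmetry of B makes B itself the Hessian of ½B(y − z, y − z). -/
theorem derivatives_test_function {k : E d → ℝ} (hk : ContDiff ℝ 2 k) (η a : ℝ) (p : E d)
    (B : (ℝ × E d) →L[ℝ] (ℝ × E d) →L[ℝ] ℝ) (hB : ∀ z w, B z w = B w z) {z : ℝ × E d}
    (hz : z.1 ≠ 0) {φ : ℝ × E d → ℝ} (hφ : φ = fun y => η / y.1 + k y.2
      + (a * (y.1 - z.1) + inner ℝ p (y.2 - z.2) + 1 / 2 * B (y - z) (y - z))) :
    ContDiffAt ℝ 2 φ z ∧ fderiv ℝ φ z (1, 0) = a - η / z.1 ^ 2 ∧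
      (∀ v, fderiv ℝ φ z (0, v) = inner ℝ p v + fderiv ℝ k z.2 v) ∧
      ∀ v w, fderiv ℝ (fderiv ℝ φ) z (0, v) (0, w)
        = B (0, v) (0, w) + fderiv ℝ (fderiv ℝ k) z.2 v w := by
  have hC : ContDiffAt ℝ 2 φ z := by
    have h1 : ContDiffAt ℝ 2 (fun y : ℝ × E d => η / y.1) z :=
      contDiffAt_const.div contDiffAt_fst hz
    have h2 : ContDiff ℝ 2 (fun y : ℝ × E d => k y.2) := hk.comp contDiff_snd
    have h3 : ContDiff ℝ 2 (fun y : ℝ × E d => a * (y.1 - z.1)) :=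
      contDiff_const.mul (contDiff_fst.sub contDiff_const)
    have h4 : ContDiff ℝ 2 (fun y : ℝ × E d => (inner ℝ p (y.2 - z.2) : ℝ)) :=
      contDiff_const.inner ℝ (contDiff_snd.sub contDiff_const)
    have h5 : ContDiff ℝ 2 (fun y : ℝ × E d => B (y - z) (y - z)) :=
      (B.contDiff.comp (contDiff_id.sub contDiff_const)).clm_apply (contDiff_id.sub contDiff_const)
    rw [hφ]
    exact (h1.add h2.contDiffAt).add ((h3.contDiffAt.add h4.contDiffAt).add
      (contDiffAt_const.mul h5.contDiffAt))
  have hd : ∀ y : ℝ × E d, y.1 ≠ 0 → ∀ v : ℝ × E d, fderiv ℝ φ y v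
      = -(η / y.1 ^ 2) * v.1 + fderiv ℝ k y.2 v.2 + (a * v.1 + inner ℝ p v.2 + B (y - z) v) := by
    intro y hy v
    have h1 : HasFDerivAt (fun y : ℝ × E d => η / y.1)
        ((-(η / y.1 ^ 2)) • ContinuousLinearMap.fst ℝ ℝ (E d)) y := by
      have h0 : HasDerivAt (fun s : ℝ => η / s) (-(η / y.1 ^ 2)) y.1 := by
        have := (hasDerivAt_inv hy).const_mul η
        simpa [div_eq_mul_inv] using this
      exact h0.comp_hasFDerivAt y hasFDerivAt_fst
    have h2 : HasFDerivAt (fun y : ℝ × E d => k y.2)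
        ((fderiv ℝ k y.2).comp (ContinuousLinearMap.snd ℝ ℝ (E d))) y :=
      (hk.differentiable (by norm_num) y.2).hasFDerivAt.comp y hasFDerivAt_snd
    have h3 : HasFDerivAt (fun y : ℝ × E d => a * (y.1 - z.1))
        (a • ContinuousLinearMap.fst ℝ ℝ (E d)) y :=
      (hasFDerivAt_fst.sub_const z.1).const_mul a
    have h4 : HasFDerivAt (fun y : ℝ × E d => innerSL ℝ p (y.2 - z.2))
        ((innerSL ℝ p).comp (ContinuousLinearMap.snd ℝ ℝ (E d))) y :=
      HasFDerivAt.comp y (g := innerSL ℝ p) (f := fun y : ℝ × E d => y.2 - z.2)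
        (innerSL ℝ p).hasFDerivAt (hasFDerivAt_snd.sub_const z.2)
    have h6 : HasFDerivAt (fun y : ℝ × E d => y - z) (ContinuousLinearMap.id ℝ _) y :=
      (hasFDerivAt_id y).sub_const z
    have h5 := (B.hasFDerivAt.comp y h6).clm_apply h6
    have h7 := (h1.add h2).add ((h3.add h4).add (h5.const_mul (1 / 2)))
    rw [hφ]
    refine (congrArg (fun l : (ℝ × E d) →L[ℝ] ℝ => l v) h7.fderiv).trans ?_
    simp [hB v y, hB v z]
    ring
  have hz' : ∀ᶠ y in nhds z, y.1 ≠ 0 :=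
    (continuous_fst.tendsto z).eventually (isOpen_ne.mem_nhds hz)
  refine ⟨hC, ?_, fun v => ?_, fun v w => ?_⟩
  · rw [hd z hz]; simp; ring
  · rw [hd z hz]; simp; ring
  · have hC1 : ContDiffAt ℝ 1 (fderiv ℝ φ) z := hC.fderiv_right (by norm_num)
    have hk1 : ContDiff ℝ 1 (fderiv ℝ k) := hk.fderiv_right (by norm_num)
    have h1 : HasFDerivAt (fun y => fderiv ℝ φ y (0, w)) _ z :=
      ((hC1.differentiableAt (by norm_num)).hasFDerivAt).clm_apply (hasFDerivAt_const (0, w) z)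
    have h2 : HasFDerivAt (fun y : ℝ × E d => fderiv ℝ k y.2 w) _ z :=
      ((hk1.differentiable (by norm_num) z.2).hasFDerivAt.comp z hasFDerivAt_snd).clm_apply
        (hasFDerivAt_const w z)
    have h6 : HasFDerivAt (fun y : ℝ × E d => y - z) (ContinuousLinearMap.id ℝ _) z :=
      (hasFDerivAt_id z).sub_const z
    have h3 : HasFDerivAt (fun y : ℝ × E d => B (y - z) (0, w)) _ z :=
      (B.hasFDerivAt.comp z h6).clm_apply (hasFDerivAt_const (0, w) z)
    have h4 := (h2.add_const (inner ℝ p w)).add h3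
    have h5 : (fun y => fderiv ℝ φ y (0, w)) =ᶠ[nhds z]
        fun y => fderiv ℝ k y.2 w + inner ℝ p w + B (y - z) (0, w) := by
      filter_upwards [hz'] with y hy
      rw [hd y hy]; simp; ring
    have h7 := h1.unique (h4.congr_of_eventuallyEq h5)
    have h8 := congrArg (fun l : (ℝ × E d) →L[ℝ] ℝ => l (0, v)) h7
    simp at h8
    rw [h8]
    ring

end Perturbation

/-! ### Doubling of variables. -/

section Doubling

variable {d : ℕ}

theorem Sym.isSymm_add (X Q : Sym d) : (X.1 + Q.1).IsSymm := X.2.add Q.2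

theorem Sym.isSymm_sub (X Q : Sym d) : (X.1 - Q.1).IsSymm := X.2.sub Q.2

theorem upperSemicontinuousOn_doubling {X : Type*} [TopologicalSpace X] {K : Set X} {U V : X → ℝ}
    (hU : UpperSemicontinuousOn U K) (hV : LowerSemicontinuousOn V K) :
    UpperSemicontinuousOn (fun p : X × X => U p.1 - V p.2) (K ×ˢ K) := by
  have h1 : UpperSemicontinuousOn (fun p : X × X => U p.1) (K ×ˢ K) :=
    UpperSemicontinuousOn.comp hU continuous_fst.continuousOn fun p hp => hp.1
  have h2 : UpperSemicontinuousOn (fun p : X × X => -V p.2) (K ×ˢ K) :=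
    UpperSemicontinuousOn.comp (f := fun x => -V x) hV.neg continuous_snd.continuousOn
      fun p hp => hp.2
  simpa only [sub_eq_add_neg] using h1.add h2

/-- Maximum points of the doubled function. -/
theorem exists_doubling_max {K : Set (ℝ × E d)} (hK : IsCompact K) (hne : K.Nonempty)
    {U V : ℝ × E d → ℝ} (hU : UpperSemicontinuousOn U K) (hV : LowerSemicontinuousOn V K)
    (κ α : ℝ) : ∃ z₀ ∈ K, ∃ w₀ ∈ K, ∀ z ∈ K, ∀ w ∈ K,
      U z - V w - (κ / 2 * (z.1 - w.1) ^ 2 + α / 2 * ‖z.2 - w.2‖ ^ 2)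
        ≤ U z₀ - V w₀ - (κ / 2 * (z₀.1 - w₀.1) ^ 2 + α / 2 * ‖z₀.2 - w₀.2‖ ^ 2) := by
  have h1 := upperSemicontinuousOn_doubling hU hV
  have h2 : Continuous fun p : (ℝ × E d) × (ℝ × E d) =>
      -(κ / 2 * (p.1.1 - p.2.1) ^ 2 + α / 2 * ‖p.1.2 - p.2.2‖ ^ 2) := by fun_prop
  obtain ⟨⟨z₀, w₀⟩, ⟨hz, hw⟩, hmax⟩ := (h1.add
    h2.continuousOn.upperSemicontinuousOn).exists_isMaxOn (hne.prod hne) (hK.prod hK)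
  refine ⟨z₀, hz, w₀, hw, fun z hz' w hw' => ?_⟩
  have := hmax (mk_mem_prod hz' hw')
  simpa only [mem_ofPred_eq, ← sub_eq_add_neg] using this

/-- The penalization term tends to zero along maximum points of the doubled function. -/
theorem exists_penalization_le {K : Set (ℝ × E d)} (hK : IsCompact K)
    {U V : ℝ × E d → ℝ} (hU : UpperSemicontinuousOn U K) (hV : LowerSemicontinuousOn V K) {b : ℝ}
    (hb : ∀ z ∈ K, ∀ w ∈ K, U z - V w ≤ b) {z₁ : ℝ × E d} (hz₁ : z₁ ∈ K) (hz₁' : 0 ≤ U z₁ - V z₁)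
    {ρ σ : ℝ} (hρ : 0 < ρ) (hσ : 0 < σ) :
    ∃ α₀ : ℝ, ∀ α κ, α₀ ≤ α → α₀ ≤ κ → ∀ z₀ ∈ K, ∀ w₀ ∈ K,
      (∀ z ∈ K, ∀ w ∈ K, U z - V w - (κ / 2 * (z.1 - w.1) ^ 2 + α / 2 * ‖z.2 - w.2‖ ^ 2)
        ≤ U z₀ - V w₀ - (κ / 2 * (z₀.1 - w₀.1) ^ 2 + α / 2 * ‖z₀.2 - w₀.2‖ ^ 2)) →
      dist z₀ w₀ < σ ∧ κ / 2 * (z₀.1 - w₀.1) ^ 2 + α / 2 * ‖z₀.2 - w₀.2‖ ^ 2 ≤ ρ := by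
  have h1 := upperSemicontinuousOn_doubling hU hV
  have hdiag : UpperSemicontinuousOn (fun z => U z - V z) K :=
    UpperSemicontinuousOn.comp (f := fun p : (ℝ × E d) × (ℝ × E d) => U p.1 - V p.2)
      (g := fun z => (z, z)) h1 (by fun_prop : Continuous fun z : ℝ × E d => (z, z)).continuousOn
      fun z hz => ⟨hz, hz⟩
  -- Near the diagonal U − V exceeds the diagonal maximum, attained at z₂, by less than ρ. Comparing
  -- the doubled maximum with (z₂, z₂) then bounds the penalty by ρ.
  obtain ⟨z₂, hz₂, hmax⟩ := hdiag.exists_isMaxOn ⟨z₁, hz₁⟩ hK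
  have hdc : Continuous fun p : (ℝ × E d) × (ℝ × E d) => dist p.1 p.2 := by fun_prop
  obtain ⟨σ₁, hσ₁, hlt⟩ := exists_pos_forall_lt (hK.prod hK) h1 hdc.continuousOn
    (fun p _ => dist_nonneg) (b := U z₂ - V z₂ + ρ) (fun p hp h0 => by
      have h2 : p.1 = p.2 := dist_eq_zero.1 h0
      have h3 : U p.1 - V p.1 ≤ U z₂ - V z₂ := hmax hp.1
      change U p.1 - V p.2 < _
      rw [← h2]
      linarith)
  set τ := min σ σ₁ with hτ
  have hτ0 : 0 < τ := lt_min hσ hσ₁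
  have hb0 : 0 ≤ b := hz₁'.trans (hb z₁ hz₁ z₁ hz₁)
  -- Comparison with (z₁, z₁) bounds the penalty by b, so this threshold already forces a distance
  -- below τ. It applies to α and κ independently.
  refine ⟨2 * b / τ ^ 2 + 1, fun α κ hα hκ z₀ hz₀ w₀ hw₀ hm => ?_⟩
  have hpos : 0 ≤ 2 * b / τ ^ 2 := by positivity
  have hα0 : 0 < α := by linarith
  have hκ0 : 0 < κ := by linarith
  have hpen : κ / 2 * (z₀.1 - w₀.1) ^ 2 + α / 2 * ‖z₀.2 - w₀.2‖ ^ 2 ≤ b := by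
    have h3 := hm z₁ hz₁ z₁ hz₁
    have h4 := hb z₀ hz₀ w₀ hw₀
    simp only [sub_self, norm_zero] at h3
    norm_num at h3
    linarith
  have hsmall : ∀ β e : ℝ, 2 * b / τ ^ 2 + 1 ≤ β → 0 ≤ e → β / 2 * e ^ 2 ≤ b → e < τ := by
    intro β e hβ he hle
    by_contra! hcon
    have h5 : τ ^ 2 ≤ e ^ 2 := by gcongr
    have h6 : 2 * b / τ ^ 2 * τ ^ 2 = 2 * b := by field_simp
    have h7 : 0 < τ ^ 2 := by positivity
    have h8 : (2 * b / τ ^ 2 + 1) * τ ^ 2 ≤ β * e ^ 2 := by gcongr; linarith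
    nlinarith
  have ht0 : 0 ≤ κ / 2 * (z₀.1 - w₀.1) ^ 2 := by positivity
  have hx0 : 0 ≤ α / 2 * ‖z₀.2 - w₀.2‖ ^ 2 := by positivity
  have hdist : dist z₀ w₀ < τ := by
    rw [Prod.dist_eq, max_lt_iff, Real.dist_eq, dist_eq_norm]
    exact ⟨hsmall κ _ hκ (abs_nonneg _) (by rw [sq_abs]; linarith),
      hsmall α _ hα (norm_nonneg _) (by linarith)⟩
  refine ⟨hdist.trans_le (min_le_left _ _), ?_⟩
  have h3 := hlt (z₀, w₀) ⟨hz₀, hw₀⟩ (hdist.trans_le (min_le_right _ _))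
  have h4 := hm z₂ hz₂ z₂ hz₂
  simp only [sub_self, norm_zero] at h4
  norm_num at h4
  linarith

/-- The jet belongs to U = u − η/t − k; passing back to u adds Dk and D²k, and the time derivative
−η/t² of η/t supplies the strictness. -/
theorem IsSubsolution.le_of_jet {T : ℝ} {D : Set (E d)} {H : Ham d} {h : E d → ℝ}
    {u : ℝ → E d → ℝ} (hu : IsSubsolution T D H h u) {k : E d → ℝ}
    (hk : ContDiff ℝ 2 k) {η a : ℝ} {p g : E d} {X Q : Sym d}
    {B : (ℝ × E d) →L[ℝ] (ℝ × E d) →L[ℝ] ℝ} {z : ℝ × E d} (ht : z.1 ∈ Ioo 0 T)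
    (hx : z.2 ∈ closure D) (hB : ∀ z w, B z w = B w z)
    (hX : ∀ a b : E d, B (0, a) (0, b) = inner ℝ (opOf X.1 a) b)
    (hg : ∀ v, fderiv ℝ k z.2 v = inner ℝ g v)
    (hQ : ∀ v w, fderiv ℝ (fderiv ℝ k) z.2 v w = inner ℝ (opOf Q.1 v) w)
    (hjet : ∀ᶠ y in nhds z, y ∈ Ioo 0 T ×ˢ closure D →
      u y.1 y.2 - η / y.1 - k y.2 ≤ u z.1 z.2 - η / z.1 - k z.2
        + (a * (y.1 - z.1) + inner ℝ p (y.2 - z.2) + 1 / 2 * B (y - z) (y - z)))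
    (hbd : z.2 ∈ frontier D → 0 < normalInf D z.2 (p + g)) :
    -(a - η / z.1 ^ 2) + H z.1 z.2 (u z.1 z.2) (p + g) ⟨X.1 + Q.1, X.isSymm_add Q⟩ ≤ 0 := by
  obtain ⟨φ, hφ⟩ : ∃ φ : ℝ × E d → ℝ, φ = fun y => η / y.1 + k y.2
    + (a * (y.1 - z.1) + inner ℝ p (y.2 - z.2) + 1 / 2 * B (y - z) (y - z)) := ⟨_, rfl⟩
  obtain ⟨hC, h1, h2, h3⟩ := derivatives_test_function hk η a p B hB ht.1.ne' hφ
  rw [← h1]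
  refine hu.le_of_test ht hx hC ?_ (fun v => ?_) (fun v w => ?_) hbd
  · filter_upwards [hjet] with y hy hy'
    have := hy hy'
    rw [hφ]
    simp only [sub_self, inner_zero_right, map_zero, mul_zero, add_zero]
    linarith
  · rw [h2, hg, inner_add_left]
  · rw [h3, hX, hQ, opOf, opOf, opOf, map_add, add_apply, inner_add_left]

theorem IsSupersolution.le_of_jet {T : ℝ} {D : Set (E d)} {H : Ham d} {h : E d → ℝ}
    {v : ℝ → E d → ℝ} (hv : IsSupersolution T D H h v) {k : E d → ℝ}
    (hk : ContDiff ℝ 2 k) {η a : ℝ} {p g : E d} {X Q : Sym d}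
    {B : (ℝ × E d) →L[ℝ] (ℝ × E d) →L[ℝ] ℝ} {z : ℝ × E d} (ht : z.1 ∈ Ioo 0 T)
    (hx : z.2 ∈ closure D) (hB : ∀ z w, B z w = B w z)
    (hX : ∀ a b : E d, B (0, a) (0, b) = inner ℝ (opOf X.1 a) b)
    (hg : ∀ v, fderiv ℝ k z.2 v = inner ℝ g v)
    (hQ : ∀ v w, fderiv ℝ (fderiv ℝ k) z.2 v w = inner ℝ (opOf Q.1 v) w)
    (hjet : ∀ᶠ y in nhds z, y ∈ Ioo 0 T ×ˢ closure D →
      v z.1 z.2 + η / z.1 + k z.2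
        + (a * (y.1 - z.1) + inner ℝ p (y.2 - z.2) + 1 / 2 * B (y - z) (y - z))
        ≤ v y.1 y.2 + η / y.1 + k y.2)
    (hbd : z.2 ∈ frontier D → normalSup D z.2 (p - g) < 0) :
    0 ≤ -(a + η / z.1 ^ 2) + H z.1 z.2 (v z.1 z.2) (p - g) ⟨X.1 - Q.1, X.isSymm_sub Q⟩ := by
  -- For v the perturbation has the opposite sign: the computation for u is reused with −η and −k.
  obtain ⟨φ, hφ⟩ : ∃ φ : ℝ × E d → ℝ, φ = fun y => -η / y.1 + (fun x => -k x) y.2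
    + (a * (y.1 - z.1) + inner ℝ p (y.2 - z.2) + 1 / 2 * B (y - z) (y - z)) := ⟨_, rfl⟩
  obtain ⟨hC, h1, h2, h3⟩ := derivatives_test_function hk.neg (-η) a p B hB ht.1.ne' hφ
  have hf : fderiv ℝ (fun x => -k x) = fun x => -fderiv ℝ k x := funext fun x => fderiv_fun_neg
  have hff : fderiv ℝ (fun x => -fderiv ℝ k x) z.2 = -fderiv ℝ (fderiv ℝ k) z.2 := fderiv_fun_neg
  have h1' : a + η / z.1 ^ 2 = fderiv ℝ φ z (1, 0) := by rw [h1]; ring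
  rw [h1']
  refine hv.le_of_test ht hx hC ?_ (fun w => ?_) (fun w w' => ?_) hbd
  · filter_upwards [hjet] with y hy hy'
    have := hy hy'
    rw [hφ]
    simp only [sub_self, inner_zero_right, map_zero, mul_zero, add_zero, neg_div]
    linarith
  · rw [h2, hf, inner_sub_left, neg_apply, hg]
    ring
  · rw [h3, hX, hf, hff, neg_apply, neg_apply, hQ, opOf, opOf, opOf, map_sub, sub_apply,
      inner_sub_left]
    ring

end Doubling

/-! ### The contradiction at a doubled maximum. -/

section Comparison

variable {d : ℕ}

theorem opOf_smul_one (θ : ℝ) (a : E d) :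
    opOf (θ • (1 : Matrix (Fin d) (Fin d) ℝ)) a = θ • a := by
  rw [opOf, map_smul, map_one]
  rfl

theorem Sym.isSymm_sub_smul_one (X : Sym d) (θ : ℝ) :
    (X.1 - θ • (1 : Matrix (Fin d) (Fin d) ℝ)).IsSymm :=
  X.2.sub (Matrix.isSymm_one.smul θ)

theorem Sym.isSymm_add_smul_one (X : Sym d) (θ : ℝ) :
    (X.1 + θ • (1 : Matrix (Fin d) (Fin d) ℝ)).IsSymm :=
  X.2.add (Matrix.isSymm_one.smul θ)

/-- Shifting by a multiple of the identity absorbs the error in the matrix inequality; the second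
matrix is then bounded. -/
theorem matrixIneq_shift {X Y : Sym d} {α θ : ℝ} (hα : 1 ≤ α) (hθ : 0 ≤ θ)
    (hXY : ∀ a b : E d, inner ℝ (opOf X.1 a) a - inner ℝ (opOf Y.1 b) b
      ≤ 3 * α * ‖a - b‖ ^ 2 + θ * (‖a‖ ^ 2 + ‖b‖ ^ 2))
    (hX : ∀ a : E d, -(3 * α) * ‖a‖ ^ 2 ≤ inner ℝ (opOf X.1 a) a)
    (hY : ∀ b : E d, inner ℝ (opOf Y.1 b) b ≤ 3 * α * ‖b‖ ^ 2) :
    MatrixIneq (α * (1 + θ)) ⟨X.1 - θ • 1, X.isSymm_sub_smul_one θ⟩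
        ⟨Y.1 + θ • 1, Y.isSymm_add_smul_one θ⟩ ∧
      ∀ b : E d, |inner ℝ (opOf (Y.1 + θ • 1) b) b| ≤ 3 * (α * (1 + θ)) * ‖b‖ ^ 2 := by
  have hX' : ∀ a : E d, inner ℝ (opOf (X.1 - θ • 1) a) a
      = inner ℝ (opOf X.1 a) a - θ * ‖a‖ ^ 2 := fun a => by
    rw [opOf, map_sub, sub_apply, inner_sub_left, ← opOf, ← opOf, opOf_smul_one,
      real_inner_smul_left, real_inner_self_eq_norm_sq]
  have hY' : ∀ a : E d, inner ℝ (opOf (Y.1 + θ • 1) a) a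
      = inner ℝ (opOf Y.1 a) a + θ * ‖a‖ ^ 2 := fun a => by
    rw [opOf, map_add, add_apply, inner_add_left, ← opOf, ← opOf, opOf_smul_one,
      real_inner_smul_left, real_inner_self_eq_norm_sq]
  have hle : ∀ e : ℝ, 0 ≤ e → θ * e ≤ 3 * (α * θ) * e := fun e he => by
    have h1 : θ ≤ α * θ := by nlinarith
    have h2 : θ ≤ 3 * (α * θ) := by nlinarith
    exact mul_le_mul_of_nonneg_right h2 he
  have hαθ : 0 ≤ α * θ := by positivity
  have e1 : ∀ a b : E d, inner ℝ (opOf (X.1 - θ • 1) a) a - inner ℝ (opOf (Y.1 + θ • 1) b) b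
      ≤ 3 * (α * (1 + θ)) * ‖a - b‖ ^ 2 := fun a b => by
    rw [hX', hY']
    have := hXY a b
    have := mul_nonneg hαθ (sq_nonneg ‖a - b‖)
    linarith
  have e2 : ∀ a : E d, -(3 * (α * (1 + θ))) * ‖a‖ ^ 2 ≤ inner ℝ (opOf (X.1 - θ • 1) a) a :=
    fun a => by
      rw [hX']
      have := hX a
      have := hle _ (sq_nonneg ‖a‖)
      linarith
  have e3 : ∀ b : E d, inner ℝ (opOf (Y.1 + θ • 1) b) b ≤ 3 * (α * (1 + θ)) * ‖b‖ ^ 2 :=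
    fun b => by
      rw [hY']
      have := hY b
      have := hle _ (sq_nonneg ‖b‖)
      linarith
  refine ⟨matrixIneq_of_forall e1 e2 e3, fun b => abs_le.2 ⟨?_, e3 b⟩⟩
  -- On the diagonal a = b the upper bound says that the shifted X is below the shifted Y, so the
  -- lower bound passes from X to Y.
  have h1 := e1 b b
  have h2 := e2 b
  rw [sub_self, norm_zero, zero_pow two_ne_zero, mul_zero, sub_nonpos] at h1
  rw [← neg_mul]
  exact h2.trans h1

/-- Comparison of the values of the Hamiltonian at the two points of a doubling argument. -/
theorem hamiltonian_sub_le {T : ℝ} {D : Set (E d)} {H : Ham d} (hH : HamContinuous T D H)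
    (h1 : HypH1 T D H) {ω₁ ω₂ : ℝ → ℝ}
    (h2 : ∀ t ∈ Ioo 0 T, ∀ x ∈ closure D, ∀ (r : ℝ) (q₁ q₂ : E d) (X Y : Sym d),
      |H t x r q₁ X - H t x r q₂ Y| ≤ ω₁ (‖q₁ - q₂‖ + ‖opOf (X.1 - Y.1)‖))
    (hω₂ : IsModulus ω₂)
    (h3 : ∀ t ∈ Icc 0 T, ∀ x ∈ D, ∀ y ∈ D, ∀ (r : ℝ) (X Y : Sym d) (α : ℝ), 1 < α →
      MatrixIneq α X Y →
      H t y r (α • (x - y)) Y - H t x r (α • (x - y)) X ≤ ω₂ (‖x - y‖ * (1 + α * ‖x - y‖)))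
    {e ρ₁ ρ₂ : ℝ} (hρ₁ : ∀ s, 0 ≤ s → s ≤ ρ₁ → ω₁ s ≤ e) (hρ₂ : ∀ s, 0 ≤ s → s ≤ ρ₂ → ω₂ s ≤ e)
    {t s r r' β : ℝ} (ht : t ∈ Ioo 0 T) (hs : s ∈ Ioo 0 T) {x y p q : E d} (hx : x ∈ closure D)
    (hy : y ∈ closure D) (hr : r' ≤ r) {X Y X' Y' : Sym d} (hβ : 1 < β)
    (hXY : MatrixIneq β X' Y') (hp : ‖p - β • (x - y)‖ + ‖opOf (X.1 - X'.1)‖ ≤ ρ₁)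
    (hq : ‖q - β • (x - y)‖ + ‖opOf (Y.1 - Y'.1)‖ ≤ ρ₁)
    (hxy : ‖x - y‖ * (1 + β * ‖x - y‖) ≤ ρ₂)
    (hts : H s y r (β • (x - y)) Y' - H t y r (β • (x - y)) Y' < e) :
    H s y r' q Y - H t x r p X ≤ 4 * e := by
  -- Each change costs at most e, apart from monotonicity in r, which costs nothing: the jet at (s,
  -- y), the time from s to t, the point from y to x, the jet at (t, x).
  have a1 := h1.mono (q := q) (X := Y) hr (Ioo_subset_Icc_self hs) hy
  have a2 := (le_abs_self _).trans ((h2 s hs y hy r q (β • (x - y)) Y Y').trans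
    (hρ₁ _ (by positivity) hq))
  have a3 := (neg_le_abs _).trans ((h2 t ht x hx r p (β • (x - y)) X X').trans
    (hρ₁ _ (by positivity) hp))
  have a4 := (structure_closure hH hω₂ h3 (Ioo_subset_Icc_self ht) hx hy r hβ hXY).trans
    (hρ₂ _ (by positivity) hxy)
  linarith

theorem norm_sub_shift_le {x y x₀ y₀ p : E d} {α θ : ℝ} (hα : 0 ≤ α)
    (hx : ‖x - x₀‖ ≤ θ) (hy : ‖y - y₀‖ ≤ θ) (hp : ‖p - α • (x₀ - y₀)‖ ≤ θ) :
    ‖p - α • (x - y)‖ ≤ (1 + 2 * α) * θ := by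
  have h1 : p - α • (x - y) = (p - α • (x₀ - y₀)) - α • ((x - x₀) - (y - y₀)) := by
    simp only [smul_sub]; abel
  rw [h1]
  refine (norm_sub_le _ _).trans ?_
  rw [norm_smul, Real.norm_of_nonneg hα]
  have h2 : α * ‖(x - x₀) - (y - y₀)‖ ≤ α * (θ + θ) :=
    mul_le_mul_of_nonneg_left ((norm_sub_le _ _).trans (add_le_add hx hy)) hα
  linarith

theorem mul_sq_le_of_perturbation {α θ r r' s : ℝ} (hα : 0 < α) (hθ : 0 < θ) (hr : 0 ≤ r)
    (hθ1 : θ ≤ 1) (hαθ : 16 * α * θ ≤ s ^ 2) (hr' : α * r' ^ 2 ≤ s ^ 2 / 4) (h : r ≤ r' + 2 * θ) :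
    α * r ^ 2 ≤ s ^ 2 := by
  have h6 : r ^ 2 ≤ (r' + 2 * θ) ^ 2 := by gcongr
  have h5 : r ^ 2 ≤ 2 * r' ^ 2 + 8 * θ ^ 2 := by nlinarith [sq_nonneg (r' - 2 * θ)]
  have h8 : α * r ^ 2 ≤ α * (2 * r' ^ 2 + 8 * θ ^ 2) := by gcongr
  have h7 : α * θ * θ ≤ α * θ * 1 := by gcongr
  linarith

theorem le_of_mul_sq_le {α r s : ℝ} (hα : 2 ≤ α) (hr : 0 ≤ r) (hs : 0 ≤ s)
    (h : α * r ^ 2 ≤ s ^ 2) : r ≤ s := by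
  refine (sq_le_sq₀ hr hs).1 (le_trans ?_ h)
  nlinarith [sq_nonneg r]

theorem mul_one_add_mul_le {α β r s ρ : ℝ} (hβ : β ≤ 2 * α) (hr : 0 ≤ r) (hrs : r ≤ s)
    (hs1 : s ≤ 1) (h : α * r ^ 2 ≤ s ^ 2) (hρ : 3 * s ≤ ρ) :
    r * (1 + β * r) ≤ ρ := by
  have h4 : β * r ^ 2 ≤ 2 * α * r ^ 2 := by gcongr
  have h5 : s ^ 2 ≤ s := by nlinarith
  linarith

-- The analytic core. Here ℓ is a level that U − V does not reach at time T, while its value at z₁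
-- is at least 2ℓ; pairs above this level are interior enough for local maxima over K to be local
-- maxima over the whole domain. The order of choices is s, α, then κ depending on α, then θ
-- depending on all of them.
set_option maxHeartbeats 1600000 in
theorem false_of_doubling {T : ℝ} (hT : 0 < T) {D : Set (E d)} {r₀ : ℝ}
    (hA : CondA D r₀) {H : Ham d} (hH : HamContinuous T D H) (h1 : HypH1 T D H) {ω₁ ω₂ : ℝ → ℝ}
    (h2 : ∀ t ∈ Ioo 0 T, ∀ x ∈ closure D, ∀ (r : ℝ) (q₁ q₂ : E d) (X Y : Sym d),
      |H t x r q₁ X - H t x r q₂ Y| ≤ ω₁ (‖q₁ - q₂‖ + ‖opOf (X.1 - Y.1)‖))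
    (hω₂ : IsModulus ω₂)
    (h3 : ∀ t ∈ Icc 0 T, ∀ x ∈ D, ∀ y ∈ D, ∀ (r : ℝ) (X Y : Sym d) (α : ℝ), 1 < α →
      MatrixIneq α X Y →
      H t y r (α • (x - y)) Y - H t x r (α • (x - y)) X ≤ ω₂ (‖x - y‖ * (1 + α * ‖x - y‖)))
    {h : E d → ℝ} {u v : ℝ → E d → ℝ} (hu : IsSubsolution T D H h u)
    (hv : IsSupersolution T D H h v) {η ν c₁ ρ₁ ρ₂ ℓ m M b : ℝ} (hη : 0 < η) (hc₁ : 0 < c₁)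
    (hρ₁0 : 0 < ρ₁) (hρ₂0 : 0 < ρ₂) (hℓ : 0 < ℓ) (hν : 4 * ν ≤ ρ₁)
    (hρ₁ : ∀ s, 0 ≤ s → s ≤ ρ₁ → ω₁ s ≤ η / (8 * T ^ 2))
    (hρ₂ : ∀ s, 0 ≤ s → s ≤ ρ₂ → ω₂ s ≤ η / (8 * T ^ 2))
    {k : E d → ℝ} (hk : ContDiff ℝ 2 k) (hk1 : ∀ x, ‖fderiv ℝ k x‖ ≤ ν)
    (hk2 : ∀ x, ‖fderiv ℝ (fderiv ℝ k) x‖ ≤ ν)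
    (hkn : ∀ x ∈ frontier D, ∀ n ∈ normals D x, fderiv ℝ k x n ≤ -c₁)
    {K : Set (ℝ × E d)} (hK : IsCompact K) (hKD : K ⊆ Ioc 0 T ×ˢ closure D)
    {U V : ℝ × E d → ℝ} (hU : ∀ z, U z = u z.1 z.2 - η / z.1 - k z.2)
    (hV : ∀ z, V z = v z.1 z.2 + η / z.1 + k z.2) (hUc : UpperSemicontinuousOn U K)
    (hVc : LowerSemicontinuousOn V K) (hb : ∀ z ∈ K, ∀ w ∈ K, U z - V w ≤ b)
    (hloc : ∀ z ∈ K, ∀ w ∈ K, ℓ ≤ U z - V w →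
      (∀ᶠ y in nhds z, y ∈ Ioo 0 T ×ˢ closure D → y ∈ K) ∧
      (∀ᶠ y in nhds w, y ∈ Ioo 0 T ×ˢ closure D → y ∈ K) ∧ v w.1 w.2 ≤ u z.1 z.2 ∧
      u z.1 z.2 ∈ Icc m M)
    (hterm : ∀ z ∈ K, z.1 = T → U z - V z < ℓ) {z₁ : ℝ × E d} (hz₁ : z₁ ∈ K)
    (hz₁' : 2 * ℓ ≤ U z₁ - V z₁) : False := by
  obtain ⟨e, he⟩ : ∃ e : ℝ, e = η / (8 * T ^ 2) := ⟨_, rfl⟩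
  rw [← he] at hρ₁ hρ₂
  have he0 : 0 < e := by rw [he]; positivity
  have hr₀ : 0 < r₀ := hA.1
  -- The target is |x − y| ≤ s and α|x − y|² ≤ s²: 3s ≤ ρ₂ serves (H3), and s²/(8r₀) ≤ c₁/4 bounds
  -- the wrong-signed part of the normal derivative.
  obtain ⟨s, hs0, hs1, hs2, hs3⟩ : ∃ s : ℝ, 0 < s ∧ s ≤ 1 ∧ 3 * s ≤ ρ₂ ∧
      s ^ 2 / (8 * r₀) ≤ c₁ / 4 := by
    refine ⟨min 1 (min (ρ₂ / 3) (2 * r₀ * c₁)), by positivity, min_le_left _ _, ?_, ?_⟩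
    · have : min 1 (min (ρ₂ / 3) (2 * r₀ * c₁)) ≤ ρ₂ / 3 :=
        (min_le_right _ _).trans (min_le_left _ _)
      linarith
    · have h0 : 0 < min 1 (min (ρ₂ / 3) (2 * r₀ * c₁)) := by positivity
      have h4 : min 1 (min (ρ₂ / 3) (2 * r₀ * c₁)) ≤ 2 * r₀ * c₁ :=
        (min_le_right _ _).trans (min_le_right _ _)
      have h5 : min 1 (min (ρ₂ / 3) (2 * r₀ * c₁)) ≤ 1 := min_le_left _ _
      rw [div_le_iff₀ (by positivity)]
      nlinarith
  -- the times stay away from `T`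
  obtain ⟨σ₂, hσ₂, htime⟩ : ∃ σ₂ : ℝ, 0 < σ₂ ∧ ∀ z ∈ K, ∀ w ∈ K, dist z w < σ₂ →
      ℓ ≤ U z - V w → z.1 < T ∧ w.1 < T := by
    have hcl : IsClosed {p : (ℝ × E d) × (ℝ × E d) | p.1.1 = T ∨ p.2.1 = T} :=
      (isClosed_eq (by fun_prop) continuous_const).union
        (isClosed_eq (by fun_prop) continuous_const)
    have hdc : Continuous fun p : (ℝ × E d) × (ℝ × E d) => dist p.1 p.2 := by fun_prop
    obtain ⟨σ₂, hσ₂, hlt⟩ := exists_pos_forall_lt ((hK.prod hK).inter_right hcl)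
      ((upperSemicontinuousOn_doubling hUc hVc).mono inter_subset_left) hdc.continuousOn
      (fun p _ => dist_nonneg) (b := ℓ) (by
        rintro ⟨z, w⟩ ⟨⟨hz, hw⟩, hzw⟩ h0
        obtain rfl : z = w := dist_eq_zero.1 h0
        exact hterm z hz (hzw.elim id id))
    refine ⟨σ₂, hσ₂, fun z hz w hw hd hl => ?_⟩
    constructor
    · refine lt_of_le_of_ne (hKD hz).1.2 fun h0 => ?_
      exact absurd (hlt (z, w) ⟨⟨hz, hw⟩, Or.inl h0⟩ hd) (not_lt.2 hl)
    · refine lt_of_le_of_ne (hKD hw).1.2 fun h0 => ?_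
      exact absurd (hlt (z, w) ⟨⟨hz, hw⟩, Or.inr h0⟩ hd) (not_lt.2 hl)
  obtain ⟨α₀, hα₀⟩ := exists_penalization_le hK hUc hVc hb hz₁ (by linarith)
    (by positivity : 0 < s ^ 2 / 8) (half_pos hσ₂)
  obtain ⟨α, hα, hα2⟩ : ∃ α : ℝ, α₀ ≤ α ∧ 2 ≤ α := ⟨max α₀ 2, le_max_left _ _, le_max_right _ _⟩
  -- After the shift the parameter is β ≤ 2α, so Hessians are bounded by 3β ≤ 6α, and gradients β(x
  -- − y) by 2α because |x − y| ≤ 1.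
  obtain ⟨S, hS, hSmem⟩ := exists_isCompact_sym d (6 * α)
  obtain ⟨σ₃, hσ₃, htm⟩ := hH.exists_time_modulus
    (P := (Prod.snd '' K) ×ˢ Icc m M ×ˢ Metric.closedBall (0 : E d) (2 * α) ×ˢ S)
    ((hK.image continuous_snd).prod (isCompact_Icc.prod ((isCompact_closedBall _ _).prod hS)))
    (by
      rintro ⟨x, p⟩ ⟨⟨z, hz, hzx⟩, -⟩
      simp only at hzx ⊢
      rw [← hzx]
      exact (hKD hz).2) he0
  -- The penalty gives κ(t₀ − s₀)² ≤ s²/4, so this κ brings the times within σ₃/2 of each other.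
  obtain ⟨κ, hκ, hκ2⟩ : ∃ κ : ℝ, α₀ ≤ κ ∧ s ^ 2 / σ₃ ^ 2 + 1 ≤ κ :=
    ⟨max α₀ _, le_max_left _ _, le_max_right _ _⟩
  have hα0 : 0 < α := by linarith
  have hκ0 : 0 < κ := by
    have : 0 ≤ s ^ 2 / σ₃ ^ 2 := by positivity
    linarith
  obtain ⟨z₀, hz₀, w₀, hw₀, hmax⟩ := exists_doubling_max hK ⟨z₁, hz₁⟩ hUc hVc κ α
  obtain ⟨hd₀, hpen⟩ := hα₀ α κ hα hκ z₀ hz₀ w₀ hw₀ hmax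
  have hpt : 0 ≤ κ / 2 * (z₀.1 - w₀.1) ^ 2 := by positivity
  have hpx : 0 ≤ α / 2 * ‖z₀.2 - w₀.2‖ ^ 2 := by positivity
  have hpx' : α * ‖z₀.2 - w₀.2‖ ^ 2 ≤ s ^ 2 / 4 := by linarith only [hpen, hpt]
  have hpt' : |z₀.1 - w₀.1| < σ₃ / 2 := by
    by_contra! hcon
    have h5 : (σ₃ / 2) ^ 2 ≤ (z₀.1 - w₀.1) ^ 2 := by
      rw [← sq_abs (z₀.1 - w₀.1)]; gcongr
    have h6 : (s ^ 2 / σ₃ ^ 2 + 1) * (σ₃ / 2) ^ 2 ≤ κ * (z₀.1 - w₀.1) ^ 2 := by gcongr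
    have h7 : (s ^ 2 / σ₃ ^ 2 + 1) * (σ₃ / 2) ^ 2 = s ^ 2 / 4 + σ₃ ^ 2 / 4 := by
      field_simp; norm_num
    have h8 : 0 < σ₃ ^ 2 := by positivity
    linarith only [h6, h7, h8, hpen, hpx]
  have hval₀ := hmax z₁ hz₁ z₁ hz₁
  rw [sub_self, sub_self, norm_zero, zero_pow two_ne_zero, mul_zero, mul_zero, add_zero,
    sub_zero] at hval₀
  obtain ⟨θ, hθ0, t1, t2, t3, t4, t5, t6, t7, t8⟩ : ∃ θ : ℝ, 0 < θ ∧ 1 * θ < 1 ∧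
      (16 * α) * θ < s ^ 2 ∧ (1 + 2 * α) * θ < c₁ / 4 ∧ 4 * θ < σ₃ ∧ 4 * θ < σ₂ ∧ 1 * θ < ℓ ∧
      2 * θ < e ∧ (2 + 3 * α) * θ < ρ₁ / 2 := by
    have hev : ∀ c b : ℝ, 0 < b → ∀ᶠ θ : ℝ in nhdsWithin 0 (Ioi 0), c * θ < b := fun c b hb => by
      have : Filter.Tendsto (fun θ : ℝ => c * θ) (nhdsWithin 0 (Ioi 0)) (nhds (c * 0)) :=
        ((continuous_const.mul continuous_id).tendsto 0).mono_left nhdsWithin_le_nhds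
      exact this.eventually (gt_mem_nhds (by simpa using hb))
    have hpos : ∀ᶠ θ : ℝ in nhdsWithin 0 (Ioi 0), 0 < θ := self_mem_nhdsWithin
    exact (hpos.and ((hev 1 1 one_pos).and ((hev _ _ (by positivity)).and
      ((hev _ _ (by positivity)).and ((hev _ _ hσ₃).and ((hev _ _ hσ₂).and ((hev _ _ hℓ).and
      ((hev _ _ he0).and (hev _ _ (half_pos hρ₁0)))))))))).exists
  rw [one_mul] at t1 t6
  obtain ⟨z, hz, w, hw, a, a', p, q, B, C, X, Y, hzz, hww, ha, ha', hp, hq, hval, hB, hC, hBX, hCY,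
    hXY, hX, hY, hjz, hjw⟩ := exists_parabolic_jets hK hUc hVc hz₀ hw₀ hα0 hκ0 hmax hθ0
  have hz1 : |z.1 - z₀.1| ≤ θ := (norm_fst_le (z - z₀)).trans hzz.le
  have hz2 : ‖z.2 - z₀.2‖ ≤ θ := (norm_snd_le (z - z₀)).trans hzz.le
  have hw1 : |w.1 - w₀.1| ≤ θ := (norm_fst_le (w - w₀)).trans hww.le
  have hw2 : ‖w.2 - w₀.2‖ ≤ θ := (norm_snd_le (w - w₀)).trans hww.le
  -- The doubled maximum is at least 2ℓ, and the approximation loses less than θ < ℓ.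
  have hlev : ℓ ≤ U z - V w := by linarith only [hval, hval₀, hz₁', t6]
  obtain ⟨hKz, hKw, hvu, hum⟩ := hloc z hz w hw hlev
  have hdist : dist z w < σ₂ := by
    have h4 : dist z w ≤ dist z z₀ + dist z₀ w₀ + dist w₀ w := dist_triangle4 _ _ _ _
    rw [dist_eq_norm z z₀, dist_comm w₀ w, dist_eq_norm w w₀] at h4
    linarith only [h4, hzz, hww, hd₀, t5]
  obtain ⟨hzT, hwT⟩ := htime z hz w hw hdist hlev
  have hzI : z.1 ∈ Ioo 0 T := ⟨(hKD hz).1.1, hzT⟩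
  have hwI : w.1 ∈ Ioo 0 T := ⟨(hKD hw).1.1, hwT⟩
  have hzD : z.2 ∈ closure D := (hKD hz).2
  have hwD : w.2 ∈ closure D := (hKD hw).2
  have hts : |w.1 - z.1| < σ₃ := by
    have h4 : w.1 - z.1 = (w.1 - w₀.1) - (z.1 - z₀.1) - (z₀.1 - w₀.1) := by ring
    rw [h4]
    refine (abs_sub _ _).trans_lt ?_
    have h5 := abs_sub (w.1 - w₀.1) (z.1 - z₀.1)
    linarith only [h5, hz1, hw1, hpt', t4]
  obtain ⟨r, hr⟩ : ∃ r : ℝ, r = ‖z.2 - w.2‖ := ⟨_, rfl⟩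
  have hr0 : 0 ≤ r := hr ▸ norm_nonneg _
  have hαr : α * r ^ 2 ≤ s ^ 2 := by
    have h4 : r ≤ ‖z₀.2 - w₀.2‖ + 2 * θ := by
      have h5 : z.2 - w.2 = (z₀.2 - w₀.2) + ((z.2 - z₀.2) - (w.2 - w₀.2)) := by abel
      rw [hr, h5]
      refine (norm_add_le _ _).trans (add_le_add le_rfl ?_)
      rw [two_mul]
      exact (norm_sub_le _ _).trans (add_le_add hz2 hw2)
    exact mul_sq_le_of_perturbation hα0 hθ0 hr0 t1.le t2.le hpx' h4
  have hrs : r ≤ s := le_of_mul_sq_le hα2 hr0 hs0.le hαr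
  obtain ⟨g, Q, hg, hQ, hgν, hQν⟩ := exists_gradient_hessian hk z.2 (hk1 _) (hk2 _)
  obtain ⟨g', Q', hg', hQ', hgν', hQν'⟩ := exists_gradient_hessian hk w.2 (hk1 _) (hk2 _)
  obtain ⟨hM, hYb⟩ := matrixIneq_shift (by linarith only [hα2]) hθ0.le hXY hX hY
  have hpn := norm_sub_shift_le hα0.le hz2 hw2 hp.le
  have hqn := norm_sub_shift_le hα0.le hz2 hw2 hq.le
  have hunit : ∀ x, ∀ n ∈ normals D x, ‖n‖ = 1 := fun x n hn => by
    obtain ⟨ϱ, -, hϱ⟩ := mem_iUnion₂.1 hn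
    exact hϱ.1
  have hquot : α * (r ^ 2 / (8 * r₀)) ≤ c₁ / 4 := by
    rw [← mul_div_assoc]
    exact (div_le_div_of_nonneg_right hαr (by positivity)).trans hs3
  -- At a boundary point the normal derivative is at most c₁/4 from replacing p by α(x − y), plus
  -- c₁/4 from the exterior sphere, minus c₁ from k. The total −c₁/2 excludes the boundary
  -- alternative; for v the signs are reversed.
  have hsub := hu.le_of_jet hk hzI hzD hB hBX hg hQ (η := η) (a := a) (p := p) (by
    filter_upwards [hjz, hKz] with y hy hy' hyD
    have := hy (hy' hyD)
    rwa [hU, hU] at this) (fun hzf => by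
    refine normalInf_pos (hA.2 _ hzf).2 (half_pos hc₁) fun n hn => ?_
    have h4 := inner_normal_le hA hzf hwD hn
    rw [← hr] at h4
    have h5 := (real_inner_le_norm (p - α • (z.2 - w.2)) n).trans
      (mul_le_mul_of_nonneg_right hpn (norm_nonneg n))
    rw [hunit _ n hn, mul_one, inner_sub_left, real_inner_smul_left] at h5
    have h6 := hkn _ hzf n hn
    rw [hg] at h6
    have h7 := mul_le_mul_of_nonneg_left h4 hα0.le
    rw [inner_add_left]
    linarith only [h5, h6, h7, hquot, t3])
  have hsup := hv.le_of_jet hk hwI hwD hC hCY hg' hQ' (η := η) (a := a') (p := q) (by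
    filter_upwards [hjw, hKw] with y hy hy' hyD
    have := hy (hy' hyD)
    rwa [hV, hV] at this) (fun hwf => by
    refine normalSup_neg (hA.2 _ hwf).2 (half_pos hc₁) fun n hn => ?_
    have h4 := inner_normal_le hA hwf hzD hn
    rw [norm_sub_rev, ← hr, ← neg_sub, inner_neg_left] at h4
    have h5 := (real_inner_le_norm (-(q - α • (z.2 - w.2))) n).trans
      (mul_le_mul_of_nonneg_right ((norm_neg _).trans_le hqn) (norm_nonneg n))
    rw [hunit _ n hn, mul_one, inner_neg_left, inner_sub_left, real_inner_smul_left] at h5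
    have h6 := hkn _ hwf n hn
    rw [hg'] at h6
    have h7 := mul_le_mul_of_nonneg_left h4 hα0.le
    rw [inner_sub_left]
    linarith only [h5, h6, h7, hquot, t3])
  -- The error θ of the approximate theorem on sums is paid for by replacing α by β in the matrix
  -- inequality; the gradient then moves by at most αθ.
  obtain ⟨β, hβ⟩ : ∃ β : ℝ, β = α * (1 + θ) := ⟨_, rfl⟩
  rw [← hβ] at hM hYb
  have hβα : β ≤ 2 * α := by rw [hβ]; nlinarith only [hα0, t1]
  have hβ1 : 1 < β := by rw [hβ]; nlinarith only [hα2, hθ0]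
  have hshift : ∀ y : E d, ‖y - β • (z.2 - w.2)‖ ≤ ‖y - α • (z.2 - w.2)‖ + α * θ := fun y => by
    have h4 : y - β • (z.2 - w.2) = (y - α • (z.2 - w.2)) - (α * θ) • (z.2 - w.2) := by
      rw [hβ, mul_add, mul_one, add_smul]; abel
    rw [h4]
    refine (norm_sub_le _ _).trans ?_
    rw [norm_smul, ← hr, Real.norm_of_nonneg (by positivity)]
    have h5 : α * θ * r ≤ α * θ * 1 := by gcongr; exact hrs.trans hs1
    linarith only [h5]
  have hone : ‖opOf (θ • (1 : Matrix (Fin d) (Fin d) ℝ))‖ ≤ θ := by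
    refine ContinuousLinearMap.opNorm_le_bound _ hθ0.le fun a => ?_
    rw [opOf_smul_one, norm_smul, Real.norm_of_nonneg hθ0.le]
  have hfin := hamiltonian_sub_le hH h1 h2 hω₂ h3 hρ₁ hρ₂ hzI hwI hzD hwD hvu hβ1 hM
    (p := p + g) (q := q - g') (X := ⟨X.1 + Q.1, X.isSymm_add Q⟩)
    (Y := ⟨Y.1 - Q'.1, Y.isSymm_sub Q'⟩)
    (by
      have h4 : X.1 + Q.1 - (X.1 - θ • 1) = Q.1 + θ • 1 := by abel
      have h5 : p + g - β • (z.2 - w.2) = (p - β • (z.2 - w.2)) + g := by abel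
      simp only [h4, h5]
      have h6 : ‖opOf (Q.1 + θ • 1)‖ ≤ ν + θ := by
        rw [opOf, map_add]
        exact (norm_add_le _ _).trans (add_le_add hQν hone)
      have h7 := norm_add_le (p - β • (z.2 - w.2)) g
      have h8 := hshift p
      linarith only [h6, h7, h8, hpn, hgν, hν, t8])
    (by
      have h4 : Y.1 - Q'.1 - (Y.1 + θ • 1) = -(Q'.1 + θ • 1) := by abel
      have h5 : q - g' - β • (z.2 - w.2) = (q - β • (z.2 - w.2)) - g' := by abel
      simp only [h4, h5]
      have h6 : ‖opOf (-(Q'.1 + θ • 1))‖ ≤ ν + θ := by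
        rw [opOf, map_neg, norm_neg, map_add]
        exact (norm_add_le _ _).trans (add_le_add hQν' hone)
      have h7 := norm_sub_le (q - β • (z.2 - w.2)) g'
      have h8 := hshift q
      linarith only [h6, h7, h8, hqn, hgν', hν, t8])
    (by
      rw [← hr]
      exact mul_one_add_mul_le hβα hr0 hrs hs1 hαr hs2)
    (by
      refine htm z.1 (Ioo_subset_Icc_self hzI) w.1 (Ioo_subset_Icc_self hwI)
        (w.2, u z.1 z.2, β • (z.2 - w.2), _) ⟨mem_image_of_mem _ hw, hum, ?_, hSmem _ fun y => ?_⟩ hts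
      · rw [mem_closedBall_zero_iff, norm_smul, ← hr, Real.norm_of_nonneg (by linarith only [hβ1])]
        nlinarith only [hβα, hβ1, hr0, hrs, hs1]
      · exact (hYb y).trans
          (mul_le_mul_of_nonneg_right (by linarith only [hβα]) (sq_nonneg _)))
  have hzt : η / T ^ 2 ≤ η / z.1 ^ 2 := by
    have := hzI.1
    have := hzI.2
    gcongr
  have hwt : η / T ^ 2 ≤ η / w.1 ^ 2 := by
    have := hwI.1
    have := hwI.2
    gcongr
  -- Strictness contributes at least 2η/T² = 16e, while the Hamiltonians differ by at most 4e and
  -- the time slopes by less than 2θ < e.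
  have hη8 : η / T ^ 2 = 8 * e := by rw [he]; field_simp
  have h4 := (abs_lt.1 ha).2
  have h5 := (abs_lt.1 ha').1
  linarith only [h4, h5, hzt, hwt, hη8, hsub, hsup, hfin, t7, he0]

end Comparison
end NeumannComparison

/-! ### Choice of the perturbation and conclusion. -/

open NeumannComparison in
theorem theorem3p2 (d : ℕ) (T : ℝ) (hT : 0 < T) (D : Set (E d)) (hD : IsOpen D)
    (hDconn : IsConnected D) (r₀ : ℝ) (hA : CondA D r₀) (hB : CondB D) (hC : CondC D r₀)
    (H : Ham d) (hH : HamContinuous T D H)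
    (hH1 : HypH1 T D H) (hH2 : HypH2 T D H) (hH3 : HypH3 T D H)
    (h : E d → ℝ) (u v : ℝ → E d → ℝ)
    (hu : IsSubsolution T D H h u)
    (hu_bdd : ∃ M : ℝ, ∀ t ∈ Set.Ioc 0 T, ∀ x ∈ closure D, u t x ≤ M)
    (hv : IsSupersolution T D H h v)
    (hv_bdd : ∃ m : ℝ, ∀ t ∈ Set.Ioc 0 T, ∀ x ∈ closure D, m ≤ v t x) :
    ∀ t ∈ Set.Ioc 0 T, ∀ x ∈ closure D, u t x ≤ v t x := by
  intro t ht x hx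
  by_contra! hcon
  obtain ⟨M, hM⟩ := hu_bdd
  obtain ⟨m, hm⟩ := hv_bdd
  obtain ⟨ω₁, hω₁, h2⟩ := hH2
  obtain ⟨ω₂, hω₂, h3⟩ := hH3
  obtain ⟨c, hc⟩ : ∃ c : ℝ, c = u t x - v t x := ⟨_, rfl⟩
  have hc0 : 0 < c := by rw [hc]; exact sub_pos.2 hcon
  have ht0 : 0 < t := ht.1
  -- With η/t = c/16 and k(x) ≤ ν ≤ c/16, the perturbation costs at most c/4 at (t, x), so that U −
  -- V is still at least c/2 there.
  obtain ⟨η, hη⟩ : ∃ η : ℝ, η = c * t / 16 := ⟨_, rfl⟩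
  have hη0 : 0 < η := by rw [hη]; positivity
  have hηt : η / t = c / 16 := by rw [hη]; field_simp
  have he : 0 < η / (8 * T ^ 2) := by positivity
  obtain ⟨ρ₁, hρ₁0, hρ₁⟩ := hω₁.exists_pos he
  obtain ⟨ρ₂, hρ₂0, hρ₂⟩ := hω₂.exists_pos he
  obtain ⟨ν, hν0, hν1, hν2⟩ : ∃ ν : ℝ, 0 < ν ∧ ν ≤ c / 16 ∧ ν ≤ ρ₁ / 4 :=
    ⟨min (c / 16) (ρ₁ / 4), by positivity, min_le_left _ _, min_le_right _ _⟩
  obtain ⟨k, c₁, hc₁, hk, hk0, hkx, hk1, hk2, hkR, hkn⟩ :=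
    hC.exists_perturbation hA.1 hν0 x
  obtain ⟨b, hb⟩ : ∃ b : ℝ, b = M - m + 2 * ν := ⟨_, rfl⟩
  have hmM : m + c ≤ M := by
    have := hM t ht x hx
    have := hm t ht x hx
    linarith
  have hb0 : 0 < b := by rw [hb]; linarith
  obtain ⟨R, hR⟩ := hkR b
  obtain ⟨U, hU⟩ : ∃ U : ℝ × E d → ℝ, ∀ z, U z = u z.1 z.2 - η / z.1 - k z.2 :=
    ⟨_, fun _ => rfl⟩
  obtain ⟨V, hV⟩ : ∃ V : ℝ × E d → ℝ, ∀ z, V z = v z.1 z.2 + η / z.1 + k z.2 :=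
    ⟨_, fun _ => rfl⟩
  have hquot : ∀ s ∈ Ioc 0 T, 0 < η / s := fun s hs => div_pos hη0 hs.1
  have hbd : ∀ z ∈ Ioc 0 T ×ˢ closure D, ∀ w ∈ Ioc 0 T ×ˢ closure D, U z - V w ≤ b := by
    intro z hz w hw
    rw [hU, hV, hb]
    have := hM z.1 hz.1 z.2 hz.2
    have := hm w.1 hw.1 w.2 hw.2
    have := hquot z.1 hz.1
    have := hquot w.1 hw.1
    have := hk0 z.2
    have := hk0 w.2
    linarith
  -- Where U − V ≥ c/4, both η/t and k are smaller than b, which bounds time from below and space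
  -- from above. Since 2ν ≤ c/8, the gap also forces v ≤ u.
  have hloc : ∀ z ∈ Ioc 0 T ×ˢ closure D, ∀ w ∈ Ioc 0 T ×ˢ closure D, c / 4 ≤ U z - V w →
      (η / b < z.1 ∧ ‖z.2‖ < R) ∧ (η / b < w.1 ∧ ‖w.2‖ < R) ∧ v w.1 w.2 ≤ u z.1 z.2 := by
    intro z hz w hw hl
    rw [hU, hV] at hl
    have a1 := hM z.1 hz.1 z.2 hz.2
    have a2 := hm w.1 hw.1 w.2 hw.2
    have a3 := hquot z.1 hz.1
    have a4 := hquot w.1 hw.1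
    have a5 := hk0 z.2
    have a6 := hk0 w.2
    refine ⟨⟨(div_lt_comm₀ hz.1.1 hb0).1 ?_, hR _ ?_⟩, ⟨(div_lt_comm₀ hw.1.1 hb0).1 ?_, hR _ ?_⟩, ?_⟩
    all_goals linarith
  have hval : 2 * (c / 4) ≤ U (t, x) - V (t, x) := by
    rw [hU, hV]
    simp only
    linarith
  -- The bounds in `hloc` are strict and those defining K are not, so K is a relative neighbourhood
  -- of every relevant point at times before T.
  obtain ⟨K, hKdef⟩ : ∃ K : Set (ℝ × E d),
      K = Icc (η / b) T ×ˢ (closure D ∩ Metric.closedBall 0 R) := ⟨_, rfl⟩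
  have hKD : K ⊆ Ioc 0 T ×ˢ closure D := by
    rw [hKdef]
    exact prod_mono (fun s hs => ⟨(div_pos hη0 hb0).trans_le hs.1, hs.2⟩) inter_subset_left
  have hmem : ∀ z ∈ Ioc 0 T ×ˢ closure D, η / b < z.1 ∧ ‖z.2‖ < R → z ∈ K := fun z hz h1 => by
    rw [hKdef]
    exact ⟨⟨h1.1.le, hz.1.2⟩, hz.2, mem_closedBall_zero_iff.2 h1.2.le⟩
  have hev : ∀ z : ℝ × E d, η / b < z.1 ∧ ‖z.2‖ < R →
      ∀ᶠ y in nhds z, y ∈ Ioo 0 T ×ˢ closure D → y ∈ K := fun z h1 => by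
    have e1 : ∀ᶠ y : ℝ × E d in nhds z, η / b < y.1 :=
      continuous_fst.continuousAt.eventually (lt_mem_nhds h1.1)
    have e2 : ∀ᶠ y : ℝ × E d in nhds z, ‖y.2‖ < R :=
      continuous_snd.norm.continuousAt.eventually (gt_mem_nhds h1.2)
    filter_upwards [e1, e2] with y hy1 hy2 hy
    exact hmem y ⟨Ioo_subset_Ioc_self hy.1, hy.2⟩ ⟨hy1, hy2⟩
  have hKc : IsCompact K := by
    rw [hKdef]
    exact isCompact_Icc.prod ((isCompact_closedBall _ _).inter_left isClosed_closure)
  have hcont : ContinuousOn (fun z : ℝ × E d => η / z.1 + k z.2) K :=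
    (continuousOn_const.div continuous_fst.continuousOn fun z hz => (hKD hz).1.1.ne').add
      (hk.continuous.comp continuous_snd).continuousOn
  have hUc : UpperSemicontinuousOn U K := by
    have h4 := (hu.usc.mono hKD).add hcont.neg.upperSemicontinuousOn
    rw [show U = fun z : ℝ × E d => u z.1 z.2 + -(η / z.1 + k z.2) from
      funext fun z => by rw [hU]; ring]
    exact h4
  have hVc : LowerSemicontinuousOn V K := by
    have h4 := (hv.lsc.mono hKD).add hcont.lowerSemicontinuousOn
    rw [show V = fun z : ℝ × E d => v z.1 z.2 + (η / z.1 + k z.2) from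
      funext fun z => by rw [hV]; ring]
    exact h4
  have htx : (t, x) ∈ Ioc 0 T ×ˢ closure D := ⟨ht, hx⟩
  refine false_of_doubling hT hA hH hH1 h2 hω₂ h3 hu hv (ℓ := c / 4) (m := m) (M := M) hη0 hc₁
    hρ₁0 hρ₂0 (by positivity) (by linarith) hρ₁ hρ₂ hk hk1 hk2 hkn hKc hKD hU hV hUc hVc
    (fun z hz w hw => hbd z (hKD hz) w (hKD hw)) (fun z hz w hw hl => ?_) (fun z hz hzT => ?_)
    (hmem _ htx (hloc _ htx _ htx (by linarith)).1) hval
  · obtain ⟨h4, h5, h6⟩ := hloc z (hKD hz) w (hKD hw) hl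
    exact ⟨hev z h4, hev w h5, h6, (hm w.1 (hKD hw).1 w.2 (hKD hw).2).trans h6,
      hM z.1 (hKD hz).1 z.2 (hKD hz).2⟩
  -- At time T the terminal conditions give u ≤ h ≤ v, hence U − V < 2ν ≤ c/8.
  · have h4 := hu.terminal z.2 (hKD hz).2
    have h5 := hv.terminal z.2 (hKD hz).2
    have h6 := hquot z.1 (hKD hz).1
    have h7 := hk0 z.2
    rw [hU, hV]
    rw [hzT] at h6 ⊢
    linarith
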